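/- **Setting.** Let $U\subset\mathbb R^3$ be a nonempty connected open set with coordinates $(x,y,z)$; all functions are smooth. Let $\varphi(x,y,z)=\lambda(x,y)+\mu(z)$ on $U$ with $\sin\varphi\cos\varphi\neq0$ and $$\lambda_{xx}-\lambda_{yy}=\tfrac{c_1^2}{2}\sin 2\lambda,\qquad \mu\equiv0\ \text{ or }\ \bigl(\mu_z\neq0\text{ everywhere and }\mu_z^2=c_2^2-c_1^2\sin^2\mu\bigr),$$ where $c_1,c_2$ are non-zero constants. Let $f:U\to\mathbb R^4$ be a generic conformally flat hypersurface with canonical Guichard net $g=\cos^2\varphi\,dx^2+\sin^2\varphi\,dy^2+dz^2$: its first fundamental form is $P^2g$ with $P>0$, $(x,y,z)$ are curvature line coordinates, and with respect to a unit normal field $N$ (so $N_x=-\kappa_1f_x$, $N_y=-\kappa_2f_y$, $N_z=-\kappa_3f_z$) the principal curvatures satisfy $\kappa_1=P^{-1}\tan\varphi+\kappa_3$ and $\kappa_2=-P^{-1}\cot\varphi+\kappa_3$. Put $$X_\gamma=P^{-1}f_z,\quad a=\frac{(P^{-1})_x}{\cos\varphi},\quad b=\frac{(P^{-1})_y}{\sin\varphi},\quad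 K=-(P^{-1})_z+\kappa_3\varphi_z,\quad A=-X_\gamma+\varphi_zN .$$ Suppose $f$ is a normal form, i.e. it has one of the following structures. (a) For each $z$ the surface $f(\cdot,\cdot,z)$ lies in a hyperplane $H(z)$ whose unit normal $\boldsymbol B$ does not depend on $z$. (b) For each $z$ the surface $f(\cdot,\cdot,z)$ lies in a linear hyperplane $H(z)$ whose unit normal $\boldsymbol B(z)$ moves on the unit circle of a linear plane $L$. (c) The surfaces $f(\cdot,\cdot,z)$ lie on $3$-spheres centered at the origin. "Independent of $z$" means constant on each segment in the $z$-direction contained in $U$. "Not locally zero" means not identically zero on any nonempty open subset of $U$. A "surface" is a smooth immersed surface in $(x,y)$, and $T$ denotes a linear isometry of $\mathbb R^4$. **Proposition 4.2.** **(1) Structure (a).** If $\mu\equiv0$: $\kappa_3\equiv0$, $c_1^2=1$, $P$ is a positive constant, and $X_\gamma=\varepsilon\boldsymbol B$ on $U$ with a constant sign $\varepsilon=\pm1$. For every $T$ with $T(X_\gamma)=(0,0,0,1)$ there are a surface $\tilde f$ in $\mathbb R^3$, independent of $z$, and a constant $s$ with $Tf=(\tilde f(x,y),Pz+s)$. If $\mu_z\ne0$: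 there is a constant $C\neq0$ with $P^{-1}=C\cos\mu(z)>0$ and $\kappa_3=-C\sin\mu(z)$; moreover $c_1^2-c_2^2-1=0$, and $-A/\sqrt{1+\mu_z^2}=\varepsilon\boldsymbol B$ on $U$ with a constant sign $\varepsilon$. For every $T$ with $T(\varepsilon\boldsymbol B)=(0,0,0,1)$ one has $Tf=(\tilde f(x,y,z),f^4(z))$ with $z$-dependent $(x,y)$-surfaces $\tilde f$ in $\mathbb R^3$ and $(f^4)'(z)=P/\sqrt{1+\mu_z^2}$, which equals $(Cc_1\cos^2\mu)^{-1}$ where $c_1\cos\mu>0$. **(2) Structure (b).** If $\mu\equiv0$: $\kappa_3$ and $P$ are independent of $z$, $P^2(a^2+b^2+\kappa_3^2)=c_1^2-1>0$, and neither $\kappa_3$ nor $a^2+b^2$ is locally zero. At each point $X_\gamma=\pm\boldsymbol B(z)$. Put $\omega=\sqrt{c_1^2-1}$ and $f^1=P/\omega>0$. For every $z_0\in\mathbb R$ there is $T$ mapping $L$ into the plane of the first two coordinates, with $TX_\gamma=(-\sin\omega(z-z_0),\cos\omega(z-z_0),0,0)$, and there are functions $f^3,f^4$ independent of $z$, such that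 $(f^1,0,f^3,f^4)$ is a surface and $$Tf=f^1\,(\cos\omega(z-z_0),\sin\omega(z-z_0),0,0)+(0,0,f^3,f^4).$$ It does not happen that $\kappa_1(P^{-1})_x=\kappa_2(P^{-1})_y\equiv0$ on $U$. If $\mu_z\neq0$: there are functions $C,D$ independent of $z$ with $$P^{-1}=C\cos\mu+D\sin\mu,\qquad \kappa_3=-C\sin\mu+D\cos\mu,\qquad C^2(c_1^2-c_2^2-1)-D^2(c_2^2+1)=a^2+b^2,$$ and $c_1^2-c_2^2-1>0$. The function $a^2+b^2$ is independent of $z$ and not locally zero. At each point $-A/\sqrt{1+\mu_z^2}=\pm\boldsymbol B(z)$. Put $f^1=P\sqrt{(1+\mu_z^2)/((1+c_2^2)(c_1^2-c_2^2-1))}>0$. For every $z_0$ in the projection of $U$ to the $z$-axis there are $\rho$ with $\rho(z_0)=0$, $\rho'=\sqrt{(1+c_2^2)(c_1^2-c_2^2-1)}/(1+\mu_z^2)$, and $T$ mapping $L$ into the plane of the first two coordinates, with $T(-A/\sqrt{1+\mu_z^2})=(-\sin\rho(z),\cos\rho(z),0,0)$, and functions $f^3,f^4$ of $(x,y,z)$,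 such that $(f^1,0,f^3,f^4)$ is a family of $z$-dependent $(x,y)$-surfaces and $$Tf=f^1\,(\cos\rho(z),\sin\rho(z),0,0)+(0,0,f^3,f^4).$$ If $\lambda$ is not constant, then it does not happen that $\kappa_1(P^{-1})_x=\kappa_2(P^{-1})_y\equiv0$ on $U$. **(3) Structure (c).** If $\mu\equiv0$: $\kappa_3\equiv0$, $X_\gamma$ is independent of $z$, $1-c_1^2>0$, and with $c_3=\sqrt{1-c_1^2}$ there are a sign $\varepsilon=\pm1$ and a constant $C>0$ such that $$P=Ce^{\varepsilon c_3z},\qquad K=\varepsilon c_3P^{-1}\neq0,\qquad f=K^{-1}X_\gamma=\varepsilon\,\tfrac1{c_3}\,P\,X_\gamma .$$ If $\mu_z\ne0$: $(\kappa_3)_z\neq0$ everywhere, $1+c_2^2-c_1^2>0$, and with $c_4=\sqrt{(1+c_2^2)(1+c_2^2-c_1^2)}$ there is a sign $\varepsilon=\pm1$ such that for every $z_0$ in the projection of $U$ to the $z$-axis there is a constant $C>0$ with $$P=\frac{C}{\sqrt{1+\mu_z^2}}\exp\Bigl(\varepsilon c_4\int_{z_0}^z\frac{dt}{1+\mu_z(t)^2}\Bigr),$$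 and $$\kappa_3=\frac{\varepsilon c_4\mu_z+\mu_{zz}}{1+\mu_z^2}\,P^{-1},\qquad K=\varepsilon c_4P^{-1}\neq0,\qquad f=-K^{-1}A=-\varepsilon\,\tfrac1{c_4}\,P\,A .$$ In (3), $\varepsilon$ is the sign of $K$; replacing the coordinate $z$ by $-z$ changes $\varepsilon$ to $-\varepsilon$, so $\varepsilon=1$ can always be arranged. -/

import Mathlib

open scoped ContDiff

namespace GuichardNet

noncomputable section

/-- The coordinate space with coordinates `(x, y, z)`. -/
abbrev Coord : Type := ℝ × ℝ × ℝ

/-- The ambient Euclidean space `ℝ⁴`. -/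
abbrev E4 : Type := EuclideanSpace ℝ (Fin 4)

section Derivatives

variable {F : Type*} [NormedAddCommGroup F] [NormedSpace ℝ F]

/-- Partial derivative in `x`. -/
def dx (h : Coord → F) (p : Coord) : F := fderiv ℝ h p (1, 0, 0)

/-- Partial derivative in `y`. -/
def dy (h : Coord → F) (p : Coord) : F := fderiv ℝ h p (0, 1, 0)

/-- Partial derivative in `z`. -/
def dz (h : Coord → F) (p : Coord) : F := fderiv ℝ h p (0, 0, 1)

/-- Partial derivative in `x` of a function of `(x, y)`. -/
def dx₂ (h : ℝ × ℝ → F) (q : ℝ × ℝ) : F := fderiv ℝ h q (1, 0)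

/-- Partial derivative in `y` of a function of `(x, y)`. -/
def dy₂ (h : ℝ × ℝ → F) (q : ℝ × ℝ) : F := fderiv ℝ h q (0, 1)

/-- `h` restricts to a family, with parameter `z`, of smooth immersed `(x, y)`-surfaces. -/
def IsSurfaceFamily (U : Set Coord) (h : Coord → F) : Prop :=
  ContDiffOn ℝ ∞ h U ∧ ∀ p ∈ U, LinearIndependent ℝ ![dx h p, dy h p]

end Derivatives

/-- The projection of `U` to the `(x, y)`-plane. -/
def projXY (U : Set Coord) : Set (ℝ × ℝ) := (fun p : Coord => (p.1, p.2.1)) '' U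

/-- The projection of `U` to the `z`-axis. -/
def projZ (U : Set Coord) : Set ℝ := (fun p : Coord => p.2.2) '' U

/-- `h` is independent of `z` on `U`: it is constant on every segment in the direction of `z` that
is contained in `U`. If each line in the direction of `z` meets `U` in an interval, this says
precisely that `h` is a function of `(x, y)` on `U`. -/
def IndepZ {F : Type*} (U : Set Coord) (h : Coord → F) : Prop :=
  ∀ x y z z' : ℝ, (∀ t ∈ Set.uIcc z z', (x, y, t) ∈ U) → h (x, y, z) = h (x, y, z')

/-- `h` does not vanish identically on any nonempty open subset of `U`. -/
def NotLocallyZero (U : Set Coord) (h : Coord → ℝ) : Prop :=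
  ∀ W : Set Coord, W ⊆ U → IsOpen W → W.Nonempty → ∃ p ∈ W, h p ≠ 0

/-- The function `φ(x, y, z) = λ(x, y) + μ(z)`. -/
def phi (lam : ℝ × ℝ → ℝ) (mu : ℝ → ℝ) (p : Coord) : ℝ := lam (p.1, p.2.1) + mu p.2.2

/-- The equations for `λ` and `μ`:
`λ_xx - λ_yy = (c₁² / 2) sin (2 λ)`, and `μ ≡ 0` or `μ_z ≠ 0`, `μ_z² = c₂² - c₁² sin² μ`. -/
structure IsSplitAngle (U : Set Coord) (lam : ℝ × ℝ → ℝ) (mu : ℝ → ℝ) (c₁ c₂ : ℝ) : Prop where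
  c₁_ne : c₁ ≠ 0
  c₂_ne : c₂ ≠ 0
  smooth_lam : ContDiffOn ℝ ∞ lam (projXY U)
  smooth_mu : ContDiffOn ℝ ∞ mu (projZ U)
  lam_eq : ∀ q ∈ projXY U,
    dx₂ (dx₂ lam) q - dy₂ (dy₂ lam) q = c₁ ^ 2 / 2 * Real.sin (2 * lam q)
  mu_eq : (∀ z ∈ projZ U, mu z = 0) ∨
    ∀ z ∈ projZ U, deriv mu z ≠ 0 ∧ deriv mu z ^ 2 = c₂ ^ 2 - c₁ ^ 2 * Real.sin (mu z) ^ 2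

/-- The first principal curvature `κ₁ = P⁻¹ tan φ + κ₃`. -/
def kappa₁ (φ P κ₃ : Coord → ℝ) (p : Coord) : ℝ := (P p)⁻¹ * Real.tan (φ p) + κ₃ p

/-- The second principal curvature `κ₂ = -P⁻¹ cot φ + κ₃`. -/
def kappa₂ (φ P κ₃ : Coord → ℝ) (p : Coord) : ℝ := -((P p)⁻¹ * Real.cot (φ p)) + κ₃ p

/-- `f : U → ℝ⁴` is a generic conformally flat hypersurface with (canonical) Guichard net
`g = cos² φ dx² + sin² φ dy² + dz²` and first fundamental form `P² g`. Here `(x, y, z)` are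
curvature line coordinates, `N` is the unit normal field, and the principal curvatures with
respect to `N` are `κ₁ = P⁻¹ tan φ + κ₃`, `κ₂ = -P⁻¹ cot φ + κ₃` and `κ₃`. They are pairwise
distinct because `sin φ cos φ ≠ 0`; this form of `κ₁`, `κ₂` says that the conformal fundamental
forms of `f` are `dx`, `dy`, `dz` up to sign, so that `f` is conformally flat. -/
structure IsGuichardHypersurface (U : Set Coord) (φ P κ₃ : Coord → ℝ) (f N : Coord → E4) :
    Prop where
  smooth_f : ContDiffOn ℝ ∞ f U
  smooth_N : ContDiffOn ℝ ∞ N U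
  smooth_P : ContDiffOn ℝ ∞ P U
  smooth_κ₃ : ContDiffOn ℝ ∞ κ₃ U
  P_pos : ∀ p ∈ U, 0 < P p
  angle : ∀ p ∈ U, Real.sin (φ p) * Real.cos (φ p) ≠ 0
  I_xx : ∀ p ∈ U, inner ℝ (dx f p) (dx f p) = P p ^ 2 * Real.cos (φ p) ^ 2
  I_yy : ∀ p ∈ U, inner ℝ (dy f p) (dy f p) = P p ^ 2 * Real.sin (φ p) ^ 2
  I_zz : ∀ p ∈ U, inner ℝ (dz f p) (dz f p) = P p ^ 2
  I_xy : ∀ p ∈ U, inner ℝ (dx f p) (dy f p) = 0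
  I_xz : ∀ p ∈ U, inner ℝ (dx f p) (dz f p) = 0
  I_yz : ∀ p ∈ U, inner ℝ (dy f p) (dz f p) = 0
  N_unit : ∀ p ∈ U, ‖N p‖ = 1
  N_x : ∀ p ∈ U, inner ℝ (N p) (dx f p) = 0
  N_y : ∀ p ∈ U, inner ℝ (N p) (dy f p) = 0
  N_z : ∀ p ∈ U, inner ℝ (N p) (dz f p) = 0
  weingarten_x : ∀ p ∈ U, dx N p = -(kappa₁ φ P κ₃ p • dx f p)
  weingarten_y : ∀ p ∈ U, dy N p = -(kappa₂ φ P κ₃ p • dy f p)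
  weingarten_z : ∀ p ∈ U, dz N p = -(κ₃ p • dz f p)

/-- The unit principal vector `X_γ = P⁻¹ f_z`. -/
def Xgamma (P : Coord → ℝ) (f : Coord → E4) (p : Coord) : E4 := (P p)⁻¹ • dz f p

/-- `a = (P⁻¹)_x / cos φ`. -/
def aFun (φ P : Coord → ℝ) (p : Coord) : ℝ := dx (fun q => (P q)⁻¹) p / Real.cos (φ p)

/-- `b = (P⁻¹)_y / sin φ`. -/
def bFun (φ P : Coord → ℝ) (p : Coord) : ℝ := dy (fun q => (P q)⁻¹) p / Real.sin (φ p)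

/-- `a² + b²`. -/
def absq (φ P : Coord → ℝ) (p : Coord) : ℝ := aFun φ P p ^ 2 + bFun φ P p ^ 2

/-- `K = -(P⁻¹)_z + κ₃ φ_z`. -/
def Kfun (φ P κ₃ : Coord → ℝ) (p : Coord) : ℝ := -dz (fun q => (P q)⁻¹) p + κ₃ p * dz φ p

/-- `A = -X_γ + φ_z N`. -/
def Avec (φ P : Coord → ℝ) (f N : Coord → E4) (p : Coord) : E4 :=
  -Xgamma P f p + dz φ p • N p

/-- Structure (a): each `(x, y)`-surface of `f` lies in a hyperplane `H(z)` whose unit normal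
vector `B` is the same for all `z`. -/
def StructureA (U : Set Coord) (f : Coord → E4) (B : E4) : Prop :=
  ‖B‖ = 1 ∧ ∃ d : ℝ → ℝ, ∀ p ∈ U, inner ℝ B (f p) = d p.2.2

/-- Structure (b): each `(x, y)`-surface of `f` lies in a linear hyperplane `H(z)`, whose unit
normal vector `B(z)` stays on the unit circle of the linear plane `L`. -/
def StructureB (U : Set Coord) (f : Coord → E4) (L : Submodule ℝ E4) (B : ℝ → E4) : Prop :=
  Module.finrank ℝ L = 2 ∧ (∀ z ∈ projZ U, B z ∈ L ∧ ‖B z‖ = 1) ∧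
    ∀ p ∈ U, inner ℝ (B p.2.2) (f p) = 0

/-- Structure (c): the `(x, y)`-surfaces of `f` lie on `3`-spheres centered at the origin. -/
def StructureC (U : Set Coord) (f : Coord → E4) : Prop :=
  ∃ r : ℝ → ℝ, ∀ p ∈ U, f p ∈ Metric.sphere (0 : E4) (r p.2.2)

end

end GuichardNet

open GuichardNet

/-! Let e₁, e₂, e₃ = X_γ, N be the orthonormal frame of principal directions and normal.
Orthogonality of the net and the Weingarten equations determine all derivatives of the frame
(`IsCurvatureNet.frame_derivatives`). Written with the scale-free quantities α = Pa, β = Pb, σ =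
Pκ₃, τ = P(P⁻¹)_z they become `IsGuichardFrame`. Its integrability conditions are the equations of
Codazzi and Gauss. The Gauss equations combine to a wave equation for φ, and the equations for λ and
μ turn it into the relation `IsGuichardFrame.gauss_split`, from which λ has disappeared.

The extrinsic geometry of a slice z = const is carried by the vector −A = X_γ − μ_z N (`tilt`). It
is orthogonal to the slice, and along the slice its differential is K df, so every slice is umbilic
in this direction. If a slice lies in a hyperplane, then K = 0 there and the unit normal is ± the
normalized −A (`normal_of_hyperplane`). If the slices lie on spheres centered at the origin, then K
≠ 0 and f = −K⁻¹A (`center_of_sphere`).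

The motion of −A in the direction of z is governed by one constant Q (`IsSplitAngle.HasInvariant`),
a first integral of the equation of μ. With hyperplanes, Gauss and Codazzi give the unit normal the
squared speed Q / (1 + μ_z²)² (`inner_tiltUnit_z`); with spheres, PK is a constant k with k² = −Q
(`StructureC.invariants`). Hence the three structures correspond to Q = 0, Q > 0 and Q < 0, which
are the stated conditions on c₁ and c₂.

What remains is integration. If K = 0, then (P⁻¹, κ₃) turns by the angle −μ along z, which gives the
coefficients C and D. In structure (a) the vanishing speed is a sum of squares, so a = b = 0. In
structure (b) the normal rotates in L with known angular speed (`exists_rotation`), and f ⟂ normal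
fixes the component of f in L. In structure (c) the logarithmic derivative of P is known and
integrates to the exponential. -/

namespace GuichardNet

noncomputable section

/-! ### Directional derivatives -/

/-- The derivative of `h` at `p` in the direction `v`. -/
def dirD {F : Type*} [NormedAddCommGroup F] [NormedSpace ℝ F] (v : Coord) (h : Coord → F)
    (p : Coord) : F := fderiv ℝ h p v

/-- `h` is differentiable at `p`, with derivative `h'` in the direction `v`. -/
structure HasDir {F : Type*} [NormedAddCommGroup F] [NormedSpace ℝ F] (v : Coord) (h : Coord → F)
    (h' : F) (p : Coord) : Prop where
  diff : DifferentiableAt ℝ h p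
  eq : dirD v h p = h'

/-- The coordinate directions. -/
abbrev ex : Coord := (1, 0, 0)
abbrev ey : Coord := (0, 1, 0)
abbrev ez : Coord := (0, 0, 1)

section Calculus

variable {F : Type*} [NormedAddCommGroup F] [NormedSpace ℝ F]
variable {U : Set Coord} {v w p : Coord}

theorem smooth_differentiableAt {h : Coord → F} (hU : IsOpen U) (hh : ContDiffOn ℝ ∞ h U)
    (hp : p ∈ U) : DifferentiableAt ℝ h p :=
  (hh.contDiffAt (hU.mem_nhds hp)).differentiableAt (by simp)

theorem smooth_dirD {h : Coord → F} (hU : IsOpen U) (hh : ContDiffOn ℝ ∞ h U) (v : Coord) :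
    ContDiffOn ℝ ∞ (dirD v h) U :=
  (hh.fderiv_of_isOpen hU (m := ∞) (by simp)).clm_apply contDiffOn_const

theorem hasDir_of_smooth {h : Coord → F} (hU : IsOpen U) (hh : ContDiffOn ℝ ∞ h U)
    (v : Coord) (hp : p ∈ U) : HasDir v h (dirD v h p) p :=
  ⟨smooth_differentiableAt hU hh hp, rfl⟩

theorem dirD_congr {h k : Coord → F} (hU : IsOpen U) (hhk : ∀ q ∈ U, h q = k q) (hp : p ∈ U) :
    dirD v h p = dirD v k p := by
  have : h =ᶠ[nhds p] k := by
    filter_upwards [hU.mem_nhds hp] with q hq using hhk q hq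
  simp only [dirD, this.fderiv_eq]

/-! ### Differentiation rules in a fixed direction -/

namespace HasDir

theorem congr {h k : Coord → F} {h' : F} (hh : HasDir v h h' p) (hU : IsOpen U)
    (hhk : ∀ q ∈ U, k q = h q) (hp : p ∈ U) : HasDir v k h' p := by
  have e : k =ᶠ[nhds p] h := by
    filter_upwards [hU.mem_nhds hp] with q hq using hhk q hq
  exact ⟨hh.diff.congr_of_eventuallyEq e, (dirD_congr hU hhk hp).trans hh.eq⟩

theorem unique {h : Coord → F} {h' h'' : F} (h₁ : HasDir v h h' p) (h₂ : HasDir v h h'' p) :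
    h' = h'' := h₁.eq.symm.trans h₂.eq

theorem to_eq {h : Coord → F} {h' h'' : F} (h₁ : HasDir v h h' p) (e : h' = h'') :
    HasDir v h h'' p := e ▸ h₁

theorem const (c : F) : HasDir v (fun _ => c) 0 p :=
  ⟨differentiableAt_const c, by simp [dirD]⟩

theorem add {g h : Coord → F} {g' h' : F} (hg : HasDir v g g' p) (hh : HasDir v h h' p) :
    HasDir v (fun q => g q + h q) (g' + h') p :=
  ⟨hg.diff.add hh.diff, by
    rw [← hg.eq, ← hh.eq]; simp only [dirD]; rw [fderiv_fun_add hg.diff hh.diff]; rfl⟩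

theorem sub {g h : Coord → F} {g' h' : F} (hg : HasDir v g g' p) (hh : HasDir v h h' p) :
    HasDir v (fun q => g q - h q) (g' - h') p :=
  ⟨hg.diff.sub hh.diff, by
    rw [← hg.eq, ← hh.eq]; simp only [dirD]; rw [fderiv_fun_sub hg.diff hh.diff]; rfl⟩

theorem neg {g : Coord → F} {g' : F} (hg : HasDir v g g' p) :
    HasDir v (fun q => -g q) (-g') p :=
  ⟨hg.diff.neg, by rw [← hg.eq]; simp only [dirD]; rw [fderiv_fun_neg]; rfl⟩

theorem smul {g : Coord → ℝ} {h : Coord → F} {g' : ℝ} {h' : F} (hg : HasDir v g g' p)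
    (hh : HasDir v h h' p) : HasDir v (fun q => g q • h q) (g p • h' + g' • h p) p :=
  ⟨hg.diff.smul hh.diff, by
    rw [← hg.eq, ← hh.eq]; simp only [dirD]; rw [fderiv_fun_smul hg.diff hh.diff]; simp⟩

theorem mul {g h : Coord → ℝ} {g' h' : ℝ} (hg : HasDir v g g' p) (hh : HasDir v h h' p) :
    HasDir v (fun q => g q * h q) (g p * h' + g' * h p) p := hg.smul hh

theorem pow_two {g : Coord → ℝ} {g' : ℝ} (hg : HasDir v g g' p) :
    HasDir v (fun q => g q ^ 2) (2 * g p * g') p := by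
  have := hg.mul hg
  simp only [← _root_.pow_two] at this
  exact this.to_eq (by ring)

theorem comp {g : Coord → ℝ} {g' : ℝ} {u : ℝ → F} {u' : F} (hu : HasDerivAt u u' (g p))
    (hg : HasDir v g g' p) : HasDir v (fun q => u (g q)) (g' • u') p := by
  have h : HasFDerivAt (fun q => u (g q)) _ p := hu.hasFDerivAt.comp p hg.diff.hasFDerivAt
  refine ⟨h.differentiableAt, ?_⟩
  rw [← hg.eq]
  simp only [dirD]
  rw [h.fderiv]
  simp

theorem inv {g : Coord → ℝ} {g' : ℝ} (hg : HasDir v g g' p) (h0 : g p ≠ 0) :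
    HasDir v (fun q => (g q)⁻¹) (-g' / g p ^ 2) p :=
  (comp (hasDerivAt_inv h0) hg).to_eq (by simp; ring)

theorem cos {g : Coord → ℝ} {g' : ℝ} (hg : HasDir v g g' p) :
    HasDir v (fun q => Real.cos (g q)) (-(Real.sin (g p) * g')) p :=
  (comp (Real.hasDerivAt_cos _) hg).to_eq (by simp; ring)

theorem sin {g : Coord → ℝ} {g' : ℝ} (hg : HasDir v g g' p) :
    HasDir v (fun q => Real.sin (g q)) (Real.cos (g p) * g') p :=
  (comp (Real.hasDerivAt_sin _) hg).to_eq (by simp; ring)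

theorem inner {g h : Coord → E4} {g' h' : E4} (hg : HasDir v g g' p) (hh : HasDir v h h' p) :
    HasDir v (fun q => inner ℝ (g q) (h q)) (inner ℝ (g p) h' + inner ℝ g' (h p)) p :=
  ⟨hg.diff.inner ℝ hh.diff, by
    rw [← hg.eq, ← hh.eq]; simp only [dirD]; rw [fderiv_inner_apply ℝ hg.diff hh.diff]⟩

theorem clm {G : Type*} [NormedAddCommGroup G] [NormedSpace ℝ G] {g : Coord → F} {g' : F}
    (T : F →L[ℝ] G) (hg : HasDir v g g' p) : HasDir v (fun q => T (g q)) (T g') p := by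
  have h : HasFDerivAt (fun q => T (g q)) _ p := T.hasFDerivAt.comp p hg.diff.hasFDerivAt
  refine ⟨h.differentiableAt, ?_⟩
  rw [← hg.eq]
  simp only [dirD]
  rw [h.fderiv]
  rfl

end HasDir

theorem dirD_comm {h : Coord → F} (hU : IsOpen U) (hh : ContDiffOn ℝ ∞ h U) (hp : p ∈ U) :
    dirD v (dirD w h) p = dirD w (dirD v h) p := by
  have hd : DifferentiableAt ℝ (fderiv ℝ h) p :=
    ((hh.fderiv_of_isOpen hU (m := ∞) (by simp)).contDiffAt (hU.mem_nhds hp)).differentiableAt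
      (by simp)
  have key : ∀ a b : Coord, dirD a (dirD b h) p = fderiv ℝ (fderiv ℝ h) p a b := by
    intro a b
    simp only [dirD]
    change fderiv ℝ (fun q => fderiv ℝ h q b) p a = _
    rw [fderiv_clm_apply hd (differentiableAt_const b)]
    simp
  rw [key, key]
  exact ((hh.contDiffAt (hU.mem_nhds hp)).isSymmSndFDerivAt
    (by rw [minSmoothness_of_isRCLikeNormedField]
        exact WithTop.coe_le_coe.2 (le_top : (2 : ℕ∞) ≤ ⊤))).eq v w

/-- The compatibility condition for the derivatives of two vector fields. -/
theorem inner_compat {g h : Coord → E4} (hU : IsOpen U) (hg : ContDiffOn ℝ ∞ g U)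
    (hh : ContDiffOn ℝ ∞ h U) (hp : p ∈ U) {a b : ℝ}
    (ha : HasDir w (fun q => inner ℝ (dirD v g q) (h q)) a p)
    (hb : HasDir v (fun q => inner ℝ (dirD w g q) (h q)) b p) :
    a - b = inner ℝ (dirD v g p) (dirD w h p) - inner ℝ (dirD w g p) (dirD v h p) := by
  have h1 := ha.unique ((hasDir_of_smooth hU (smooth_dirD hU hg v) w hp).inner
    (hasDir_of_smooth hU hh w hp))
  have h2 := hb.unique ((hasDir_of_smooth hU (smooth_dirD hU hg w) v hp).inner
    (hasDir_of_smooth hU hh v hp))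
  -- The two terms with mixed second derivatives of `g` cancel. Only products of first derivatives
  -- remain, so integrability conditions can be read off from the first-order frame equations.
  rw [h1, h2, dirD_comm (v := w) (w := v) hU hg hp]
  ring

theorem coord_decomp (u : Coord) : u = u.1 • ex + u.2.1 • ey + u.2.2 • ez := by
  ext <;> simp

/-- A smooth function with vanishing partial derivatives on a connected open set is constant. -/
theorem eq_of_partials_zero {h : Coord → F} (hU : IsOpen U) (hUc : IsConnected U)
    (hx : ∀ q ∈ U, HasDir ex h 0 q) (hy : ∀ q ∈ U, HasDir ey h 0 q)
    (hz : ∀ q ∈ U, HasDir ez h 0 q) {q r : Coord} (hq : q ∈ U) (hr : r ∈ U) : h q = h r := by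
  refine hU.is_const_of_fderiv_eq_zero (𝕜 := ℝ) hUc.isPreconnected
    (fun q hq => (hx q hq).diff.differentiableWithinAt) ?_ hq hr
  intro q hq
  refine ContinuousLinearMap.ext fun u => ?_
  have h1 := (hx q hq).eq
  have h2 := (hy q hq).eq
  have h3 := (hz q hq).eq
  simp only [dirD] at h1 h2 h3
  rw [coord_decomp u]
  simp only [map_add, map_smul, h1, h2, h3]
  simp

theorem line_hasDerivAt {h : Coord → F} {h' : F} {x y t : ℝ}
    (hh : HasDir ez h h' (x, y, t)) : HasDerivAt (fun t => h (x, y, t)) h' t := by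
  have hl : HasDerivAt (fun t : ℝ => ((x, y, t) : Coord)) ez t :=
    (hasDerivAt_const t x).prodMk ((hasDerivAt_const t y).prodMk (hasDerivAt_id t))
  have := hh.diff.hasFDerivAt.comp_hasDerivAt t hl
  rw [← hh.eq]
  exact this

theorem indepZ_of_dz {h : Coord → F} (hz : ∀ q ∈ U, HasDir ez h 0 q) : IndepZ U h := by
  have key : ∀ x y z z' : ℝ, z ≤ z' → (∀ t ∈ Set.uIcc z z', (x, y, t) ∈ U) →
      h (x, y, z) = h (x, y, z') := by
    intro x y z z' hzz hU
    rw [Set.uIcc_of_le hzz] at hU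
    refine (constant_of_has_deriv_right_zero (f := fun t => h (x, y, t)) (a := z) (b := z')
      ?_ ?_ z' (Set.right_mem_Icc.2 hzz)).symm
    · exact fun t ht => (line_hasDerivAt (hz _ (hU t ht))).continuousAt.continuousWithinAt
    · exact fun t ht => (line_hasDerivAt (hz _ (hU t ⟨ht.1, ht.2.le⟩))).hasDerivWithinAt
  intro x y z z' hU
  rcases le_total z z' with hle | hle
  · exact key x y z z' hle hU
  · exact (key x y z' z hle (by rwa [Set.uIcc_comm])).symm

/-- A function that is constant on the slice of `U` through `p` has vanishing derivatives at `p`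
in the directions of the slice. -/
theorem dirD_eq_zero_of_slice {g : Coord → ℝ} {c : ℝ} (hU : IsOpen U) (hp : p ∈ U)
    (hg : DifferentiableAt ℝ g p) (hv : v.2.2 = 0)
    (hc : ∀ q ∈ U, q.2.2 = p.2.2 → g q = c) : dirD v g p = 0 := by
  have hl : HasDerivAt (fun t : ℝ => p + t • v) v 0 := by
    simpa using ((hasDerivAt_id (0 : ℝ)).smul_const v).const_add p
  have hl0 : p + (0 : ℝ) • v = p := by simp
  have h1 : HasDerivAt (fun t : ℝ => g (p + t • v)) (fderiv ℝ g p v) 0 := by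
    have := (hl0.symm ▸ hg.hasFDerivAt : HasFDerivAt g (fderiv ℝ g p) (p + (0 : ℝ) • v))
    exact this.comp_hasDerivAt 0 hl
  -- As `v` has no z-component, the line p + tv stays in the slice of `p`, and in `U` for small t.
  have h2 : (fun t : ℝ => g (p + t • v)) =ᶠ[nhds 0] fun _ => c := by
    have : ∀ᶠ t in nhds (0 : ℝ), p + t • v ∈ U :=
      hl.continuousAt.eventually_mem (by rw [hl0]; exact hU.mem_nhds hp)
    filter_upwards [this] with t ht
    exact hc _ ht (by simp [hv])
  exact h1.unique ((hasDerivAt_const (0 : ℝ) c).congr_of_eventuallyEq h2)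

end Calculus

/-! ### Orthonormal frames and orthogonal nets -/

/-- `e₁, e₂, e₃, e₄` is an orthonormal frame of `ℝ⁴`. -/
structure IsFrame (e₁ e₂ e₃ e₄ : E4) : Prop where
  i₁₁ : inner ℝ e₁ e₁ = 1
  i₂₂ : inner ℝ e₂ e₂ = 1
  i₃₃ : inner ℝ e₃ e₃ = 1
  i₄₄ : inner ℝ e₄ e₄ = 1
  i₁₂ : inner ℝ e₁ e₂ = 0
  i₁₃ : inner ℝ e₁ e₃ = 0
  i₁₄ : inner ℝ e₁ e₄ = 0
  i₂₃ : inner ℝ e₂ e₃ = 0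
  i₂₄ : inner ℝ e₂ e₄ = 0
  i₃₄ : inner ℝ e₃ e₄ = 0

namespace IsFrame

variable {e₁ e₂ e₃ e₄ : E4}

theorem i₂₁ (h : IsFrame e₁ e₂ e₃ e₄) : inner ℝ e₂ e₁ = 0 := by rw [real_inner_comm, h.i₁₂]
theorem i₃₁ (h : IsFrame e₁ e₂ e₃ e₄) : inner ℝ e₃ e₁ = 0 := by rw [real_inner_comm, h.i₁₃]
theorem i₄₁ (h : IsFrame e₁ e₂ e₃ e₄) : inner ℝ e₄ e₁ = 0 := by rw [real_inner_comm, h.i₁₄]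
theorem i₃₂ (h : IsFrame e₁ e₂ e₃ e₄) : inner ℝ e₃ e₂ = 0 := by rw [real_inner_comm, h.i₂₃]
theorem i₄₂ (h : IsFrame e₁ e₂ e₃ e₄) : inner ℝ e₄ e₂ = 0 := by rw [real_inner_comm, h.i₂₄]
theorem i₄₃ (h : IsFrame e₁ e₂ e₃ e₄) : inner ℝ e₄ e₃ = 0 := by rw [real_inner_comm, h.i₃₄]

theorem orthonormal (h : IsFrame e₁ e₂ e₃ e₄) : Orthonormal ℝ ![e₁, e₂, e₃, e₄] := by
  rw [orthonormal_iff_ite]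
  intro i j
  fin_cases i <;> fin_cases j <;>
    simp [h.i₁₁, h.i₂₂, h.i₃₃, h.i₄₄, h.i₁₂, h.i₁₃, h.i₁₄, h.i₂₃, h.i₂₄, h.i₃₄, h.i₂₁, h.i₃₁,
      h.i₄₁, h.i₃₂, h.i₄₂, h.i₄₃, -inner_self_eq_norm_sq_to_K]

/-- The orthonormal basis consisting of the vectors of the frame. -/
def basis (h : IsFrame e₁ e₂ e₃ e₄) : OrthonormalBasis (Fin 4) ℝ E4 :=
  (basisOfOrthonormalOfCardEqFinrank h.orthonormal (by simp)).toOrthonormalBasis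
    (by rw [coe_basisOfOrthonormalOfCardEqFinrank]; exact h.orthonormal)

theorem coe_basis (h : IsFrame e₁ e₂ e₃ e₄) : ⇑h.basis = ![e₁, e₂, e₃, e₄] := by
  simp [basis]

theorem expand (h : IsFrame e₁ e₂ e₃ e₄) (v : E4) :
    v = inner ℝ v e₁ • e₁ + inner ℝ v e₂ • e₂ + inner ℝ v e₃ • e₃ + inner ℝ v e₄ • e₄ := by
  have := h.basis.sum_repr v
  simp only [h.basis.repr_apply_apply, Fin.sum_univ_four, h.coe_basis] at this
  conv_lhs => rw [← this]
  simp [real_inner_comm]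

theorem ext_inner (h : IsFrame e₁ e₂ e₃ e₄) {v w : E4} (h₁ : inner ℝ v e₁ = inner ℝ w e₁)
    (h₂ : inner ℝ v e₂ = inner ℝ w e₂) (h₃ : inner ℝ v e₃ = inner ℝ w e₃)
    (h₄ : inner ℝ v e₄ = inner ℝ w e₄) : v = w := by
  rw [h.expand v, h.expand w, h₁, h₂, h₃, h₄]

theorem inner_comb (h : IsFrame e₁ e₂ e₃ e₄) (a b c d a' b' c' d' : ℝ) :
    inner ℝ (a • e₁ + b • e₂ + c • e₃ + d • e₄) (a' • e₁ + b' • e₂ + c' • e₃ + d' • e₄) =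
      a * a' + b * b' + c * c' + d * d' := by
  simp only [inner_add_left, inner_add_right, real_inner_smul_left, real_inner_smul_right,
    h.i₁₁, h.i₂₂, h.i₃₃, h.i₄₄, h.i₁₂, h.i₁₃, h.i₁₄, h.i₂₃, h.i₂₄, h.i₃₄, h.i₂₁, h.i₃₁,
    h.i₄₁, h.i₃₂, h.i₄₂, h.i₄₃]
  ring

end IsFrame

/-- An orthogonal net of curvature lines on a hypersurface `f` with unit frame `e₁, e₂, e₃, N`,
with Lamé coefficients `l₁, l₂, l₃` and principal curvatures `k₁, k₂, k₃`. -/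
structure IsCurvatureNet (U : Set Coord) (l₁ l₂ l₃ k₁ k₂ k₃ : Coord → ℝ)
    (f e₁ e₂ e₃ N : Coord → E4) : Prop where
  isOpen : IsOpen U
  smooth_f : ContDiffOn ℝ ∞ f U
  smooth_l₁ : ContDiffOn ℝ ∞ l₁ U
  smooth_l₂ : ContDiffOn ℝ ∞ l₂ U
  smooth_l₃ : ContDiffOn ℝ ∞ l₃ U
  smooth_e₁ : ContDiffOn ℝ ∞ e₁ U
  smooth_e₂ : ContDiffOn ℝ ∞ e₂ U
  smooth_e₃ : ContDiffOn ℝ ∞ e₃ U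
  smooth_N : ContDiffOn ℝ ∞ N U
  l₁_ne : ∀ p ∈ U, l₁ p ≠ 0
  l₂_ne : ∀ p ∈ U, l₂ p ≠ 0
  l₃_ne : ∀ p ∈ U, l₃ p ≠ 0
  frame : ∀ p ∈ U, IsFrame (e₁ p) (e₂ p) (e₃ p) (N p)
  f_x : ∀ p ∈ U, dirD ex f p = l₁ p • e₁ p
  f_y : ∀ p ∈ U, dirD ey f p = l₂ p • e₂ p
  f_z : ∀ p ∈ U, dirD ez f p = l₃ p • e₃ p
  N_x : ∀ p ∈ U, dirD ex N p = -((k₁ p * l₁ p) • e₁ p)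
  N_y : ∀ p ∈ U, dirD ey N p = -((k₂ p * l₂ p) • e₂ p)
  N_z : ∀ p ∈ U, dirD ez N p = -((k₃ p * l₃ p) • e₃ p)

section

variable {U : Set Coord} {p v w : Coord}

/-- Symmetry of the second derivatives of `f`, if `f_v = l e` and `f_w = l' e'`. -/
theorem mixed_derivatives {l l' : Coord → ℝ} {f e e' : Coord → E4} (hU : IsOpen U)
    (hf : ContDiffOn ℝ ∞ f U) (hl : ContDiffOn ℝ ∞ l U) (hl' : ContDiffOn ℝ ∞ l' U)
    (he : ContDiffOn ℝ ∞ e U) (he' : ContDiffOn ℝ ∞ e' U) (hp : p ∈ U)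
    (h1 : ∀ q ∈ U, dirD v f q = l q • e q) (h2 : ∀ q ∈ U, dirD w f q = l' q • e' q) :
    l p • dirD w e p + dirD w l p • e p = l' p • dirD v e' p + dirD v l' p • e' p := by
  have a1 := ((hasDir_of_smooth hU hl w hp).smul (hasDir_of_smooth hU he w hp)).congr hU h1 hp
  have a2 := ((hasDir_of_smooth hU hl' v hp).smul (hasDir_of_smooth hU he' v hp)).congr hU h2 hp
  rw [← a1.eq, ← a2.eq]
  exact dirD_comm hU hf hp

theorem inner_dirD_antisymm {e e' : Coord → E4} {c : ℝ} (hU : IsOpen U)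
    (he : ContDiffOn ℝ ∞ e U) (he' : ContDiffOn ℝ ∞ e' U) (hp : p ∈ U)
    (h : ∀ q ∈ U, inner ℝ (e q) (e' q) = c) :
    inner ℝ (dirD v e p) (e' p) = -inner ℝ (dirD v e' p) (e p) := by
  have h1 := (hasDir_of_smooth hU he v hp).inner (hasDir_of_smooth hU he' v hp)
  have h2 := ((HasDir.const c).congr hU h hp).unique h1
  rw [real_inner_comm (e p)]
  linarith

namespace IsCurvatureNet

variable {l₁ l₂ l₃ k₁ k₂ k₃ : Coord → ℝ} {f e₁ e₂ e₃ N : Coord → E4}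

/-- The derivatives of the frame of a net of curvature lines. -/
theorem frame_derivatives (H : IsCurvatureNet U l₁ l₂ l₃ k₁ k₂ k₃ f e₁ e₂ e₃ N) (hp : p ∈ U) :
    (dirD ex e₁ p = -(dirD ey l₁ p / l₂ p) • e₂ p + -(dirD ez l₁ p / l₃ p) • e₃ p +
        (k₁ p * l₁ p) • N p ∧
      dirD ey e₁ p = (dirD ex l₂ p / l₁ p) • e₂ p ∧
      dirD ez e₁ p = (dirD ex l₃ p / l₁ p) • e₃ p) ∧
    (dirD ex e₂ p = (dirD ey l₁ p / l₂ p) • e₁ p ∧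
      dirD ey e₂ p = -(dirD ex l₂ p / l₁ p) • e₁ p + -(dirD ez l₂ p / l₃ p) • e₃ p +
        (k₂ p * l₂ p) • N p ∧
      dirD ez e₂ p = (dirD ey l₃ p / l₂ p) • e₃ p) ∧
    (dirD ex e₃ p = (dirD ez l₁ p / l₃ p) • e₁ p ∧
      dirD ey e₃ p = (dirD ez l₂ p / l₃ p) • e₂ p ∧
      dirD ez e₃ p = -(dirD ex l₃ p / l₁ p) • e₁ p + -(dirD ey l₃ p / l₂ p) • e₂ p +
        (k₃ p * l₃ p) • N p) := by
  have F := H.frame p hp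
  have hU := H.isOpen
  have n1 := H.l₁_ne p hp
  have n2 := H.l₂_ne p hp
  have n3 := H.l₃_ne p hp
  have s1 := H.smooth_e₁
  have s2 := H.smooth_e₂
  have s3 := H.smooth_e₃
  have s4 := H.smooth_N
  have a11 : ∀ v, inner ℝ (dirD v e₁ p) (e₁ p) = 0 := fun v => by
    have := inner_dirD_antisymm (v := v) hU s1 s1 hp fun q hq => (H.frame q hq).i₁₁
    linarith
  have a22 : ∀ v, inner ℝ (dirD v e₂ p) (e₂ p) = 0 := fun v => by
    have := inner_dirD_antisymm (v := v) hU s2 s2 hp fun q hq => (H.frame q hq).i₂₂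
    linarith
  have a33 : ∀ v, inner ℝ (dirD v e₃ p) (e₃ p) = 0 := fun v => by
    have := inner_dirD_antisymm (v := v) hU s3 s3 hp fun q hq => (H.frame q hq).i₃₃
    linarith
  have a12 := fun v => inner_dirD_antisymm (v := v) hU s1 s2 hp fun q hq => (H.frame q hq).i₁₂
  have a13 := fun v => inner_dirD_antisymm (v := v) hU s1 s3 hp fun q hq => (H.frame q hq).i₁₃
  have a23 := fun v => inner_dirD_antisymm (v := v) hU s2 s3 hp fun q hq => (H.frame q hq).i₂₃
  have a14 := fun v => inner_dirD_antisymm (v := v) hU s1 s4 hp fun q hq => (H.frame q hq).i₁₄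
  have a24 := fun v => inner_dirD_antisymm (v := v) hU s2 s4 hp fun q hq => (H.frame q hq).i₂₄
  have a34 := fun v => inner_dirD_antisymm (v := v) hU s3 s4 hp fun q hq => (H.frame q hq).i₃₄
  have m12 := mixed_derivatives hU H.smooth_f H.smooth_l₁ H.smooth_l₂ s1 s2 hp H.f_x H.f_y
  have m13 := mixed_derivatives hU H.smooth_f H.smooth_l₁ H.smooth_l₃ s1 s3 hp H.f_x H.f_z
  have m23 := mixed_derivatives hU H.smooth_f H.smooth_l₂ H.smooth_l₃ s2 s3 hp H.f_y H.f_z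
  have ortho := And.intro F.i₁₁ <| And.intro F.i₂₂ <| And.intro F.i₃₃ <| And.intro F.i₄₄ <|
    And.intro F.i₁₂ <| And.intro F.i₁₃ <| And.intro F.i₁₄ <| And.intro F.i₂₃ <|
    And.intro F.i₂₄ <| And.intro F.i₃₄ <| And.intro F.i₂₁ <| And.intro F.i₃₁ <|
    And.intro F.i₄₁ <| And.intro F.i₃₂ <| And.intro F.i₄₂ F.i₄₃
  have q12 := congrArg (fun u => inner ℝ u (e₁ p)) m12
  have r12 := congrArg (fun u => inner ℝ u (e₂ p)) m12
  have t12 := congrArg (fun u => inner ℝ u (e₃ p)) m12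
  have q13 := congrArg (fun u => inner ℝ u (e₁ p)) m13
  have r13 := congrArg (fun u => inner ℝ u (e₂ p)) m13
  have t13 := congrArg (fun u => inner ℝ u (e₃ p)) m13
  have q23 := congrArg (fun u => inner ℝ u (e₁ p)) m23
  have r23 := congrArg (fun u => inner ℝ u (e₂ p)) m23
  have t23 := congrArg (fun u => inner ℝ u (e₃ p)) m23
  simp only [inner_add_left, real_inner_smul_left, a11, a22, a33, ortho, mul_zero, mul_one,
    zero_add, add_zero] at q12 r12 t12 q13 r13 t13 q23 r23 t23
  have h1 := a13 ey
  have h2 := a12 ez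
  have h3 := a23 ex
  -- Dupin's argument for triply orthogonal systems: three symmetries of second derivatives and
  -- three antisymmetries of the connection form a cyclic linear system that forces the coefficients
  -- with three distinct indices to vanish.
  have z1 : inner ℝ (dirD ez e₁ p) (e₂ p) = 0 := by
    have : l₁ p * l₂ p * inner ℝ (dirD ez e₁ p) (e₂ p) = 0 := by
      linear_combination (1 / 2 * l₂ p) * r13 + (1 / 2 * l₂ p * l₃ p) * h3 +
        (1 / 2 * l₃ p) * t12 - (1 / 2 * l₁ p) * q23 + (1 / 2 * l₁ p * l₂ p) * h2 -
        (1 / 2 * l₁ p * l₃ p) * h1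
    simpa [n1, n2] using this
  have z1' : inner ℝ (dirD ez e₂ p) (e₁ p) = 0 := by linarith
  have z2' : inner ℝ (dirD ex e₃ p) (e₂ p) = 0 := by
    rw [z1] at r13; simpa [n3] using r13.symm
  have z2 : inner ℝ (dirD ex e₂ p) (e₃ p) = 0 := by linarith
  have z3 : inner ℝ (dirD ey e₁ p) (e₃ p) = 0 := by
    rw [z2] at t12; simpa [n1] using t12
  have z3' : inner ℝ (dirD ey e₃ p) (e₁ p) = 0 := by linarith
  have b12 : inner ℝ (dirD ex e₂ p) (e₁ p) = dirD ey l₁ p / l₂ p := by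
    rw [eq_div_iff n2, q12]; ring
  have b21 : inner ℝ (dirD ey e₁ p) (e₂ p) = dirD ex l₂ p / l₁ p := by
    rw [eq_div_iff n1, ← r12]; ring
  have b13 : inner ℝ (dirD ex e₃ p) (e₁ p) = dirD ez l₁ p / l₃ p := by
    rw [eq_div_iff n3, q13]; ring
  have b31 : inner ℝ (dirD ez e₁ p) (e₃ p) = dirD ex l₃ p / l₁ p := by
    rw [eq_div_iff n1, ← t13]; ring
  have b23 : inner ℝ (dirD ey e₃ p) (e₂ p) = dirD ez l₂ p / l₃ p := by
    rw [eq_div_iff n3, r23]; ring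
  have b32 : inner ℝ (dirD ez e₂ p) (e₃ p) = dirD ey l₃ p / l₂ p := by
    rw [eq_div_iff n2, ← t23]; ring
  have d12 := a12 ex
  have d21 := a12 ey
  have d13 := a13 ex
  have d31 := a13 ez
  have d23 := a23 ey
  have d32 := a23 ez
  rw [b12] at d12
  rw [b21, eq_neg_iff_add_eq_zero, add_comm, ← eq_neg_iff_add_eq_zero] at d21
  rw [b13] at d13
  rw [b31, eq_neg_iff_add_eq_zero, add_comm, ← eq_neg_iff_add_eq_zero] at d31
  rw [b23] at d23
  rw [b32, eq_neg_iff_add_eq_zero, add_comm, ← eq_neg_iff_add_eq_zero] at d32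
  -- All rotation coefficients are now known. The components along `N` come from the Weingarten
  -- equations by antisymmetry.
  refine ⟨⟨?_, ?_, ?_⟩, ⟨?_, ?_, ?_⟩, ⟨?_, ?_, ?_⟩⟩ <;>
  refine F.ext_inner ?_ ?_ ?_ ?_ <;>
  simp only [inner_add_left, real_inner_smul_left, inner_neg_left, a14, a24, a34, H.N_x p hp,
    H.N_y p hp, H.N_z p hp, a11, a22, a33, ortho, mul_zero, mul_one, zero_add, add_zero, neg_zero,
    neg_neg, z1, z1', z2, z2', z3, z3', b12, b21, b13, b31, b23, b32, d12, d21, d13, d31, d23, d32]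

end IsCurvatureNet
end

/-! ### The frame of a hypersurface with Guichard net -/

/-- The structure equations of the principal frame `e₁, e₂, e₃, N` of a hypersurface with Guichard
net, where `α = P a`, `β = P b`, `σ = P κ₃`, `τ = P (P⁻¹)_z`. -/
structure IsGuichardFrame (U : Set Coord) (φ α β σ τ : Coord → ℝ) (e₁ e₂ e₃ N : Coord → E4) :
    Prop where
  isOpen : IsOpen U
  smooth_φ : ContDiffOn ℝ ∞ φ U
  smooth_α : ContDiffOn ℝ ∞ α U
  smooth_β : ContDiffOn ℝ ∞ β U
  smooth_σ : ContDiffOn ℝ ∞ σ U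
  smooth_τ : ContDiffOn ℝ ∞ τ U
  smooth_e₁ : ContDiffOn ℝ ∞ e₁ U
  smooth_e₂ : ContDiffOn ℝ ∞ e₂ U
  smooth_e₃ : ContDiffOn ℝ ∞ e₃ U
  smooth_N : ContDiffOn ℝ ∞ N U
  sin_ne : ∀ p ∈ U, Real.sin (φ p) ≠ 0
  cos_ne : ∀ p ∈ U, Real.cos (φ p) ≠ 0
  frame : ∀ p ∈ U, IsFrame (e₁ p) (e₂ p) (e₃ p) (N p)
  e₁_x : ∀ p ∈ U, dirD ex e₁ p = (β p * Real.cos (φ p) + dirD ey φ p) • e₂ p +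
    (τ p * Real.cos (φ p) + Real.sin (φ p) * dirD ez φ p) • e₃ p +
    (Real.sin (φ p) + σ p * Real.cos (φ p)) • N p
  e₁_y : ∀ p ∈ U, dirD ey e₁ p = (dirD ex φ p - α p * Real.sin (φ p)) • e₂ p
  e₁_z : ∀ p ∈ U, dirD ez e₁ p = -α p • e₃ p
  e₂_x : ∀ p ∈ U, dirD ex e₂ p = -(β p * Real.cos (φ p) + dirD ey φ p) • e₁ p
  e₂_y : ∀ p ∈ U, dirD ey e₂ p = -(dirD ex φ p - α p * Real.sin (φ p)) • e₁ p +
    (τ p * Real.sin (φ p) - Real.cos (φ p) * dirD ez φ p) • e₃ p +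
    (-Real.cos (φ p) + σ p * Real.sin (φ p)) • N p
  e₂_z : ∀ p ∈ U, dirD ez e₂ p = -β p • e₃ p
  e₃_x : ∀ p ∈ U, dirD ex e₃ p =
    -(τ p * Real.cos (φ p) + Real.sin (φ p) * dirD ez φ p) • e₁ p
  e₃_y : ∀ p ∈ U, dirD ey e₃ p =
    -(τ p * Real.sin (φ p) - Real.cos (φ p) * dirD ez φ p) • e₂ p
  e₃_z : ∀ p ∈ U, dirD ez e₃ p = α p • e₁ p + β p • e₂ p + σ p • N p
  N_x : ∀ p ∈ U, dirD ex N p = -(Real.sin (φ p) + σ p * Real.cos (φ p)) • e₁ p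
  N_y : ∀ p ∈ U, dirD ey N p = -(-Real.cos (φ p) + σ p * Real.sin (φ p)) • e₂ p
  N_z : ∀ p ∈ U, dirD ez N p = -σ p • e₃ p

/-- The unit principal vector `(P cos φ)⁻¹ f_x`. -/
def unitX (φ P : Coord → ℝ) (f : Coord → E4) (p : Coord) : E4 :=
  (P p * Real.cos (φ p))⁻¹ • dx f p

/-- The unit principal vector `(P sin φ)⁻¹ f_y`. -/
def unitY (φ P : Coord → ℝ) (f : Coord → E4) (p : Coord) : E4 :=
  (P p * Real.sin (φ p))⁻¹ • dy f p

namespace IsGuichardHypersurface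

variable {U : Set Coord} {φ P κ₃ : Coord → ℝ} {f N : Coord → E4} {p v : Coord}

theorem sin_ne (H : IsGuichardHypersurface U φ P κ₃ f N) (hp : p ∈ U) : Real.sin (φ p) ≠ 0 :=
  left_ne_zero_of_mul (H.angle p hp)

theorem cos_ne (H : IsGuichardHypersurface U φ P κ₃ f N) (hp : p ∈ U) : Real.cos (φ p) ≠ 0 :=
  right_ne_zero_of_mul (H.angle p hp)

theorem P_ne (H : IsGuichardHypersurface U φ P κ₃ f N) (hp : p ∈ U) : P p ≠ 0 :=
  (H.P_pos p hp).ne'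

theorem smooth_inv (H : IsGuichardHypersurface U φ P κ₃ f N) :
    ContDiffOn ℝ ∞ (fun q => (P q)⁻¹) U := H.smooth_P.inv fun _ hp => H.P_ne hp

theorem dirD_P (H : IsGuichardHypersurface U φ P κ₃ f N) (hU : IsOpen U) (hp : p ∈ U) :
    dirD v P p = -(P p ^ 2 * dirD v (fun q => (P q)⁻¹) p) := by
  have := ((hasDir_of_smooth hU H.smooth_P v hp).inv (H.P_ne hp)).eq
  have := H.P_ne hp
  rw [‹dirD v (fun q => (P q)⁻¹) p = _›]
  field_simp

theorem f_x (H : IsGuichardHypersurface U φ P κ₃ f N) (hp : p ∈ U) :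
    dirD ex f p = (P p * Real.cos (φ p)) • unitX φ P f p := by
  rw [unitX, smul_inv_smul₀ (mul_ne_zero (H.P_ne hp) (H.cos_ne hp))]; rfl

theorem f_y (H : IsGuichardHypersurface U φ P κ₃ f N) (hp : p ∈ U) :
    dirD ey f p = (P p * Real.sin (φ p)) • unitY φ P f p := by
  rw [unitY, smul_inv_smul₀ (mul_ne_zero (H.P_ne hp) (H.sin_ne hp))]; rfl

theorem f_z (H : IsGuichardHypersurface U φ P κ₃ f N) (hp : p ∈ U) :
    dirD ez f p = P p • Xgamma P f p := by
  rw [Xgamma, smul_inv_smul₀ (H.P_ne hp)]; rfl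

theorem isFrame (H : IsGuichardHypersurface U φ P κ₃ f N) (hp : p ∈ U) :
    IsFrame (unitX φ P f p) (unitY φ P f p) (Xgamma P f p) (N p) := by
  have h1 := H.P_ne hp
  have h2 := H.cos_ne hp
  have h3 := H.sin_ne hp
  constructor <;> try simp only [unitX, unitY, Xgamma, real_inner_smul_left, real_inner_smul_right]
  · rw [H.I_xx p hp]; field_simp
  · rw [H.I_yy p hp]; field_simp
  · rw [H.I_zz p hp]; field_simp
  · rw [real_inner_self_eq_norm_sq, H.N_unit p hp, one_pow]
  · rw [H.I_xy p hp]; simp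
  · rw [H.I_xz p hp]; simp
  · rw [real_inner_comm, H.N_x p hp]; simp
  · rw [H.I_yz p hp]; simp
  · rw [real_inner_comm, H.N_y p hp]; simp
  · rw [real_inner_comm, H.N_z p hp]; simp

theorem isCurvatureNet (H : IsGuichardHypersurface U φ P κ₃ f N) (hU : IsOpen U)
    (hφ : ContDiffOn ℝ ∞ φ U) :
    IsCurvatureNet U (fun p => P p * Real.cos (φ p)) (fun p => P p * Real.sin (φ p)) P
      (kappa₁ φ P κ₃) (kappa₂ φ P κ₃) κ₃ f (unitX φ P f) (unitY φ P f) (Xgamma P f) N where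
  isOpen := hU
  smooth_f := H.smooth_f
  smooth_l₁ := H.smooth_P.mul hφ.cos
  smooth_l₂ := H.smooth_P.mul hφ.sin
  smooth_l₃ := H.smooth_P
  smooth_e₁ := ((H.smooth_P.mul hφ.cos).inv fun _ hp =>
    mul_ne_zero (H.P_ne hp) (H.cos_ne hp)).smul (smooth_dirD hU H.smooth_f ex)
  smooth_e₂ := ((H.smooth_P.mul hφ.sin).inv fun _ hp =>
    mul_ne_zero (H.P_ne hp) (H.sin_ne hp)).smul (smooth_dirD hU H.smooth_f ey)
  smooth_e₃ := H.smooth_inv.smul (smooth_dirD hU H.smooth_f ez)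
  smooth_N := H.smooth_N
  l₁_ne := fun _ hp => mul_ne_zero (H.P_ne hp) (H.cos_ne hp)
  l₂_ne := fun _ hp => mul_ne_zero (H.P_ne hp) (H.sin_ne hp)
  l₃_ne := fun _ hp => H.P_ne hp
  frame := fun _ hp => H.isFrame hp
  f_x := fun _ hp => H.f_x hp
  f_y := fun _ hp => H.f_y hp
  f_z := fun _ hp => H.f_z hp
  N_x := fun p hp => by rw [mul_smul, ← H.f_x hp]; exact H.weingarten_x p hp
  N_y := fun p hp => by rw [mul_smul, ← H.f_y hp]; exact H.weingarten_y p hp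
  N_z := fun p hp => by rw [mul_smul, ← H.f_z hp]; exact H.weingarten_z p hp

theorem isGuichardFrame (H : IsGuichardHypersurface U φ P κ₃ f N) (hU : IsOpen U)
    (hφ : ContDiffOn ℝ ∞ φ U) :
    IsGuichardFrame U φ (fun p => P p * aFun φ P p) (fun p => P p * bFun φ P p)
      (fun p => P p * κ₃ p) (fun p => P p * dirD ez (fun q => (P q)⁻¹) p)
      (unitX φ P f) (unitY φ P f) (Xgamma P f) N := by
  have C := H.isCurvatureNet hU hφ
  have l1 : ∀ v, ∀ p ∈ U, dirD v (fun p => P p * Real.cos (φ p)) p =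
      -(P p ^ 2 * dirD v (fun q => (P q)⁻¹) p * Real.cos (φ p)) -
        P p * Real.sin (φ p) * dirD v φ p := fun v p hp => by
    rw [((hasDir_of_smooth hU H.smooth_P v hp).mul (hasDir_of_smooth hU hφ v hp).cos).eq,
      H.dirD_P hU hp]; ring
  have l2 : ∀ v, ∀ p ∈ U, dirD v (fun p => P p * Real.sin (φ p)) p =
      -(P p ^ 2 * dirD v (fun q => (P q)⁻¹) p * Real.sin (φ p)) +
        P p * Real.cos (φ p) * dirD v φ p := fun v p hp => by
    rw [((hasDir_of_smooth hU H.smooth_P v hp).mul (hasDir_of_smooth hU hφ v hp).sin).eq,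
      H.dirD_P hU hp]; ring
  -- Multiplication by the Lamé coefficients clears the denominators of tan and cot.
  have k1 : ∀ p ∈ U, kappa₁ φ P κ₃ p * (P p * Real.cos (φ p)) =
      Real.sin (φ p) + P p * κ₃ p * Real.cos (φ p) := fun p hp => by
    have := H.P_ne hp
    have := H.cos_ne hp
    rw [kappa₁, Real.tan_eq_sin_div_cos]; field_simp
  have k2 : ∀ p ∈ U, kappa₂ φ P κ₃ p * (P p * Real.sin (φ p)) =
      -Real.cos (φ p) + P p * κ₃ p * Real.sin (φ p) := fun p hp => by
    have := H.P_ne hp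
    have := H.sin_ne hp
    rw [kappa₂, Real.cot_eq_cos_div_sin]; field_simp
  constructor
  · exact hU
  · exact hφ
  · exact H.smooth_P.mul ((smooth_dirD hU H.smooth_inv ex).div hφ.cos fun p hp => H.cos_ne hp)
  · exact H.smooth_P.mul ((smooth_dirD hU H.smooth_inv ey).div hφ.sin fun p hp => H.sin_ne hp)
  · exact H.smooth_P.mul H.smooth_κ₃
  · exact H.smooth_P.mul (smooth_dirD hU H.smooth_inv ez)
  · exact C.smooth_e₁
  · exact C.smooth_e₂
  · exact C.smooth_e₃
  · exact C.smooth_N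
  · exact fun p hp => H.sin_ne hp
  · exact fun p hp => H.cos_ne hp
  · exact C.frame
  all_goals
    intro p hp
    have h1 := H.P_ne hp
    have h2 := H.cos_ne hp
    have h3 := H.sin_ne hp
    obtain ⟨⟨c1, c2, c3⟩, ⟨c4, c5, c6⟩, ⟨c7, c8, c9⟩⟩ := C.frame_derivatives hp
    have aE : aFun φ P p = dirD ex (fun q => (P q)⁻¹) p / Real.cos (φ p) := rfl
    have bE : bFun φ P p = dirD ey (fun q => (P q)⁻¹) p / Real.sin (φ p) := rfl
    have t12 : dirD ey (fun p => P p * Real.cos (φ p)) p / (P p * Real.sin (φ p)) =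
        -(P p * bFun φ P p * Real.cos (φ p) + dirD ey φ p) := by
      rw [l1 _ p hp, bE]
      -- Naming the derivative protects the P⁻¹ under it from `field_simp`.
      generalize dirD ey (fun q => (P q)⁻¹) p = w
      field_simp
      ring
    have t21 : dirD ex (fun p => P p * Real.sin (φ p)) p / (P p * Real.cos (φ p)) =
        dirD ex φ p - P p * aFun φ P p * Real.sin (φ p) := by
      rw [l2 _ p hp, aE]
      generalize dirD ex (fun q => (P q)⁻¹) p = w
      field_simp
      ring
    have t13 : dirD ez (fun p => P p * Real.cos (φ p)) p / P p =
        -(P p * dirD ez (fun q => (P q)⁻¹) p * Real.cos (φ p) +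
          Real.sin (φ p) * dirD ez φ p) := by
      rw [l1 _ p hp]
      generalize dirD ez (fun q => (P q)⁻¹) p = w
      field_simp
      ring
    have t23 : dirD ez (fun p => P p * Real.sin (φ p)) p / P p =
        -(P p * dirD ez (fun q => (P q)⁻¹) p * Real.sin (φ p) -
          Real.cos (φ p) * dirD ez φ p) := by
      rw [l2 _ p hp]
      generalize dirD ez (fun q => (P q)⁻¹) p = w
      field_simp
      ring
    have t31 : dirD ex P p / (P p * Real.cos (φ p)) = -(P p * aFun φ P p) := by
      rw [H.dirD_P hU hp, aE]
      generalize dirD ex (fun q => (P q)⁻¹) p = w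
      field_simp
    have t32 : dirD ey P p / (P p * Real.sin (φ p)) = -(P p * bFun φ P p) := by
      rw [H.dirD_P hU hp, bE]
      generalize dirD ey (fun q => (P q)⁻¹) p = w
      field_simp
  · rw [c1, k1 p hp, t12, t13, neg_neg, neg_neg]
  · rw [c2, t21]
  · rw [c3, t31]
  · rw [c4, t12]
  · rw [c5, k2 p hp, t21, t23, neg_neg]
  · rw [c6, t32]
  · rw [c7, t13]
  · rw [c8, t23]
  · rw [c9, t31, t32, neg_neg, neg_neg, mul_comm (κ₃ p)]
  · rw [C.N_x p hp, k1 p hp, neg_smul]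
  · rw [C.N_y p hp, k2 p hp, neg_smul]
  · rw [C.N_z p hp, neg_smul, mul_comm]

end IsGuichardHypersurface

/-! ### The equations of Gauss and Codazzi -/

namespace IsGuichardFrame

variable {U : Set Coord} {φ α β σ τ : Coord → ℝ} {e₁ e₂ e₃ N : Coord → E4} {p v : Coord}

/-- Compares ⟨N_z, e₃⟩ = −σ with ⟨N_x, e₃⟩ = 0 by means of `inner_compat`; `codazzi_y` is the same
with y in place of x. -/
theorem codazzi_x (H : IsGuichardFrame U φ α β σ τ e₁ e₂ e₃ N) (hp : p ∈ U) :
    dirD ex σ p = -(α p * (Real.sin (φ p) + σ p * Real.cos (φ p))) := by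
  have F := H.frame p hp
  have h := inner_compat (v := ez) (w := ex) H.isOpen H.smooth_N H.smooth_e₃ hp
    (((hasDir_of_smooth H.isOpen H.smooth_σ ex hp).neg).congr H.isOpen (fun q hq => by
      rw [H.N_z q hq, real_inner_smul_left, (H.frame q hq).i₃₃, mul_one]) hp)
    ((HasDir.const 0).congr H.isOpen (fun q hq => by
      rw [H.N_x q hq, real_inner_smul_left, (H.frame q hq).i₁₃, mul_zero]) hp)
  simp only [H.N_z p hp, H.N_x p hp, H.e₃_x p hp, H.e₃_z p hp, inner_add_right,
    real_inner_smul_left, real_inner_smul_right, F.i₁₁, F.i₁₂, F.i₁₄, F.i₃₁] at h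
  linear_combination -h

theorem codazzi_y (H : IsGuichardFrame U φ α β σ τ e₁ e₂ e₃ N) (hp : p ∈ U) :
    dirD ey σ p = -(β p * (-Real.cos (φ p) + σ p * Real.sin (φ p))) := by
  have F := H.frame p hp
  have h := inner_compat (v := ez) (w := ey) H.isOpen H.smooth_N H.smooth_e₃ hp
    (((hasDir_of_smooth H.isOpen H.smooth_σ ey hp).neg).congr H.isOpen (fun q hq => by
      rw [H.N_z q hq, real_inner_smul_left, (H.frame q hq).i₃₃, mul_one]) hp)
    ((HasDir.const 0).congr H.isOpen (fun q hq => by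
      rw [H.N_y q hq, real_inner_smul_left, (H.frame q hq).i₂₃, mul_zero]) hp)
  simp only [H.N_z p hp, H.N_y p hp, H.e₃_y p hp, H.e₃_z p hp, inner_add_right,
    real_inner_smul_left, real_inner_smul_right, F.i₂₁, F.i₂₂, F.i₂₄, F.i₃₂] at h
  linear_combination -h

/-- Here the pair is N, e₁, whose coefficient ⟨N_x, e₁⟩ = −(sin φ + σ cos φ) contains σ. This
produces the equation multiplied by cos φ ≠ 0. -/
theorem codazzi_z (H : IsGuichardFrame U φ α β σ τ e₁ e₂ e₃ N) (hp : p ∈ U) :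
    dirD ez σ p = -dirD ez φ p - σ p * τ p := by
  have F := H.frame p hp
  have dφ := hasDir_of_smooth H.isOpen H.smooth_φ ez hp
  have h := inner_compat (v := ex) (w := ez) H.isOpen H.smooth_N H.smooth_e₁ hp
    (((dφ.sin.add ((hasDir_of_smooth H.isOpen H.smooth_σ ez hp).mul dφ.cos)).neg).congr H.isOpen
      (fun q hq => by
        rw [H.N_x q hq, real_inner_smul_left, (H.frame q hq).i₁₁, mul_one]) hp)
    ((HasDir.const 0).congr H.isOpen (fun q hq => by
      rw [H.N_z q hq, real_inner_smul_left, (H.frame q hq).i₃₁, mul_zero]) hp)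
  simp only [H.N_z p hp, H.N_x p hp, H.e₁_x p hp, H.e₁_z p hp, inner_add_right,
    real_inner_smul_left, real_inner_smul_right, F.i₁₃, F.i₃₂, F.i₃₃, F.i₃₄] at h
  have hc := H.cos_ne p hp
  have : Real.cos (φ p) * (dirD ez σ p - (-dirD ez φ p - σ p * τ p)) = 0 := by
    linear_combination -h
  linarith [(mul_eq_zero.1 this).resolve_left hc]

/-- The coefficient ⟨e₃_z, e₁⟩ is α, so the Gauss equation in the xz-plane expresses α_x by
z-derivatives. In the same way `gauss_yz` expresses β_y. -/
theorem gauss_xz (H : IsGuichardFrame U φ α β σ τ e₁ e₂ e₃ N) (hp : p ∈ U) :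
    dirD ex α p = β p * (β p * Real.cos (φ p) + dirD ey φ p) +
      σ p * (Real.sin (φ p) + σ p * Real.cos (φ p)) -
      (dirD ez τ p * Real.cos (φ p) - τ p * Real.sin (φ p) * dirD ez φ p +
        Real.cos (φ p) * dirD ez φ p ^ 2 + Real.sin (φ p) * dirD ez (dirD ez φ) p) := by
  have F := H.frame p hp
  have dφ := hasDir_of_smooth H.isOpen H.smooth_φ ez hp
  have dφz := hasDir_of_smooth H.isOpen (smooth_dirD H.isOpen H.smooth_φ ez) ez hp
  have h := inner_compat (v := ex) (w := ez) H.isOpen H.smooth_e₃ H.smooth_e₁ hp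
    (((((hasDir_of_smooth H.isOpen H.smooth_τ ez hp).mul dφ.cos).add (dφ.sin.mul dφz)).neg).congr
      H.isOpen (fun q hq => by
        rw [H.e₃_x q hq, real_inner_smul_left, (H.frame q hq).i₁₁, mul_one]) hp)
    ((hasDir_of_smooth H.isOpen H.smooth_α ex hp).congr H.isOpen (fun q hq => by
      have F := H.frame q hq
      simp only [H.e₃_z q hq, inner_add_left, real_inner_smul_left, F.i₁₁, F.i₂₁, F.i₄₁]
      ring) hp)
  simp only [H.e₃_z p hp, H.e₃_x p hp, H.e₁_x p hp, H.e₁_z p hp, inner_add_right, inner_add_left,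
    real_inner_smul_left, real_inner_smul_right, F.i₁₂, F.i₁₃, F.i₁₄, F.i₂₂, F.i₂₃, F.i₂₄, F.i₄₂,
    F.i₄₃, F.i₄₄] at h
  linear_combination -h

theorem gauss_yz (H : IsGuichardFrame U φ α β σ τ e₁ e₂ e₃ N) (hp : p ∈ U) :
    dirD ey β p = -α p * (dirD ex φ p - α p * Real.sin (φ p)) +
      σ p * (-Real.cos (φ p) + σ p * Real.sin (φ p)) -
      (dirD ez τ p * Real.sin (φ p) + τ p * Real.cos (φ p) * dirD ez φ p +
        Real.sin (φ p) * dirD ez φ p ^ 2 - Real.cos (φ p) * dirD ez (dirD ez φ) p) := by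
  have F := H.frame p hp
  have dφ := hasDir_of_smooth H.isOpen H.smooth_φ ez hp
  have dφz := hasDir_of_smooth H.isOpen (smooth_dirD H.isOpen H.smooth_φ ez) ez hp
  have h := inner_compat (v := ey) (w := ez) H.isOpen H.smooth_e₃ H.smooth_e₂ hp
    (((((hasDir_of_smooth H.isOpen H.smooth_τ ez hp).mul dφ.sin).sub (dφ.cos.mul dφz)).neg).congr
      H.isOpen (fun q hq => by
        rw [H.e₃_y q hq, real_inner_smul_left, (H.frame q hq).i₂₂, mul_one]) hp)
    ((hasDir_of_smooth H.isOpen H.smooth_β ey hp).congr H.isOpen (fun q hq => by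
      have F := H.frame q hq
      simp only [H.e₃_z q hq, inner_add_left, real_inner_smul_left, F.i₁₂, F.i₂₂, F.i₄₂]
      ring) hp)
  simp only [H.e₃_z p hp, H.e₃_y p hp, H.e₂_y p hp, H.e₂_z p hp, inner_add_right, inner_add_left,
    real_inner_smul_left, real_inner_smul_right, F.i₁₁, F.i₁₃, F.i₁₄, F.i₂₁, F.i₂₃, F.i₂₄, F.i₄₁,
    F.i₄₃, F.i₄₄] at h
  linear_combination -h

theorem gauss_xy (H : IsGuichardFrame U φ α β σ τ e₁ e₂ e₃ N) (hp : p ∈ U) :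
    dirD ey β p * Real.cos (φ p) - β p * Real.sin (φ p) * dirD ey φ p + dirD ey (dirD ey φ) p -
      (dirD ex (dirD ex φ) p - dirD ex α p * Real.sin (φ p) - α p * Real.cos (φ p) * dirD ex φ p) =
    (τ p * Real.cos (φ p) + Real.sin (φ p) * dirD ez φ p) *
      (τ p * Real.sin (φ p) - Real.cos (φ p) * dirD ez φ p) +
    (Real.sin (φ p) + σ p * Real.cos (φ p)) * (-Real.cos (φ p) + σ p * Real.sin (φ p)) := by
  have F := H.frame p hp
  have dφx := hasDir_of_smooth H.isOpen H.smooth_φ ex hp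
  have dφy := hasDir_of_smooth H.isOpen H.smooth_φ ey hp
  have dφxx := hasDir_of_smooth H.isOpen (smooth_dirD H.isOpen H.smooth_φ ex) ex hp
  have dφyy := hasDir_of_smooth H.isOpen (smooth_dirD H.isOpen H.smooth_φ ey) ey hp
  have h := inner_compat (v := ex) (w := ey) H.isOpen H.smooth_e₁ H.smooth_e₂ hp
    ((((hasDir_of_smooth H.isOpen H.smooth_β ey hp).mul dφy.cos).add dφyy).congr
      H.isOpen (fun q hq => by
        have F := H.frame q hq
        simp only [H.e₁_x q hq, inner_add_left, real_inner_smul_left, F.i₂₂, F.i₃₂, F.i₄₂]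
        ring) hp)
    ((dφxx.sub ((hasDir_of_smooth H.isOpen H.smooth_α ex hp).mul dφx.sin)).congr H.isOpen
      (fun q hq => by
        rw [H.e₁_y q hq, real_inner_smul_left, (H.frame q hq).i₂₂, mul_one]) hp)
  simp only [H.e₁_x p hp, H.e₁_y p hp, H.e₂_y p hp, H.e₂_x p hp, inner_add_right, inner_add_left,
    real_inner_smul_left, real_inner_smul_right, F.i₂₁, F.i₂₃, F.i₂₄, F.i₃₁, F.i₃₃, F.i₃₄, F.i₄₁,
    F.i₄₃, F.i₄₄] at h
  linear_combination h

/-- The wave equation for the angle of the Guichard net. -/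
theorem wave (H : IsGuichardFrame U φ α β σ τ e₁ e₂ e₃ N) (hp : p ∈ U) :
    dirD ex (dirD ex φ) p - dirD ey (dirD ey φ) p =
      Real.sin (φ p) * Real.cos (φ p) *
        (1 + α p ^ 2 + β p ^ 2 + σ p ^ 2 - 2 * dirD ez τ p - τ p ^ 2 - dirD ez φ p ^ 2) +
      (Real.cos (φ p) ^ 2 - Real.sin (φ p) ^ 2) * dirD ez (dirD ez φ) p := by
  have h := H.gauss_xy hp
  -- This removes α_x and β_y from the third Gauss equation; only the second derivatives of φ and
  -- τ_z are left.
  rw [H.gauss_xz hp, H.gauss_yz hp] at h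
  linear_combination -h

/-- If `α` and `β` vanish identically, then the second derivatives in `z` are determined. -/
theorem second_z_of_absq_zero (H : IsGuichardFrame U φ α β σ τ e₁ e₂ e₃ N) {W : Set Coord}
    (hWU : W ⊆ U) (hW : IsOpen W) (hα : ∀ q ∈ W, α q = 0) (hβ : ∀ q ∈ W, β q = 0) (hp : p ∈ W) :
    dirD ez τ p + dirD ez φ p ^ 2 = σ p ^ 2 ∧
      dirD ez (dirD ez φ) p - τ p * dirD ez φ p = σ p := by
  have h1 := H.gauss_xz (hWU hp)
  have h2 := H.gauss_yz (hWU hp)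
  -- As α and β vanish on an open set, so do α_x and β_y. The two Gauss equations, rotated by the
  -- angle φ, then separate into the two claims.
  rw [((HasDir.const 0).congr hW hα hp).eq, hβ p hp] at h1
  rw [((HasDir.const 0).congr hW hβ hp).eq, hα p hp] at h2
  have h3 := Real.sin_sq_add_cos_sq (φ p)
  set s := Real.sin (φ p)
  set c := Real.cos (φ p)
  constructor
  · linear_combination c * h1 + s * h2 - (dirD ez τ p + dirD ez φ p ^ 2 - σ p ^ 2) * h3
  · linear_combination s * h1 - c * h2 -
      (dirD ez (dirD ez φ) p - τ p * dirD ez φ p - σ p) * h3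

end IsGuichardFrame

/-! ### The split angle -/

section

variable {U : Set Coord} {lam : ℝ × ℝ → ℝ} {mu : ℝ → ℝ} {c₁ c₂ : ℝ} {p v : Coord}

theorem isOpen_projXY (hU : IsOpen U) : IsOpen (projXY U) :=
  (IsOpenMap.id.prodMap isOpenMap_fst : IsOpenMap fun p : Coord => (p.1, p.2.1)) U hU

theorem isOpen_projZ (hU : IsOpen U) : IsOpen (projZ U) :=
  (isOpenMap_snd.comp isOpenMap_snd : IsOpenMap fun p : Coord => p.2.2) U hU

theorem ordConnected_projZ (hU : IsConnected U) : (projZ U).OrdConnected :=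
  (hU.isPreconnected.image _ (by fun_prop)).ordConnected

theorem mem_projXY (hp : p ∈ U) : (p.1, p.2.1) ∈ projXY U := ⟨p, hp, rfl⟩

theorem mem_projZ (hp : p ∈ U) : p.2.2 ∈ projZ U := ⟨p, hp, rfl⟩

theorem smooth_deriv {I : Set ℝ} {g : ℝ → ℝ} (hI : IsOpen I) (hg : ContDiffOn ℝ ∞ g I) :
    ContDiffOn ℝ ∞ (deriv g) I :=
  hg.deriv_of_isOpen hI (by simp)

theorem hasDerivAt_of_smooth {I : Set ℝ} {g : ℝ → ℝ} (hI : IsOpen I) (hg : ContDiffOn ℝ ∞ g I)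
    {z : ℝ} (hz : z ∈ I) : HasDerivAt g (deriv g z) z :=
  ((hg.contDiffAt (hI.mem_nhds hz)).differentiableAt (by simp)).hasDerivAt

theorem hasDir_height : HasDir v (fun q => q.2.2) v.2.2 p := by
  have h : HasFDerivAt (fun q : Coord => q.2.2)
    ((ContinuousLinearMap.snd ℝ ℝ ℝ).comp (ContinuousLinearMap.snd ℝ ℝ (ℝ × ℝ))) p :=
    hasFDerivAt_snd.comp p hasFDerivAt_snd
  exact ⟨h.differentiableAt, by simp only [dirD]; rw [h.fderiv]; rfl⟩

theorem hasDir_profile {g : ℝ → ℝ} {g' : ℝ} (hg : HasDerivAt g g' p.2.2) :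
    HasDir v (fun q => g q.2.2) (v.2.2 * g') p := (HasDir.comp hg hasDir_height).to_eq (by simp)

theorem smooth_profile {g : ℝ → ℝ} (hg : ContDiffOn ℝ ∞ g (projZ U)) :
    ContDiffOn ℝ ∞ (fun q : Coord => g q.2.2) U :=
  hg.comp (g := g) (f := fun q : Coord => q.2.2) (by fun_prop) fun _ hq => mem_projZ hq

theorem hasDir_base {l : ℝ × ℝ → ℝ} (hl : DifferentiableAt ℝ l (p.1, p.2.1)) :
    HasDir v (fun q => l (q.1, q.2.1)) (fderiv ℝ l (p.1, p.2.1) (v.1, v.2.1)) p := by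
  have h0 : HasFDerivAt (fun q : Coord => (q.1, q.2.1)) ((ContinuousLinearMap.fst ℝ ℝ (ℝ × ℝ)).prod
    ((ContinuousLinearMap.fst ℝ ℝ ℝ).comp (ContinuousLinearMap.snd ℝ ℝ (ℝ × ℝ)))) p :=
    hasFDerivAt_fst.prodMk (hasFDerivAt_fst.comp p hasFDerivAt_snd)
  have h : HasFDerivAt (fun q : Coord => l (q.1, q.2.1)) _ p :=
    HasFDerivAt.comp (g := l) (f := fun q : Coord => (q.1, q.2.1)) p hl.hasFDerivAt h0
  exact ⟨h.differentiableAt, by simp only [dirD]; rw [h.fderiv]; rfl⟩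

end

namespace IsSplitAngle

variable {U : Set Coord} {lam : ℝ × ℝ → ℝ} {mu : ℝ → ℝ} {c₁ c₂ : ℝ} {p v : Coord}

theorem smooth_phi (hs : IsSplitAngle U lam mu c₁ c₂) : ContDiffOn ℝ ∞ (phi lam mu) U :=
  (hs.smooth_lam.comp (g := lam) (f := fun q : Coord => (q.1, q.2.1)) (by fun_prop)
    fun _ hq => mem_projXY hq).add (smooth_profile hs.smooth_mu)

theorem hasDir_phi (hs : IsSplitAngle U lam mu c₁ c₂) (hU : IsOpen U) (hp : p ∈ U) :
    HasDir v (phi lam mu)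
      (fderiv ℝ lam (p.1, p.2.1) (v.1, v.2.1) + v.2.2 * deriv mu p.2.2) p :=
  (hasDir_base ((hs.smooth_lam.contDiffAt
    ((isOpen_projXY hU).mem_nhds (mem_projXY hp))).differentiableAt (by simp))).add
    (hasDir_profile (hasDerivAt_of_smooth (isOpen_projZ hU) hs.smooth_mu (mem_projZ hp)))

theorem phi_x (hs : IsSplitAngle U lam mu c₁ c₂) (hU : IsOpen U) (hp : p ∈ U) :
    dirD ex (phi lam mu) p = dx₂ lam (p.1, p.2.1) := by
  rw [(hs.hasDir_phi hU hp).eq]; simp [dx₂]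

theorem phi_y (hs : IsSplitAngle U lam mu c₁ c₂) (hU : IsOpen U) (hp : p ∈ U) :
    dirD ey (phi lam mu) p = dy₂ lam (p.1, p.2.1) := by
  rw [(hs.hasDir_phi hU hp).eq]; simp [dy₂]

theorem phi_z (hs : IsSplitAngle U lam mu c₁ c₂) (hU : IsOpen U) (hp : p ∈ U) :
    dirD ez (phi lam mu) p = deriv mu p.2.2 := by
  rw [(hs.hasDir_phi hU hp).eq, show ((ez.1, ez.2.1) : ℝ × ℝ) = 0 from rfl]; simp

theorem hasDir_mu (hs : IsSplitAngle U lam mu c₁ c₂) (hU : IsOpen U) (hp : p ∈ U) :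
    HasDir v (fun q => mu q.2.2) (v.2.2 * deriv mu p.2.2) p :=
  hasDir_profile (hasDerivAt_of_smooth (isOpen_projZ hU) hs.smooth_mu (mem_projZ hp))

theorem hasDir_mu_z (hs : IsSplitAngle U lam mu c₁ c₂) (hU : IsOpen U) (hp : p ∈ U) :
    HasDir v (fun q => deriv mu q.2.2) (v.2.2 * deriv (deriv mu) p.2.2) p :=
  hasDir_profile (hasDerivAt_of_smooth (isOpen_projZ hU)
    (smooth_deriv (isOpen_projZ hU) hs.smooth_mu) (mem_projZ hp))

theorem phi_zz (hs : IsSplitAngle U lam mu c₁ c₂) (hU : IsOpen U) (hp : p ∈ U) :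
    dirD ez (dirD ez (phi lam mu)) p = deriv (deriv mu) p.2.2 := by
  rw [((hs.hasDir_mu_z hU hp).congr hU (fun q hq => hs.phi_z hU hq) hp).eq]; simp

theorem phi_wave (hs : IsSplitAngle U lam mu c₁ c₂) (hU : IsOpen U) (hp : p ∈ U) :
    dirD ex (dirD ex (phi lam mu)) p - dirD ey (dirD ey (phi lam mu)) p =
      c₁ ^ 2 / 2 * Real.sin (2 * lam (p.1, p.2.1)) := by
  have hO := isOpen_projXY hU
  have hd : DifferentiableAt ℝ (fderiv ℝ lam) (p.1, p.2.1) :=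
    ((hs.smooth_lam.fderiv_of_isOpen hO (m := ∞) (by simp)).contDiffAt
      (hO.mem_nhds (mem_projXY hp))).differentiableAt (by simp)
  have h1 : DifferentiableAt ℝ (dx₂ lam) (p.1, p.2.1) :=
    hd.clm_apply (differentiableAt_const _)
  have h2 : DifferentiableAt ℝ (dy₂ lam) (p.1, p.2.1) :=
    hd.clm_apply (differentiableAt_const _)
  rw [((hasDir_base (v := ex) h1).congr hU (fun q hq => hs.phi_x hU hq) hp).eq,
    ((hasDir_base (v := ey) h2).congr hU (fun q hq => hs.phi_y hU hq) hp).eq]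
  exact hs.lam_eq _ (mem_projXY hp)

theorem mu_z_of_zero (hU : IsOpen U) (h0 : ∀ z ∈ projZ U, mu z = 0) :
    ∀ z ∈ projZ U, deriv mu z = 0 := fun z hz => by
  have : mu =ᶠ[nhds z] fun _ => 0 := by
    filter_upwards [(isOpen_projZ hU).mem_nhds hz] with t ht using h0 t ht
  rw [this.deriv_eq, deriv_const]

theorem mu_z_sq (hs : IsSplitAngle U lam mu c₁ c₂) (hU : IsOpen U)
    (h : ∀ z ∈ projZ U, deriv mu z ≠ 0) :
    ∀ z ∈ projZ U, deriv mu z ^ 2 = c₂ ^ 2 - c₁ ^ 2 * Real.sin (mu z) ^ 2 := fun z hz => by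
  rcases hs.mu_eq with h0 | h0
  · exact absurd (mu_z_of_zero hU h0 z hz) (h z hz)
  · exact (h0 z hz).2

/-- Where μ_z ≠ 0, this is the z-derivative of the first integral divided by 2μ_z. For μ ≡ 0 both
sides vanish, so later arguments need not distinguish the cases. -/
theorem mu_zz (hs : IsSplitAngle U lam mu c₁ c₂) (hU : IsOpen U) :
    ∀ z ∈ projZ U, deriv (deriv mu) z = -(c₁ ^ 2 * Real.sin (mu z) * Real.cos (mu z)) := by
  intro z hz
  have hI := isOpen_projZ hU
  rcases hs.mu_eq with h0 | h0
  · rw [mu_z_of_zero hU (mu_z_of_zero hU h0) z hz, h0 z hz]; simp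
  · have d1 := hasDerivAt_of_smooth hI hs.smooth_mu hz
    have d2 := hasDerivAt_of_smooth hI (smooth_deriv hI hs.smooth_mu) hz
    have e : (fun t => deriv mu t ^ 2) =ᶠ[nhds z] fun t => c₂ ^ 2 - c₁ ^ 2 * Real.sin (mu t) ^ 2 := by
      filter_upwards [hI.mem_nhds hz] with t ht using (h0 t ht).2
    have h1 := (d2.pow 2).unique 
      ((((d1.sin.pow 2).const_mul (c₁ ^ 2)).const_sub (c₂ ^ 2)).congr_of_eventuallyEq e)
    have h2 := (h0 z hz).1
    apply mul_left_cancel₀ h2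
    simp at h1
    linear_combination h1 / 2

/-- The first integral of the equation of `μ` that governs the rotation of the hyperplanes. -/
def HasInvariant (U : Set Coord) (mu : ℝ → ℝ) (c₁ Q : ℝ) : Prop :=
  ∀ z ∈ projZ U, (c₁ ^ 2 * (Real.cos (mu z) ^ 2 - Real.sin (mu z) ^ 2) - (1 + deriv mu z ^ 2)) *
    (1 + deriv mu z ^ 2) + deriv (deriv mu) z ^ 2 = Q

theorem hasInvariant_of_zero (hU : IsOpen U) (h0 : ∀ z ∈ projZ U, mu z = 0) :
    HasInvariant U mu c₁ (c₁ ^ 2 - 1) := fun z hz => by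
  rw [mu_z_of_zero hU (mu_z_of_zero hU h0) z hz, mu_z_of_zero hU h0 z hz, h0 z hz]; simp

/-- After substituting for μ_z² and μ_zz, all terms in sin² μ cancel. -/
theorem hasInvariant (hs : IsSplitAngle U lam mu c₁ c₂) (hU : IsOpen U)
    (h : ∀ z ∈ projZ U, deriv mu z ≠ 0) :
    HasInvariant U mu c₁ ((1 + c₂ ^ 2) * (c₁ ^ 2 - c₂ ^ 2 - 1)) := fun z hz => by
  rw [hs.mu_zz hU z hz, hs.mu_z_sq hU h z hz, neg_sq, mul_pow, mul_pow, Real.cos_sq']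
  ring

end IsSplitAngle

/-- The Gauss equation for a split angle. -/
theorem IsGuichardFrame.gauss_split {U : Set Coord} {lam : ℝ × ℝ → ℝ} {mu : ℝ → ℝ} {c₁ c₂ : ℝ}
    {α β σ τ : Coord → ℝ} {e₁ e₂ e₃ N : Coord → E4} {p : Coord}
    (H : IsGuichardFrame U (phi lam mu) α β σ τ e₁ e₂ e₃ N) (hs : IsSplitAngle U lam mu c₁ c₂)
    (hp : p ∈ U) :
    c₁ ^ 2 * (Real.cos (mu p.2.2) ^ 2 - Real.sin (mu p.2.2) ^ 2) =
      1 + α p ^ 2 + β p ^ 2 + σ p ^ 2 - 2 * dirD ez τ p - τ p ^ 2 - deriv mu p.2.2 ^ 2 := by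
  have hU := H.isOpen
  have h := H.wave hp
  rw [hs.phi_wave hU hp, hs.phi_zz hU hp, hs.phi_z hU hp, hs.mu_zz hU _ (mem_projZ hp)] at h
  -- With λ = φ − μ, sin 2λ expands into sin 2φ and cos 2φ. The cos 2φ term cancels against μ_zz,
  -- and the factor sin φ cos φ ≠ 0 divides out.
  have e : lam (p.1, p.2.1) = phi lam mu p - mu p.2.2 := by simp [phi]
  rw [e, Real.sin_two_mul, Real.sin_sub, Real.cos_sub] at h
  have hsc := mul_ne_zero (H.sin_ne p hp) (H.cos_ne p hp)
  apply mul_left_cancel₀ hsc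
  linear_combination h

/-! ### The normal vectors of the hyperplanes and the centers of the spheres -/

/-- The vector `-A = X_γ - μ_z N`. -/
def tilt (mu : ℝ → ℝ) (e₃ N : Coord → E4) (p : Coord) : E4 := e₃ p - deriv mu p.2.2 • N p

/-- The unit vector `-A / √(1 + μ_z²)`. -/
def tiltUnit (mu : ℝ → ℝ) (e₃ N : Coord → E4) (p : Coord) : E4 :=
  (√(1 + deriv mu p.2.2 ^ 2))⁻¹ • tilt mu e₃ N p

theorem one_add_sq_pos (t : ℝ) : 0 < 1 + t ^ 2 := by positivity

theorem inv_sqrt_sq (t : ℝ) : (√(1 + t ^ 2))⁻¹ ^ 2 * (1 + t ^ 2) = 1 := by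
  have := one_add_sq_pos t
  rw [inv_pow, Real.sq_sqrt this.le]; field_simp

namespace IsGuichardFrame

variable {U : Set Coord} {lam : ℝ × ℝ → ℝ} {mu : ℝ → ℝ} {c₁ c₂ : ℝ}
  {α β σ τ l₁ l₂ l₃ : Coord → ℝ} {f e₁ e₂ e₃ N : Coord → E4} {p v : Coord}

theorem hasDir_e₁ {φ : Coord → ℝ} (H : IsGuichardFrame U φ α β σ τ e₁ e₂ e₃ N) (hp : p ∈ U) :
    HasDir v e₁ (dirD v e₁ p) p := hasDir_of_smooth H.isOpen H.smooth_e₁ v hp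

theorem hasDir_e₂ {φ : Coord → ℝ} (H : IsGuichardFrame U φ α β σ τ e₁ e₂ e₃ N) (hp : p ∈ U) :
    HasDir v e₂ (dirD v e₂ p) p := hasDir_of_smooth H.isOpen H.smooth_e₂ v hp

theorem hasDir_e₃ {φ : Coord → ℝ} (H : IsGuichardFrame U φ α β σ τ e₁ e₂ e₃ N) (hp : p ∈ U) :
    HasDir v e₃ (dirD v e₃ p) p := hasDir_of_smooth H.isOpen H.smooth_e₃ v hp

theorem hasDir_N {φ : Coord → ℝ} (H : IsGuichardFrame U φ α β σ τ e₁ e₂ e₃ N) (hp : p ∈ U) :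
    HasDir v N (dirD v N p) p := hasDir_of_smooth H.isOpen H.smooth_N v hp

/-- For the frame of a hypersurface, σμ_z − τ = PK. Together with `tilt_y` this says that the
differential of −A along a slice is K df. -/
theorem tilt_x (H : IsGuichardFrame U (phi lam mu) α β σ τ e₁ e₂ e₃ N)
    (hs : IsSplitAngle U lam mu c₁ c₂) (hp : p ∈ U) :
    HasDir ex (tilt mu e₃ N)
      (((σ p * deriv mu p.2.2 - τ p) * Real.cos (phi lam mu p)) • e₁ p) p := by
  refine ((H.hasDir_e₃ hp).sub ((hs.hasDir_mu_z H.isOpen hp).smul (H.hasDir_N hp))).to_eq ?_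
  rw [H.e₃_x p hp, H.N_x p hp, hs.phi_z H.isOpen hp]
  module

theorem tilt_y (H : IsGuichardFrame U (phi lam mu) α β σ τ e₁ e₂ e₃ N)
    (hs : IsSplitAngle U lam mu c₁ c₂) (hp : p ∈ U) :
    HasDir ey (tilt mu e₃ N)
      (((σ p * deriv mu p.2.2 - τ p) * Real.sin (phi lam mu p)) • e₂ p) p := by
  refine ((H.hasDir_e₃ hp).sub ((hs.hasDir_mu_z H.isOpen hp).smul (H.hasDir_N hp))).to_eq ?_
  rw [H.e₃_y p hp, H.N_y p hp, hs.phi_z H.isOpen hp]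
  module

theorem tilt_z (H : IsGuichardFrame U (phi lam mu) α β σ τ e₁ e₂ e₃ N)
    (hs : IsSplitAngle U lam mu c₁ c₂) (hp : p ∈ U) :
    HasDir ez (tilt mu e₃ N)
      (α p • e₁ p + β p • e₂ p + (deriv mu p.2.2 * σ p) • e₃ p +
        (σ p - deriv (deriv mu) p.2.2) • N p) p := by
  refine ((H.hasDir_e₃ hp).sub ((hs.hasDir_mu_z H.isOpen hp).smul (H.hasDir_N hp))).to_eq ?_
  rw [H.e₃_z p hp, H.N_z p hp]
  module

theorem hasDir_inv_sqrt (hs : IsSplitAngle U lam mu c₁ c₂) (hU : IsOpen U) (hp : p ∈ U) :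
    HasDir v (fun q => (√(1 + deriv mu q.2.2 ^ 2))⁻¹)
      (-((√(1 + deriv mu p.2.2 ^ 2))⁻¹ * (v.2.2 * (deriv mu p.2.2 * deriv (deriv mu) p.2.2)) /
        (1 + deriv mu p.2.2 ^ 2))) p := by
  have h0 := one_add_sq_pos (deriv mu p.2.2)
  have h1 : √(1 + deriv mu p.2.2 ^ 2) ≠ 0 := (Real.sqrt_pos.2 h0).ne'
  have h2 : √(1 + deriv mu p.2.2 ^ 2) ^ 2 = 1 + deriv mu p.2.2 ^ 2 := Real.sq_sqrt h0.le
  have d := (HasDir.const (1 : ℝ)).add (hs.hasDir_mu_z (v := v) hU hp).pow_two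
  refine ((HasDir.comp (Real.hasDerivAt_sqrt h0.ne') d).inv h1).to_eq ?_
  rw [h2, smul_eq_mul]
  field_simp
  ring

/-- If `K = 0`, then `-A / √(1 + μ_z²)` does not depend on `x`. -/
theorem tiltUnit_x (H : IsGuichardFrame U (phi lam mu) α β σ τ e₁ e₂ e₃ N)
    (hs : IsSplitAngle U lam mu c₁ c₂) (hp : p ∈ U) (hk : τ p = σ p * deriv mu p.2.2) :
    HasDir ex (tiltUnit mu e₃ N) 0 p := by
  refine ((hasDir_inv_sqrt hs H.isOpen hp).smul (H.tilt_x hs hp)).to_eq ?_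
  simp [hk]

/-- If `K = 0`, then `-A / √(1 + μ_z²)` does not depend on `y`. -/
theorem tiltUnit_y (H : IsGuichardFrame U (phi lam mu) α β σ τ e₁ e₂ e₃ N)
    (hs : IsSplitAngle U lam mu c₁ c₂) (hp : p ∈ U) (hk : τ p = σ p * deriv mu p.2.2) :
    HasDir ey (tiltUnit mu e₃ N) 0 p := by
  refine ((hasDir_inv_sqrt hs H.isOpen hp).smul (H.tilt_y hs hp)).to_eq ?_
  simp [hk]

/-- Normalizing removes the component along X_γ − μ_z N: what remains beside e₁ and e₂ is a multiple
of the orthogonal vector μ_z X_γ + N. -/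
theorem tiltUnit_z (H : IsGuichardFrame U (phi lam mu) α β σ τ e₁ e₂ e₃ N)
    (hs : IsSplitAngle U lam mu c₁ c₂) (hp : p ∈ U) :
    HasDir ez (tiltUnit mu e₃ N) ((√(1 + deriv mu p.2.2 ^ 2))⁻¹ • (α p • e₁ p + β p • e₂ p +
      ((σ p - deriv (deriv mu) p.2.2 / (1 + deriv mu p.2.2 ^ 2)) * deriv mu p.2.2) • e₃ p +
      (σ p - deriv (deriv mu) p.2.2 / (1 + deriv mu p.2.2 ^ 2)) • N p)) p := by
  refine ((hasDir_inv_sqrt hs H.isOpen hp).smul (H.tilt_z hs hp)).to_eq ?_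
  have h0 := (one_add_sq_pos (deriv mu p.2.2)).ne'
  simp only [tilt]
  match_scalars <;> field_simp <;> ring

theorem inner_tiltUnit_self {φ : Coord → ℝ} (H : IsGuichardFrame U φ α β σ τ e₁ e₂ e₃ N)
    (hp : p ∈ U) : inner ℝ (tiltUnit mu e₃ N p) (tiltUnit mu e₃ N p) = 1 := by
  have F := H.frame p hp
  simp only [tiltUnit, tilt, real_inner_smul_left, real_inner_smul_right, inner_sub_left,
    inner_sub_right, F.i₃₃, F.i₃₄, F.i₄₃, F.i₄₄]
  linear_combination inv_sqrt_sq (deriv mu p.2.2)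

/-- The speed of `-A / √(1 + μ_z²)` in the direction of `z`, if `K = 0`. -/
theorem speed_tiltUnit (H : IsGuichardFrame U (phi lam mu) α β σ τ e₁ e₂ e₃ N)
    (hs : IsSplitAngle U lam mu c₁ c₂) {Q : ℝ} (hQ : IsSplitAngle.HasInvariant U mu c₁ Q)
    (hk : ∀ q ∈ U, τ q = σ q * deriv mu q.2.2) (hp : p ∈ U) :
    α p ^ 2 + β p ^ 2 + (σ p - deriv (deriv mu) p.2.2 / (1 + deriv mu p.2.2 ^ 2)) ^ 2 *
      (1 + deriv mu p.2.2 ^ 2) = Q / (1 + deriv mu p.2.2 ^ 2) := by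
  have hU := H.isOpen
  -- Differentiating τ = σμ_z and inserting Codazzi for σ_z gives τ_z without derivatives of σ, so
  -- the Gauss relation becomes algebraic in α, β, σ.
  have hτz := (((hasDir_of_smooth hU H.smooth_σ ez hp).mul
    (hs.hasDir_mu_z hU hp)).congr hU hk hp).eq
  rw [H.codazzi_z hp, hs.phi_z hU hp, hk p hp] at hτz
  have hg := H.gauss_split hs hp
  rw [hτz, hk p hp] at hg
  have h0 := (one_add_sq_pos (deriv mu p.2.2)).ne'
  rw [← hQ _ (mem_projZ hp), hg]
  field_simp
  ring

theorem inner_tiltUnit_z (H : IsGuichardFrame U (phi lam mu) α β σ τ e₁ e₂ e₃ N)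
    (hs : IsSplitAngle U lam mu c₁ c₂) {Q : ℝ} (hQ : IsSplitAngle.HasInvariant U mu c₁ Q)
    (hk : ∀ q ∈ U, τ q = σ q * deriv mu q.2.2) (hp : p ∈ U) :
    inner ℝ (dirD ez (tiltUnit mu e₃ N) p) (dirD ez (tiltUnit mu e₃ N) p) =
      Q / (1 + deriv mu p.2.2 ^ 2) ^ 2 := by
  have h0 := (one_add_sq_pos (deriv mu p.2.2)).ne'
  rw [(H.tiltUnit_z hs hp).eq, real_inner_smul_left, real_inner_smul_right,
    (H.frame p hp).inner_comb]
  have h1 := H.speed_tiltUnit hs hQ hk hp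
  have h2 := inv_sqrt_sq (deriv mu p.2.2)
  rw [eq_div_iff (pow_ne_zero 2 h0)]
  rw [eq_div_iff h0] at h1
  linear_combination ((√(1 + deriv mu p.2.2 ^ 2))⁻¹ ^ 2 * (1 + deriv mu p.2.2 ^ 2)) * h1 + Q * h2

/-- The unit normal vector of a hyperplane that contains the `(x, y)`-surface through `p`. -/
theorem normal_of_hyperplane (H : IsGuichardFrame U (phi lam mu) α β σ τ e₁ e₂ e₃ N)
    (hs : IsSplitAngle U lam mu c₁ c₂) (hf : ContDiffOn ℝ ∞ f U)
    (hl₁ : ∀ q ∈ U, l₁ q ≠ 0) (hl₂ : ∀ q ∈ U, l₂ q ≠ 0)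
    (hf₁ : ∀ q ∈ U, dirD ex f q = l₁ q • e₁ q) (hf₂ : ∀ q ∈ U, dirD ey f q = l₂ q • e₂ q)
    {B : E4} (hB : ‖B‖ = 1) {d : ℝ} (hp : p ∈ U)
    (h : ∀ q ∈ U, q.2.2 = p.2.2 → inner ℝ B (f q) = d) :
    τ p = σ p * deriv mu p.2.2 ∧
      (tiltUnit mu e₃ N p = B ∨ tiltUnit mu e₃ N p = -B) := by
  have hU := H.isOpen
  have F := H.frame p hp
  have key : ∀ v, v.2.2 = 0 → ∀ q ∈ U, q.2.2 = p.2.2 → inner ℝ B (dirD v f q) = 0 := by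
    intro v hv q hq hqp
    have d1 := (HasDir.const B).inner (hasDir_of_smooth hU hf v hq)
    have := dirD_eq_zero_of_slice (c := d) hU hq d1.diff hv fun q' hq' e => h q' hq' (e.trans hqp)
    rw [d1.eq] at this
    simpa using this
  have k1 : ∀ q ∈ U, q.2.2 = p.2.2 → inner ℝ B (e₁ q) = 0 := fun q hq e => by
    have := key ex rfl q hq e
    rw [hf₁ q hq, real_inner_smul_right] at this
    exact (mul_eq_zero.1 this).resolve_left (hl₁ q hq)
  have k2 : ∀ q ∈ U, q.2.2 = p.2.2 → inner ℝ B (e₂ q) = 0 := fun q hq e => by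
    have := key ey rfl q hq e
    rw [hf₂ q hq, real_inner_smul_right] at this
    exact (mul_eq_zero.1 this).resolve_left (hl₂ q hq)
  have d1 := (HasDir.const B).inner (H.hasDir_e₁ (v := ex) hp)
  have d2 := (HasDir.const B).inner (H.hasDir_e₂ (v := ey) hp)
  -- `B` is orthogonal to e₁ and e₂ throughout the slice. Differentiating once more along x and y
  -- gives two linear equations for the components of `B` along e₃ and `N`.
  have x1 := d1.eq.symm.trans (dirD_eq_zero_of_slice hU hp d1.diff rfl k1)
  have x2 := d2.eq.symm.trans (dirD_eq_zero_of_slice hU hp d2.diff rfl k2)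
  simp only [H.e₁_x p hp, H.e₂_y p hp, inner_add_right, real_inner_smul_right, k1 p hp rfl,
    k2 p hp rfl, inner_zero_left, hs.phi_z hU hp] at x1 x2
  have tr := Real.sin_sq_add_cos_sq (phi lam mu p)
  set s := Real.sin (phi lam mu p)
  set c := Real.cos (phi lam mu p)
  set a := inner ℝ B (e₃ p) with ha
  set b := inner ℝ B (N p) with hb
  -- Rotated by the angle φ, the system reads b + aμ_z = 0 and aτ + bσ = 0. So `B` is a multiple of
  -- −A, and a ≠ 0 forces τ = σμ_z, that is K = 0.
  have hba : b = -(a * deriv mu p.2.2) := by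
    linear_combination s * x1 - c * x2 - (b + a * deriv mu p.2.2) * tr
  have hak : a * (τ p - σ p * deriv mu p.2.2) = 0 := by
    rw [hba] at x1 x2
    linear_combination c * x1 + s * x2 - a * (τ p - σ p * deriv mu p.2.2) * tr
  have hBe : B = a • tilt mu e₃ N p := by
    conv_lhs => rw [F.expand B, k1 p hp rfl, k2 p hp rfl, ← ha, ← hb, hba]
    simp only [tilt]
    module
  have ha2 : a ^ 2 * (1 + deriv mu p.2.2 ^ 2) = 1 := by
    have : inner ℝ B B = (1 : ℝ) := by rw [real_inner_self_eq_norm_sq, hB, one_pow]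
    rw [hBe] at this
    simp only [tilt, real_inner_smul_left, real_inner_smul_right, inner_sub_left,
      inner_sub_right, F.i₃₃, F.i₃₄, F.i₄₃, F.i₄₄] at this
    linear_combination this
  have ha0 : a ≠ 0 := fun h => by rw [h] at ha2; norm_num at ha2
  refine ⟨by linarith [(mul_eq_zero.1 hak).resolve_left ha0], ?_⟩
  have h2 := inv_sqrt_sq (deriv mu p.2.2)
  have h3 : ((√(1 + deriv mu p.2.2 ^ 2))⁻¹) ^ 2 = a ^ 2 :=
    mul_right_cancel₀ (one_add_sq_pos (deriv mu p.2.2)).ne' (h2.trans ha2.symm)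
  rcases sq_eq_sq_iff_eq_or_eq_neg.1 h3 with e | e
  · left; rw [tiltUnit, e, ← hBe]
  · right; rw [tiltUnit, e, neg_smul, ← hBe]

/-- If the `(x, y)`-surfaces lie on spheres centered at the origin, then `K ≠ 0` and
`f = -K⁻¹ A`. -/
theorem center_of_sphere (H : IsGuichardFrame U (phi lam mu) α β σ τ e₁ e₂ e₃ N)
    (hs : IsSplitAngle U lam mu c₁ c₂) (hf : ContDiffOn ℝ ∞ f U) {P : Coord → ℝ}
    (hP : ∀ q ∈ U, P q ≠ 0)
    (hf₁ : ∀ q ∈ U, dirD ex f q = (P q * Real.cos (phi lam mu q)) • e₁ q)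
    (hf₂ : ∀ q ∈ U, dirD ey f q = (P q * Real.sin (phi lam mu q)) • e₂ q)
    {r : ℝ → ℝ} (h : ∀ q ∈ U, ‖f q‖ = r q.2.2) (hp : p ∈ U) :
    σ p * deriv mu p.2.2 - τ p ≠ 0 ∧
      f p = (P p / (σ p * deriv mu p.2.2 - τ p)) • tilt mu e₃ N p := by
  have hU := H.isOpen
  have F := H.frame p hp
  have key : ∀ v, v.2.2 = 0 → ∀ q ∈ U, inner ℝ (f q) (dirD v f q) = 0 := by
    intro v hv q hq
    have d1 := (hasDir_of_smooth hU hf v hq).inner (hasDir_of_smooth hU hf v hq)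
    have := dirD_eq_zero_of_slice (c := r q.2.2 ^ 2) hU hq d1.diff hv fun q' hq' e => by
      rw [real_inner_self_eq_norm_sq, h q' hq', e]
    rw [d1.eq, real_inner_comm] at this
    rw [real_inner_comm]
    linarith
  have k1 : ∀ q ∈ U, inner ℝ (f q) (e₁ q) = 0 := fun q hq => by
    have := key ex rfl q hq
    rw [hf₁ q hq, real_inner_smul_right] at this
    exact (mul_eq_zero.1 this).resolve_left (mul_ne_zero (hP q hq) (H.cos_ne q hq))
  have k2 : ∀ q ∈ U, inner ℝ (f q) (e₂ q) = 0 := fun q hq => by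
    have := key ey rfl q hq
    rw [hf₂ q hq, real_inner_smul_right] at this
    exact (mul_eq_zero.1 this).resolve_left (mul_ne_zero (hP q hq) (H.sin_ne q hq))
  -- Since |f| is constant on slices, f is orthogonal to e₁ and e₂. Compared with the hyperplane
  -- case, the derivatives of these relations have the extra terms ⟨f_x, e₁⟩ = P cos φ and ⟨f_y, e₂⟩
  -- = P sin φ.
  have x1 := ((HasDir.const 0).congr hU k1 hp).unique
    ((hasDir_of_smooth hU hf ex hp).inner (H.hasDir_e₁ hp))
  have x2 := ((HasDir.const 0).congr hU k2 hp).unique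
    ((hasDir_of_smooth hU hf ey hp).inner (H.hasDir_e₂ hp))
  simp only [H.e₁_x p hp, H.e₂_y p hp, hf₁ p hp, hf₂ p hp, inner_add_right, real_inner_smul_right,
    real_inner_smul_left, k1 p hp, k2 p hp, F.i₁₁, F.i₂₂, hs.phi_z hU hp] at x1 x2
  have tr := Real.sin_sq_add_cos_sq (phi lam mu p)
  set s := Real.sin (phi lam mu p)
  set c := Real.cos (phi lam mu p)
  set a := inner ℝ (f p) (e₃ p) with ha
  set b := inner ℝ (f p) (N p) with hb
  have hba : b = -(a * deriv mu p.2.2) := by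
    linear_combination -s * x1 + c * x2 - (b + a * deriv mu p.2.2) * tr
  -- The extra terms make the right side P instead of 0, which excludes K = 0.
  have hak : a * (σ p * deriv mu p.2.2 - τ p) = P p := by
    rw [hba] at x1 x2
    linear_combination c * x1 + s * x2 - (a * (σ p * deriv mu p.2.2 - τ p) - P p) * tr
  have hk0 : σ p * deriv mu p.2.2 - τ p ≠ 0 := fun h0 => by
    rw [h0, mul_zero] at hak; exact hP p hp hak.symm
  refine ⟨hk0, ?_⟩
  rw [← hak, mul_div_cancel_right₀ _ hk0]
  conv_lhs => rw [F.expand (f p), k1 p hp, k2 p hp, ← ha, ← hb, hba]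
  simp only [tilt]
  module

end IsGuichardFrame

/-! ### Auxiliary facts -/

/-! ### The Codazzi equations for κ₃ -/

namespace IsGuichardHypersurface

variable {U : Set Coord} {φ P κ₃ : Coord → ℝ} {f N : Coord → E4} {p v : Coord}

theorem inv_x (H : IsGuichardHypersurface U φ P κ₃ f N) (hp : p ∈ U) :
    dirD ex (fun q => (P q)⁻¹) p = aFun φ P p * Real.cos (φ p) := by
  rw [aFun, div_mul_cancel₀ _ (H.cos_ne hp)]; rfl

theorem inv_y (H : IsGuichardHypersurface U φ P κ₃ f N) (hp : p ∈ U) :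
    dirD ey (fun q => (P q)⁻¹) p = bFun φ P p * Real.sin (φ p) := by
  rw [bFun, div_mul_cancel₀ _ (H.sin_ne hp)]; rfl

theorem dirD_σ (H : IsGuichardHypersurface U φ P κ₃ f N) (hU : IsOpen U) (hp : p ∈ U) :
    dirD v (fun q => P q * κ₃ q) p =
      P p * dirD v κ₃ p - P p ^ 2 * dirD v (fun q => (P q)⁻¹) p * κ₃ p := by
  rw [((hasDir_of_smooth hU H.smooth_P v hp).mul (hasDir_of_smooth hU H.smooth_κ₃ v hp)).eq,
    H.dirD_P hU hp]
  ring

/-- In σ = Pκ₃ the derivative of P contributes exactly the term −ασ cos φ of `codazzi_x`. What is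
left relates κ₃_x to (P⁻¹)_x = a cos φ. -/
theorem κ₃_x (H : IsGuichardHypersurface U φ P κ₃ f N) (hU : IsOpen U)
    (hφ : ContDiffOn ℝ ∞ φ U) (hp : p ∈ U) :
    dirD ex κ₃ p = -(aFun φ P p * Real.sin (φ p)) := by
  have h := (H.isGuichardFrame hU hφ).codazzi_x hp
  rw [H.dirD_σ hU hp, H.inv_x hp] at h
  apply mul_left_cancel₀ (H.P_ne hp)
  linear_combination h

theorem κ₃_y (H : IsGuichardHypersurface U φ P κ₃ f N) (hU : IsOpen U)
    (hφ : ContDiffOn ℝ ∞ φ U) (hp : p ∈ U) :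
    dirD ey κ₃ p = bFun φ P p * Real.cos (φ p) := by
  have h := (H.isGuichardFrame hU hφ).codazzi_y hp
  rw [H.dirD_σ hU hp, H.inv_y hp] at h
  apply mul_left_cancel₀ (H.P_ne hp)
  linear_combination h

theorem κ₃_z (H : IsGuichardHypersurface U φ P κ₃ f N) (hU : IsOpen U)
    (hφ : ContDiffOn ℝ ∞ φ U) (hp : p ∈ U) :
    dirD ez κ₃ p = -(dirD ez φ p * (P p)⁻¹) := by
  have h := (H.isGuichardFrame hU hφ).codazzi_z hp
  rw [H.dirD_σ hU hp] at h
  apply mul_left_cancel₀ (H.P_ne hp)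
  linear_combination h + dirD ez φ p * mul_inv_cancel₀ (H.P_ne hp)

end IsGuichardHypersurface

/-! ### Unit vector fields, planes and isometries of ℝ⁴ -/

section

variable {U : Set Coord} {p v : Coord}

theorem hasDir_euclidean {n : ℕ} {h : Coord → EuclideanSpace ℝ (Fin n)}
    {h' : EuclideanSpace ℝ (Fin n)} (H : ∀ i, HasDir v (fun q => h q i) (h' i) p) :
    HasDir v h h' p := by
  have hd : DifferentiableAt ℝ h p := differentiableAt_euclidean.2 fun i => (H i).diff
  refine ⟨hd, ?_⟩
  ext i
  have := (HasDir.mk (v := v) hd rfl).clm (EuclideanSpace.proj i : EuclideanSpace ℝ (Fin n) →L[ℝ] ℝ)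
  exact this.unique (H i)

theorem hasDir_coord {g : Coord → E4} {g' : E4} (hg : HasDir v g g' p) (i : Fin 4) :
    HasDir v (fun q => g q i) (g' i) p := hg.clm (EuclideanSpace.proj i : E4 →L[ℝ] ℝ)

/-- The vectors e₁, e₂ lie in the hyperplane orthogonal to `E`, on which `M` is injective. Used to
see that projections of f along the normal are still immersed. -/
theorem linearIndependent_image {F : Type*} [AddCommGroup F] [Module ℝ F] (M : E4 →ₗ[ℝ] F)
    {e₁ e₂ e₃ e₄ E : E4} (h : IsFrame e₁ e₂ e₃ e₄) (h₁ : inner ℝ e₁ E = 0) (h₂ : inner ℝ e₂ E = 0)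
    {l₁ l₂ : ℝ} (hl₁ : l₁ ≠ 0) (hl₂ : l₂ ≠ 0)
    (hM : ∀ u, inner ℝ u E = 0 → M u = 0 → u = 0) :
    LinearIndependent ℝ ![M (l₁ • e₁), M (l₂ • e₂)] := by
  rw [LinearIndependent.pair_iff]
  intro s t hst
  rw [← map_smul, ← map_smul, ← map_add] at hst
  have hu := hM _ (by simp [inner_add_left, real_inner_smul_left, h₁, h₂]) hst
  have k1 := congrArg (fun u => inner ℝ u e₁) hu
  have k2 := congrArg (fun u => inner ℝ u e₂) hu
  simp only [inner_add_left, real_inner_smul_left, h.i₁₁, h.i₂₁, h.i₁₂, h.i₂₂,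
    inner_zero_left] at k1 k2
  constructor
  · simpa [hl₁] using k1
  · simpa [hl₂] using k2

/-- A smooth vector field with values in `{B, -B}` is constant. -/
theorem exists_sign {E : Coord → E4} (hU : IsOpen U) (hUc : IsConnected U)
    (hE : ContDiffOn ℝ ∞ E U) {B : E4} (hB : ‖B‖ = 1) (h : ∀ p ∈ U, E p = B ∨ E p = -B) :
    ∃ ε : ℝ, (ε = 1 ∨ ε = -1) ∧ ∀ p ∈ U, E p = ε • B := by
  have hBB : inner ℝ B B = (1 : ℝ) := by rw [real_inner_self_eq_norm_sq, hB, one_pow]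
  have hsq : ∀ q ∈ U, inner ℝ (E q) B ^ 2 = (1 : ℝ) := fun q hq => by
    rcases h q hq with e | e <;> rw [e] <;> simp [hB]
  -- The function ⟨E, B⟩ has square 1. Differentiating gives 2⟨E, B⟩⟨E, B⟩_v = 0, and the first
  -- factor does not vanish.
  have hd : ∀ v, ∀ q ∈ U, HasDir v (fun q => inner ℝ (E q) B) (0 : ℝ) q := fun v q hq => by
    have d := (hasDir_of_smooth hU hE v hq).inner (HasDir.const B)
    have h2 := d.pow_two.unique ((HasDir.const 1).congr hU hsq hq)
    refine d.to_eq ?_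
    have h0 : inner ℝ (E q) B ≠ (0 : ℝ) := fun h0 => by
      have := hsq q hq
      rw [h0] at this; norm_num at this
    simpa [h0] using h2
  obtain ⟨p₀, hp₀⟩ := hUc.nonempty
  refine ⟨inner ℝ (E p₀) B, sq_eq_sq_iff_eq_or_eq_neg.1 ((hsq p₀ hp₀).trans (one_pow 2).symm), fun p hp => ?_⟩
  rw [eq_of_partials_zero hU hUc (hd ex) (hd ey) (hd ez) hp₀ hp]
  rcases h p hp with e | e <;> rw [e] <;> simp [hB]

/-- Membership in `L` means orthogonality to every vector of the complement of `L`, and this passes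
to derivatives. -/
theorem dirD_mem {L : Submodule ℝ E4} {E : Coord → E4} (hU : IsOpen U) {E' : E4}
    (hE : HasDir v E E' p) (hp : p ∈ U) (hL : ∀ q ∈ U, E q ∈ L) : E' ∈ L := by
  rw [← L.orthogonal_orthogonal, Submodule.mem_orthogonal]
  intro n hn
  have d := (HasDir.const n).inner hE
  have h0 : ∀ q ∈ U, inner ℝ n (E q) = (0 : ℝ) := fun q hq => by
    rw [real_inner_comm]; exact (Submodule.mem_orthogonal _ _).1 hn _ (hL q hq)
  simpa using d.unique ((HasDir.const 0).congr hU h0 hp)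

theorem plane_expand {L : Submodule ℝ E4} (hL : Module.finrank ℝ L = 2) {a b : E4} (ha : a ∈ L)
    (hb : b ∈ L) (haa : inner ℝ a a = (1 : ℝ)) (hbb : inner ℝ b b = (1 : ℝ))
    (hab : inner ℝ a b = (0 : ℝ)) {v : E4} (hv : v ∈ L) :
    v = inner ℝ v a • a + inner ℝ v b • b := by
  have hba : inner ℝ b a = (0 : ℝ) := by rw [real_inner_comm, hab]
  have hli : LinearIndependent ℝ ![a, b] := by
    rw [LinearIndependent.pair_iff]
    intro s t hst
    have k1 := congrArg (fun u => inner ℝ u a) hst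
    have k2 := congrArg (fun u => inner ℝ u b) hst
    simp only [inner_add_left, real_inner_smul_left, haa, hba, hab, hbb, inner_zero_left] at k1 k2
    constructor <;> linarith
  have hle : Submodule.span ℝ (Set.range ![a, b]) ≤ L := by
    rw [Submodule.span_le]
    rintro _ ⟨i, rfl⟩
    fin_cases i
    · exact ha
    · exact hb
  have heq := Submodule.eq_of_le_of_finrank_eq hle
    (by rw [finrank_span_eq_card hli, hL, Fintype.card_fin])
  rw [← heq, Matrix.range_cons_cons_empty, Submodule.mem_span_pair] at hv
  obtain ⟨s, t, rfl⟩ := hv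
  simp only [inner_add_left, real_inner_smul_left, haa, hba, hab, hbb]
  module

/-- A unit vector field in a plane that depends on `z` only and has angular speed `ρ' = ν`. -/
theorem exists_rotation {E : Coord → E4} {L : Submodule ℝ E4} {ν ρ : ℝ → ℝ} (hU : IsOpen U)
    (hUc : IsConnected U) (hE : ContDiffOn ℝ ∞ E U) (hL : Module.finrank ℝ L = 2)
    (hEL : ∀ q ∈ U, E q ∈ L) (hEx : ∀ q ∈ U, dirD ex E q = 0) (hEy : ∀ q ∈ U, dirD ey E q = 0)
    (hEE : ∀ q ∈ U, inner ℝ (E q) (E q) = (1 : ℝ))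
    (hν : ∀ z ∈ projZ U, 0 < ν z) (hνd : ∀ z ∈ projZ U, DifferentiableAt ℝ ν z)
    (hρ : ∀ z ∈ projZ U, HasDerivAt ρ (ν z) z)
    (hEz : ∀ q ∈ U, inner ℝ (dirD ez E q) (dirD ez E q) = ν q.2.2 ^ 2) :
    ∃ V₁ ∈ L, ∃ V₂ ∈ L, inner ℝ V₁ V₁ = (1 : ℝ) ∧ inner ℝ V₂ V₂ = (1 : ℝ) ∧
      inner ℝ V₁ V₂ = (0 : ℝ) ∧ ∀ q ∈ U,
        E q = Real.cos (ρ q.2.2) • V₁ + Real.sin (ρ q.2.2) • V₂ ∧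
        dirD ez E q = ν q.2.2 • (-Real.sin (ρ q.2.2) • V₁ + Real.cos (ρ q.2.2) • V₂) := by
  -- E and its normalized derivative u form an orthonormal frame of `L` with E_z = νu; the next
  -- steps establish u_x = u_y = 0 and u_z = −νE.
  set u : Coord → E4 := fun q => (ν q.2.2)⁻¹ • dirD ez E q with hu
  have hν0 : ∀ q ∈ U, ν q.2.2 ≠ 0 := fun q hq => (hν _ (mem_projZ hq)).ne'
  have hEzu : ∀ q ∈ U, dirD ez E q = ν q.2.2 • u q := fun q hq => by
    rw [hu]; simp only; rw [smul_inv_smul₀ (hν0 q hq)]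
  have duv : ∀ v, ∀ q ∈ U, HasDir v u ((ν q.2.2)⁻¹ • dirD v (dirD ez E) q +
      (-(v.2.2 * deriv ν q.2.2) / ν q.2.2 ^ 2) • dirD ez E q) q := fun v q hq =>
    ((hasDir_profile (hνd _ (mem_projZ hq)).hasDerivAt).inv (hν0 q hq)).smul
      (hasDir_of_smooth hU (smooth_dirD hU hE ez) v hq)
  have dux : ∀ q ∈ U, HasDir ex u 0 q := fun q hq => by
    refine (duv ex q hq).to_eq ?_
    rw [dirD_comm hU hE hq, ((HasDir.const 0).congr hU hEx hq).eq]
    simp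
  have duy : ∀ q ∈ U, HasDir ey u 0 q := fun q hq => by
    refine (duv ey q hq).to_eq ?_
    rw [dirD_comm hU hE hq, ((HasDir.const 0).congr hU hEy hq).eq]
    simp
  have huL : ∀ q ∈ U, u q ∈ L := fun q hq =>
    L.smul_mem _ (dirD_mem hU (hasDir_of_smooth hU hE ez hq) hq hEL)
  have huu : ∀ q ∈ U, inner ℝ (u q) (u q) = (1 : ℝ) := fun q hq => by
    have := hν0 q hq
    simp only [hu, real_inner_smul_left, real_inner_smul_right, hEz q hq]
    field_simp
  have hEu : ∀ q ∈ U, inner ℝ (E q) (u q) = (0 : ℝ) := fun q hq => by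
    have d := (hasDir_of_smooth hU hE ez hq).inner (hasDir_of_smooth hU hE ez hq)
    have h1 := d.unique ((HasDir.const 1).congr hU hEE hq)
    rw [real_inner_comm (E q)] at h1
    simp only [hu, real_inner_smul_right]
    rw [show inner ℝ (E q) (dirD ez E q) = (0 : ℝ) by linarith, mul_zero]
  have duz : ∀ q ∈ U, HasDir ez u (-(ν q.2.2) • E q) q := fun q hq => by
    have d := duv ez q hq
    set w := (ν q.2.2)⁻¹ • dirD ez (dirD ez E) q +
      (-(ez.2.2 * deriv ν q.2.2) / ν q.2.2 ^ 2) • dirD ez E q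
    refine d.to_eq ?_
    -- u_z lies in `L`. Its component along u vanishes because |u| = 1, and its component along E is
    -- −ν by differentiating ⟨E, u⟩ = 0.
    rw [plane_expand hL (hEL q hq) (huL q hq) (hEE q hq) (huu q hq) (hEu q hq)
      (dirD_mem hU d hq huL)]
    have h1 := (d.inner d).unique ((HasDir.const 1).congr hU huu hq)
    have h2 := ((hasDir_of_smooth hU hE ez hq).inner d).unique
      ((HasDir.const 0).congr hU hEu hq)
    rw [real_inner_comm] at h1
    rw [hEzu q hq, real_inner_smul_left, huu q hq, real_inner_comm] at h2
    rw [show inner ℝ w (u q) = (0 : ℝ) by linarith,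
      show inner ℝ w (E q) = -ν q.2.2 by linarith]
    simp
  have dρ : ∀ v, ∀ q ∈ U, HasDir v (fun q => ρ q.2.2) (v.2.2 * ν q.2.2) q := fun v q hq =>
    hasDir_profile (hρ _ (mem_projZ hq))
  have dE := fun v q (hq : q ∈ U) => hasDir_of_smooth hU hE v hq
  -- Turning the frame (E, u) back by the angle ρ makes it constant; the two constant vectors are V₁
  -- and V₂.
  have c1 : ∀ q ∈ U, ∀ r ∈ U, Real.cos (ρ q.2.2) • E q - Real.sin (ρ q.2.2) • u q =
      Real.cos (ρ r.2.2) • E r - Real.sin (ρ r.2.2) • u r := fun q hq r hr => by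
    refine eq_of_partials_zero (h := fun q => Real.cos (ρ q.2.2) • E q - Real.sin (ρ q.2.2) • u q)
      hU hUc ?_ ?_ ?_ hq hr
    · intro q hq
      refine (((dρ ex q hq).cos.smul (dE ex q hq)).sub ((dρ ex q hq).sin.smul (dux q hq))).to_eq ?_
      simp [hEx q hq]
    · intro q hq
      refine (((dρ ey q hq).cos.smul (dE ey q hq)).sub ((dρ ey q hq).sin.smul (duy q hq))).to_eq ?_
      simp [hEy q hq]
    · intro q hq
      refine (((dρ ez q hq).cos.smul (dE ez q hq)).sub ((dρ ez q hq).sin.smul (duz q hq))).to_eq ?_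
      rw [hEzu q hq]
      module
  have c2 : ∀ q ∈ U, ∀ r ∈ U, Real.sin (ρ q.2.2) • E q + Real.cos (ρ q.2.2) • u q =
      Real.sin (ρ r.2.2) • E r + Real.cos (ρ r.2.2) • u r := fun q hq r hr => by
    refine eq_of_partials_zero (h := fun q => Real.sin (ρ q.2.2) • E q + Real.cos (ρ q.2.2) • u q)
      hU hUc ?_ ?_ ?_ hq hr
    · intro q hq
      refine (((dρ ex q hq).sin.smul (dE ex q hq)).add ((dρ ex q hq).cos.smul (dux q hq))).to_eq ?_
      simp [hEx q hq]
    · intro q hq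
      refine (((dρ ey q hq).sin.smul (dE ey q hq)).add ((dρ ey q hq).cos.smul (duy q hq))).to_eq ?_
      simp [hEy q hq]
    · intro q hq
      refine (((dρ ez q hq).sin.smul (dE ez q hq)).add ((dρ ez q hq).cos.smul (duz q hq))).to_eq ?_
      rw [hEzu q hq]
      module
  obtain ⟨p₀, hp₀⟩ := hUc.nonempty
  have huE : inner ℝ (u p₀) (E p₀) = (0 : ℝ) := by rw [real_inner_comm, hEu p₀ hp₀]
  have tr := Real.sin_sq_add_cos_sq (ρ p₀.2.2)
  refine ⟨_, L.sub_mem (L.smul_mem (Real.cos (ρ p₀.2.2)) (hEL p₀ hp₀))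
    (L.smul_mem (Real.sin (ρ p₀.2.2)) (huL p₀ hp₀)),
    _, L.add_mem (L.smul_mem (Real.sin (ρ p₀.2.2)) (hEL p₀ hp₀))
    (L.smul_mem (Real.cos (ρ p₀.2.2)) (huL p₀ hp₀)), ?_, ?_, ?_, ?_⟩
  · simp only [inner_sub_left, inner_sub_right, real_inner_smul_left, real_inner_smul_right,
      hEE p₀ hp₀, huu p₀ hp₀, hEu p₀ hp₀, huE]
    linear_combination tr
  · simp only [inner_add_left, inner_add_right, real_inner_smul_left, real_inner_smul_right,
      hEE p₀ hp₀, huu p₀ hp₀, hEu p₀ hp₀, huE]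
    linear_combination tr
  · simp only [inner_sub_left, inner_add_right, real_inner_smul_left, real_inner_smul_right,
      hEE p₀ hp₀, huu p₀ hp₀, hEu p₀ hp₀, huE]
    ring
  · intro q hq
    rw [c1 p₀ hp₀ q hq, c2 p₀ hp₀ q hq]
    have tr := Real.sin_sq_add_cos_sq (ρ q.2.2)
    constructor
    · have : E q = (Real.sin (ρ q.2.2) ^ 2 + Real.cos (ρ q.2.2) ^ 2) • E q := by
        rw [tr, one_smul]
      conv_lhs => rw [this]
      module
    · have : dirD ez E q = (Real.sin (ρ q.2.2) ^ 2 + Real.cos (ρ q.2.2) ^ 2) • ν q.2.2 • u q := by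
        rw [tr, one_smul, hEzu q hq]
      rw [this]
      module

/-- A linear isometry that maps the plane spanned by `V₁, V₂` to the first coordinate plane. -/
theorem exists_isometry {V₁ V₂ : E4} (h₁ : inner ℝ V₁ V₁ = (1 : ℝ)) (h₂ : inner ℝ V₂ V₂ = (1 : ℝ))
    (h₁₂ : inner ℝ V₁ V₂ = (0 : ℝ)) :
    ∃ T : E4 ≃ₗᵢ[ℝ] E4, (∀ v, T v 0 = -inner ℝ V₂ v) ∧ (∀ v, T v 1 = inner ℝ V₁ v) ∧
      (T V₁ 2 = 0 ∧ T V₁ 3 = 0) ∧ T V₂ 2 = 0 ∧ T V₂ 3 = 0 := by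
  have h₂₁ : inner ℝ V₂ V₁ = (0 : ℝ) := by rw [real_inner_comm, h₁₂]
  -- The order −V₂, V₁ gives cos ρ V₁ + sin ρ V₂ the coordinates (−sin ρ, cos ρ). Only the entries 0
  -- and 1 are prescribed; the zeros are placeholders.
  obtain ⟨b, hb⟩ := Orthonormal.exists_orthonormalBasis_extension_of_card_eq (𝕜 := ℝ) (E := E4)
    (ι := Fin 4) (by simp) (v := ![-V₂, V₁, 0, 0]) (s := {0, 1}) (by
      rw [orthonormal_iff_ite]
      rintro ⟨i, hi⟩ ⟨j, hj⟩
      rcases hi with rfl | rfl <;> rcases hj with rfl | rfl <;>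
        simp [Set.domRestrict, Subtype.ext_iff, h₁, h₂, h₁₂, h₂₁, -inner_self_eq_norm_sq_to_K])
  have b0 : b 0 = -V₂ := hb 0 (by simp)
  have b1 : b 1 = V₁ := hb 1 (by simp)
  have e1 := b.repr_self 1
  have e2 := b.repr_self 0
  rw [b1] at e1
  rw [b0, map_neg, neg_eq_iff_eq_neg] at e2
  refine ⟨b.repr, fun v => ?_, fun v => ?_, ?_, ?_⟩
  · rw [b.repr_apply_apply, b0, inner_neg_left]
  · rw [b.repr_apply_apply, b1]
  · rw [e1]; simp
  · rw [e2]; simp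

end

/-! ### Hypersurfaces with a split angle -/

/-- The coefficient of `cos μ` in `P⁻¹`. -/
def cosCoeff (mu : ℝ → ℝ) (P κ₃ : Coord → ℝ) (p : Coord) : ℝ :=
  (P p)⁻¹ * Real.cos (mu p.2.2) - κ₃ p * Real.sin (mu p.2.2)

/-- The coefficient of `sin μ` in `P⁻¹`. -/
def sinCoeff (mu : ℝ → ℝ) (P κ₃ : Coord → ℝ) (p : Coord) : ℝ :=
  (P p)⁻¹ * Real.sin (mu p.2.2) + κ₃ p * Real.cos (mu p.2.2)

theorem inner_basis_three (v : E4) : inner ℝ v !₂[0, 0, 0, 1] = v 3 := by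
  simp [PiLp.inner_apply, Fin.sum_univ_four]

namespace IsGuichardHypersurface

variable {U : Set Coord} {lam : ℝ × ℝ → ℝ} {mu : ℝ → ℝ} {c₁ c₂ : ℝ}
  {P κ₃ : Coord → ℝ} {f N : Coord → E4} {p v : Coord}

theorem frame_split (H : IsGuichardHypersurface U (phi lam mu) P κ₃ f N)
    (hs : IsSplitAngle U lam mu c₁ c₂) (hU : IsOpen U) :
    IsGuichardFrame U (phi lam mu) (fun p => P p * aFun (phi lam mu) P p)
      (fun p => P p * bFun (phi lam mu) P p) (fun p => P p * κ₃ p)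
      (fun p => P p * dirD ez (fun q => (P q)⁻¹) p)
      (unitX (phi lam mu) P f) (unitY (phi lam mu) P f) (Xgamma P f) N :=
  H.isGuichardFrame hU hs.smooth_phi

theorem smooth_tiltUnit (H : IsGuichardHypersurface U (phi lam mu) P κ₃ f N)
    (hs : IsSplitAngle U lam mu c₁ c₂) (hU : IsOpen U) :
    ContDiffOn ℝ ∞ (tiltUnit mu (Xgamma P f) N) U := by
  have h1 := smooth_profile (smooth_deriv (isOpen_projZ hU) hs.smooth_mu)
  have h2 : ContDiffOn ℝ ∞ (fun q : Coord => 1 + deriv mu q.2.2 ^ 2) U :=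
    contDiffOn_const.add (h1.pow 2)
  exact ((h2.sqrt fun q _ => (one_add_sq_pos _).ne').inv fun q _ =>
    (Real.sqrt_pos.2 (one_add_sq_pos _)).ne').smul
    ((H.frame_split hs hU).smooth_e₃.sub (h1.smul H.smooth_N))

theorem neg_smul_Avec (hs : IsSplitAngle U lam mu c₁ c₂) (hU : IsOpen U) (hp : p ∈ U) :
    -((√(1 + deriv mu p.2.2 ^ 2))⁻¹ • Avec (phi lam mu) P f N p) =
      tiltUnit mu (Xgamma P f) N p := by
  have : dz (phi lam mu) p = deriv mu p.2.2 := hs.phi_z hU hp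
  simp only [Avec, tiltUnit, tilt, this]
  module

theorem inner_unitX_tiltUnit (H : IsGuichardHypersurface U (phi lam mu) P κ₃ f N) (hp : p ∈ U) :
    inner ℝ (unitX (phi lam mu) P f p) (tiltUnit mu (Xgamma P f) N p) = (0 : ℝ) := by
  simp [tiltUnit, tilt, real_inner_smul_right, inner_sub_right, (H.isFrame hp).i₁₃,
    (H.isFrame hp).i₁₄]

theorem inner_unitY_tiltUnit (H : IsGuichardHypersurface U (phi lam mu) P κ₃ f N) (hp : p ∈ U) :
    inner ℝ (unitY (phi lam mu) P f p) (tiltUnit mu (Xgamma P f) N p) = (0 : ℝ) := by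
  simp [tiltUnit, tilt, real_inner_smul_right, inner_sub_right, (H.isFrame hp).i₂₃,
    (H.isFrame hp).i₂₄]

theorem inner_Xgamma_tiltUnit (H : IsGuichardHypersurface U (phi lam mu) P κ₃ f N) (hp : p ∈ U) :
    inner ℝ (Xgamma P f p) (tiltUnit mu (Xgamma P f) N p) = (√(1 + deriv mu p.2.2 ^ 2))⁻¹ := by
  simp only [tiltUnit, tilt, real_inner_smul_right, inner_sub_right, (H.isFrame hp).i₃₃,
    (H.isFrame hp).i₃₄]
  ring

theorem hasDir_inv (H : IsGuichardHypersurface U (phi lam mu) P κ₃ f N) (hU : IsOpen U)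
    (hp : p ∈ U) : HasDir v (fun q => (P q)⁻¹) (dirD v (fun q => (P q)⁻¹) p) p :=
  hasDir_of_smooth hU H.smooth_inv v hp

theorem hasDir_cosCoeff (H : IsGuichardHypersurface U (phi lam mu) P κ₃ f N)
    (hs : IsSplitAngle U lam mu c₁ c₂) (hU : IsOpen U) (hp : p ∈ U) :
    HasDir v (cosCoeff mu P κ₃)
      (dirD v (fun q => (P q)⁻¹) p * Real.cos (mu p.2.2) - dirD v κ₃ p * Real.sin (mu p.2.2) -
        v.2.2 * deriv mu p.2.2 * sinCoeff mu P κ₃ p) p := by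
  refine (((H.hasDir_inv hU hp).mul (hs.hasDir_mu hU hp).cos).sub
    ((hasDir_of_smooth hU H.smooth_κ₃ v hp).mul (hs.hasDir_mu hU hp).sin)).to_eq ?_
  simp only [sinCoeff]
  ring

theorem hasDir_sinCoeff (H : IsGuichardHypersurface U (phi lam mu) P κ₃ f N)
    (hs : IsSplitAngle U lam mu c₁ c₂) (hU : IsOpen U) (hp : p ∈ U) :
    HasDir v (sinCoeff mu P κ₃)
      (dirD v (fun q => (P q)⁻¹) p * Real.sin (mu p.2.2) + dirD v κ₃ p * Real.cos (mu p.2.2) +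
        v.2.2 * deriv mu p.2.2 * cosCoeff mu P κ₃ p) p := by
  refine (((H.hasDir_inv hU hp).mul (hs.hasDir_mu hU hp).sin).add
    ((hasDir_of_smooth hU H.smooth_κ₃ v hp).mul (hs.hasDir_mu hU hp).cos)).to_eq ?_
  simp only [cosCoeff]
  ring

theorem κ₃_z_split (H : IsGuichardHypersurface U (phi lam mu) P κ₃ f N)
    (hs : IsSplitAngle U lam mu c₁ c₂) (hU : IsOpen U) (hp : p ∈ U) :
    dirD ez κ₃ p = -(deriv mu p.2.2 * (P p)⁻¹) := by
  rw [H.κ₃_z hU hs.smooth_phi hp, hs.phi_z hU hp]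

/-- If `K = 0`, the coefficients of `P⁻¹` with respect to `cos μ`, `sin μ` do not depend on `z`. -/
theorem cosCoeff_z (H : IsGuichardHypersurface U (phi lam mu) P κ₃ f N)
    (hs : IsSplitAngle U lam mu c₁ c₂) (hU : IsOpen U) (hp : p ∈ U)
    (hk : dirD ez (fun q => (P q)⁻¹) p = κ₃ p * deriv mu p.2.2) :
    HasDir ez (cosCoeff mu P κ₃) 0 p := by
  refine (H.hasDir_cosCoeff hs hU hp).to_eq ?_
  -- For K = 0, (P⁻¹)_z = μ_z κ₃ and κ₃_z = −μ_z P⁻¹: a rotation of (P⁻¹, κ₃) that the coefficients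
  -- undo.
  rw [hk, H.κ₃_z_split hs hU hp, sinCoeff]
  simp only
  ring

theorem sinCoeff_z (H : IsGuichardHypersurface U (phi lam mu) P κ₃ f N)
    (hs : IsSplitAngle U lam mu c₁ c₂) (hU : IsOpen U) (hp : p ∈ U)
    (hk : dirD ez (fun q => (P q)⁻¹) p = κ₃ p * deriv mu p.2.2) :
    HasDir ez (sinCoeff mu P κ₃) 0 p := by
  refine (H.hasDir_sinCoeff hs hU hp).to_eq ?_
  rw [hk, H.κ₃_z_split hs hU hp, cosCoeff]
  simp only
  ring

theorem inv_eq_coeff : (P p)⁻¹ = cosCoeff mu P κ₃ p * Real.cos (mu p.2.2) +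
    sinCoeff mu P κ₃ p * Real.sin (mu p.2.2) := by
  simp only [cosCoeff, sinCoeff]
  linear_combination -(P p)⁻¹ * Real.sin_sq_add_cos_sq (mu p.2.2)

theorem κ₃_eq_coeff : κ₃ p = -(cosCoeff mu P κ₃ p * Real.sin (mu p.2.2)) +
    sinCoeff mu P κ₃ p * Real.cos (mu p.2.2) := by
  simp only [cosCoeff, sinCoeff]
  linear_combination -κ₃ p * Real.sin_sq_add_cos_sq (mu p.2.2)

/-- The normal vectors of hyperplanes that contain the `(x, y)`-surfaces. -/
theorem normal_of_hyperplanes (H : IsGuichardHypersurface U (phi lam mu) P κ₃ f N)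
    (hs : IsSplitAngle U lam mu c₁ c₂) (hU : IsOpen U) {B : ℝ → E4} {d : ℝ → ℝ}
    (hB : ∀ z ∈ projZ U, ‖B z‖ = 1) (h : ∀ p ∈ U, inner ℝ (B p.2.2) (f p) = d p.2.2)
    (hp : p ∈ U) :
    dirD ez (fun q => (P q)⁻¹) p = κ₃ p * deriv mu p.2.2 ∧
      (tiltUnit mu (Xgamma P f) N p = B p.2.2 ∨ tiltUnit mu (Xgamma P f) N p = -B p.2.2) := by
  obtain ⟨h1, h2⟩ := (H.frame_split hs hU).normal_of_hyperplane hs H.smooth_f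
    (fun q hq => mul_ne_zero (H.P_ne hq) (H.cos_ne hq))
    (fun q hq => mul_ne_zero (H.P_ne hq) (H.sin_ne hq)) (fun q hq => H.f_x hq)
    (fun q hq => H.f_y hq) (hB _ (mem_projZ hp)) (d := d p.2.2) hp
    (fun q hq e => by rw [← e]; exact h q hq)
  exact ⟨mul_left_cancel₀ (H.P_ne hp) (by linear_combination h1), h2⟩

end IsGuichardHypersurface

/-! ### Parallel hyperplanes -/

section

variable {U : Set Coord} {lam : ℝ × ℝ → ℝ} {mu : ℝ → ℝ} {c₁ c₂ : ℝ}
  {P κ₃ : Coord → ℝ} {f N : Coord → E4} {p v : Coord}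

/-- The unit normal is constant, so its speed is zero and Q = 0. The speed is a sum of three
squares, each of which must then vanish. -/
theorem StructureA.normal {B : E4} (hA : StructureA U f B)
    (H : IsGuichardHypersurface U (phi lam mu) P κ₃ f N)
    (hs : IsSplitAngle U lam mu c₁ c₂) (hU : IsOpen U) (hUc : IsConnected U) {Q : ℝ}
    (hQ : IsSplitAngle.HasInvariant U mu c₁ Q) :
    ∃ ε : ℝ, (ε = 1 ∨ ε = -1) ∧ (∀ p ∈ U, tiltUnit mu (Xgamma P f) N p = ε • B) ∧ Q = 0 ∧
      ∀ p ∈ U, dirD ez (fun q => (P q)⁻¹) p = κ₃ p * deriv mu p.2.2 ∧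
        aFun (phi lam mu) P p = 0 ∧ bFun (phi lam mu) P p = 0 ∧
        P p * κ₃ p * (1 + deriv mu p.2.2 ^ 2) = deriv (deriv mu) p.2.2 := by
  obtain ⟨hB, d, hd⟩ := hA
  have F := H.frame_split hs hU
  have hn := fun p (hp : p ∈ U) =>
    H.normal_of_hyperplanes hs hU (B := fun _ => B) (d := d) (fun _ _ => hB) hd hp
  have hk : ∀ q ∈ U, P q * dirD ez (fun q => (P q)⁻¹) q = P q * κ₃ q * deriv mu q.2.2 :=
    fun q hq => by rw [(hn q hq).1]; ring
  obtain ⟨ε, hε, hE⟩ := exists_sign hU hUc (H.smooth_tiltUnit hs hU) hB fun p hp => (hn p hp).2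
  have hEz : ∀ q ∈ U, dirD ez (tiltUnit mu (Xgamma P f) N) q = 0 := fun q hq =>
    ((HasDir.const (ε • B)).congr hU hE hq).eq
  have hQ0 : Q = 0 := by
    obtain ⟨p, hp⟩ := hUc.nonempty
    have := F.inner_tiltUnit_z hs hQ hk hp
    rw [hEz p hp, inner_zero_left, eq_comm, div_eq_zero_iff] at this
    exact this.resolve_right (pow_ne_zero 2 (one_add_sq_pos _).ne')
  refine ⟨ε, hε, hE, hQ0, fun p hp => ?_⟩
  have h1 := F.speed_tiltUnit hs hQ hk hp
  rw [hQ0, zero_div] at h1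
  have h0 := one_add_sq_pos (deriv mu p.2.2)
  have hP := H.P_ne hp
  have t1 := sq_nonneg (P p * aFun (phi lam mu) P p)
  have t2 := sq_nonneg (P p * bFun (phi lam mu) P p)
  have t3 := mul_nonneg (sq_nonneg (P p * κ₃ p - deriv (deriv mu) p.2.2 /
    (1 + deriv mu p.2.2 ^ 2))) h0.le
  refine ⟨(hn p hp).1, ?_, ?_, ?_⟩
  · have : (P p * aFun (phi lam mu) P p) ^ 2 = 0 := by linarith
    exact (mul_eq_zero.1 (pow_eq_zero_iff two_ne_zero |>.1 this)).resolve_left hP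
  · have : (P p * bFun (phi lam mu) P p) ^ 2 = 0 := by linarith
    exact (mul_eq_zero.1 (pow_eq_zero_iff two_ne_zero |>.1 this)).resolve_left hP
  · have : (P p * κ₃ p - deriv (deriv mu) p.2.2 / (1 + deriv mu p.2.2 ^ 2)) ^ 2 *
      (1 + deriv mu p.2.2 ^ 2) = 0 := by linarith
    have := (pow_eq_zero_iff two_ne_zero).1 ((mul_eq_zero.1 this).resolve_right h0.ne')
    rw [sub_eq_zero, eq_div_iff h0.ne'] at this
    exact this

/-- The first three coordinates of a vector of `ℝ⁴`. -/
def dropLast : E4 →ₗ[ℝ] EuclideanSpace ℝ (Fin 3) where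
  toFun v := !₂[v 0, v 1, v 2]
  map_add' v w := by ext i; fin_cases i <;> simp
  map_smul' c v := by ext i; fin_cases i <;> simp

/-- The projection of `f` to a hyperplane orthogonal to `-A / √(1 + μ_z²)` is a family of
surfaces. -/
theorem isSurfaceFamily_dropLast (H : IsGuichardHypersurface U (phi lam mu) P κ₃ f N)
    (hU : IsOpen U) (T : E4 ≃ₗᵢ[ℝ] E4)
    (hT : ∀ p ∈ U, T (tiltUnit mu (Xgamma P f) N p) = !₂[0, 0, 0, 1]) :
    IsSurfaceFamily U (fun p => dropLast (T (f p))) := by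
  have hD : ∀ v, ∀ p ∈ U, HasDir v f (dirD v f p) p →
      HasDir v (fun p => dropLast (T (f p))) (dropLast (T (dirD v f p))) p := fun v p hp h =>
    (h.clm (T : E4 →L[ℝ] E4)).clm (LinearMap.toContinuousLinearMap dropLast)
  refine ⟨(LinearMap.toContinuousLinearMap dropLast).contDiff.comp_contDiffOn
    ((T : E4 →L[ℝ] E4).contDiff.comp_contDiffOn H.smooth_f), fun p hp => ?_⟩
  have hd := smooth_differentiableAt hU H.smooth_f hp
  have hx := (hD ex p hp ⟨hd, rfl⟩).eq
  have hy := (hD ey p hp ⟨hd, rfl⟩).eq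
  change LinearIndependent ℝ ![dirD ex _ p, dirD ey _ p]
  rw [hx, hy, H.f_x hp, H.f_y hp]
  refine linearIndependent_image (dropLast.comp (T : E4 →ₗ[ℝ] E4)) (H.isFrame hp)
    (H.inner_unitX_tiltUnit hp) (H.inner_unitY_tiltUnit hp)
    (mul_ne_zero (H.P_ne hp) (H.cos_ne hp)) (mul_ne_zero (H.P_ne hp) (H.sin_ne hp)) ?_
  intro u hu hM
  -- Orthogonality to the normal kills the last coordinate of T u, and `dropLast` accounts for the
  -- other three.
  rw [← T.inner_map_map, hT p hp, inner_basis_three] at hu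
  have h0 := congrArg (fun v => v 0) hM
  have h1 := congrArg (fun v => v 1) hM
  have h2 := congrArg (fun v => v 2) hM
  simp [dropLast] at h0 h1 h2
  apply T.injective
  rw [map_zero]
  ext i
  fin_cases i <;> simp [h0, h1, h2, hu]

theorem StructureA.of_zero {B : E4} (hA : StructureA U f B)
    (H : IsGuichardHypersurface U (phi lam mu) P κ₃ f N)
    (hs : IsSplitAngle U lam mu c₁ c₂) (hU : IsOpen U) (hUc : IsConnected U)
    (hmu : ∀ z ∈ projZ U, mu z = 0) :
    (∀ p ∈ U, κ₃ p = 0) ∧ c₁ ^ 2 = 1 ∧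
      ∃ P₀ : ℝ, 0 < P₀ ∧ (∀ p ∈ U, P p = P₀) ∧
      ∃ ε : ℝ, (ε = 1 ∨ ε = -1) ∧ (∀ p ∈ U, Xgamma P f p = ε • B) ∧
      ∀ T : E4 ≃ₗᵢ[ℝ] E4, T (ε • B) = !₂[0, 0, 0, 1] →
        ∃ (ft : Coord → EuclideanSpace ℝ (Fin 3)) (s : ℝ),
          IsSurfaceFamily U ft ∧ IndepZ U ft ∧
          ∀ p ∈ U, T (f p) = !₂[ft p 0, ft p 1, ft p 2, P₀ * p.2.2 + s] := by
  obtain ⟨ε, hε, hE, hQ, h⟩ := hA.normal H hs hU hUc (IsSplitAngle.hasInvariant_of_zero hU hmu)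
  have hz := fun p (hp : p ∈ U) => IsSplitAngle.mu_z_of_zero hU hmu _ (mem_projZ hp)
  have hzz := fun p (hp : p ∈ U) => IsSplitAngle.mu_z_of_zero hU
    (IsSplitAngle.mu_z_of_zero hU hmu) _ (mem_projZ hp)
  have hκ : ∀ p ∈ U, κ₃ p = 0 := fun p hp => by
    have := (h p hp).2.2.2
    rw [hz p hp, hzz p hp] at this
    simpa [H.P_ne hp] using this
  obtain ⟨p₀, hp₀⟩ := hUc.nonempty
  have hP : ∀ p ∈ U, P p = P p₀ := fun p hp => by
    refine eq_of_partials_zero hU hUc ?_ ?_ ?_ hp hp₀ <;> intro q hq <;>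
      refine (hasDir_of_smooth hU H.smooth_P _ hq).to_eq ?_ <;> rw [H.dirD_P hU hq]
    · rw [H.inv_x hq, (h q hq).2.1]; simp
    · rw [H.inv_y hq, (h q hq).2.2.1]; simp
    · rw [(h q hq).1, hκ q hq]; simp
  have hX : ∀ p ∈ U, Xgamma P f p = ε • B := fun p hp => by
    rw [← hE p hp, tiltUnit, tilt, hz p hp]; simp
  refine ⟨hκ, by linarith, P p₀, H.P_pos p₀ hp₀, hP, ε, hε, hX, fun T hT => ?_⟩
  have h3 : ∀ p, T (f p) 3 = inner ℝ (f p) (ε • B) := fun p => by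
    rw [← T.inner_map_map, hT, inner_basis_three]
  -- The height ⟨f, εB⟩ has gradient (0, 0, P₀), since f_x and f_y are orthogonal to X_γ = εB and
  -- f_z = P₀X_γ. Subtracting P₀z leaves the constant s.
  have d3 : ∀ v, ∀ q ∈ U, HasDir v (fun q => T (f q) 3 - P p₀ * q.2.2)
      (inner ℝ (dirD v f q) (ε • B) - P p₀ * v.2.2) q := fun v q hq => by
    refine ((((hasDir_of_smooth hU H.smooth_f v hq).inner (HasDir.const (ε • B))).sub
      ((HasDir.const (P p₀)).mul hasDir_height)).congr hU (fun q _ => by rw [h3]) hq).to_eq ?_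
    simp
  refine ⟨fun p => dropLast (T (f p)), T (f p₀) 3 - P p₀ * p₀.2.2,
    isSurfaceFamily_dropLast H hU T (fun p hp => by rw [hE p hp, hT]), ?_, fun p hp => ?_⟩
  · refine indepZ_of_dz fun q hq => ?_
    refine (((hasDir_of_smooth hU H.smooth_f ez hq).clm (T : E4 →L[ℝ] E4)).clm
      (LinearMap.toContinuousLinearMap dropLast)).to_eq ?_
    rw [H.f_z hq, hX q hq]
    change dropLast (T _) = 0
    rw [map_smul, hT]
    ext i
    fin_cases i <;> simp [dropLast]
  · have : T (f p) 3 - P p₀ * p.2.2 = T (f p₀) 3 - P p₀ * p₀.2.2 := by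
      refine eq_of_partials_zero (h := fun q : Coord => T (f q) 3 - P p₀ * q.2.2)
        hU hUc ?_ ?_ ?_ hp hp₀ <;> intro q hq <;> refine (d3 _ q hq).to_eq ?_ <;>
        rw [← hE q hq]
      · rw [H.f_x hq, real_inner_smul_left, H.inner_unitX_tiltUnit hq]; simp
      · rw [H.f_y hq, real_inner_smul_left, H.inner_unitY_tiltUnit hq]; simp
      · rw [H.f_z hq, real_inner_smul_left, H.inner_Xgamma_tiltUnit hq, hz q hq, hP q hq]; simp
    ext i
    fin_cases i
    · simp [dropLast]
    · simp [dropLast]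
    · simp [dropLast]
    · simp
      linarith

theorem StructureA.of_ne_zero {B : E4} (hA : StructureA U f B)
    (H : IsGuichardHypersurface U (phi lam mu) P κ₃ f N)
    (hs : IsSplitAngle U lam mu c₁ c₂) (hU : IsOpen U) (hUc : IsConnected U)
    (hmu : ∀ z ∈ projZ U, deriv mu z ≠ 0) :
    ∃ C : ℝ, C ≠ 0 ∧
      (∀ p ∈ U, 0 < C * Real.cos (mu p.2.2) ∧ (P p)⁻¹ = C * Real.cos (mu p.2.2) ∧
        κ₃ p = -(C * Real.sin (mu p.2.2))) ∧
      c₁ ^ 2 - c₂ ^ 2 - 1 = 0 ∧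
      ∃ ε : ℝ, (ε = 1 ∨ ε = -1) ∧
      (∀ p ∈ U, -((√(1 + deriv mu p.2.2 ^ 2))⁻¹ • Avec (phi lam mu) P f N p) = ε • B) ∧
      ∀ T : E4 ≃ₗᵢ[ℝ] E4, T (ε • B) = !₂[0, 0, 0, 1] →
        ∃ (ft : Coord → EuclideanSpace ℝ (Fin 3)) (f4 : ℝ → ℝ),
          IsSurfaceFamily U ft ∧
          (∀ p ∈ U, T (f p) = !₂[ft p 0, ft p 1, ft p 2, f4 p.2.2]) ∧
          ∀ p ∈ U, HasDerivAt f4 (P p / √(1 + deriv mu p.2.2 ^ 2)) p.2.2 ∧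
            (0 < c₁ * Real.cos (mu p.2.2) →
              P p / √(1 + deriv mu p.2.2 ^ 2) = (C * c₁ * Real.cos (mu p.2.2) ^ 2)⁻¹) := by
  obtain ⟨ε, hε, hE, hQ, h⟩ := hA.normal H hs hU hUc (hs.hasInvariant hU hmu)
  have hc : c₁ ^ 2 - c₂ ^ 2 - 1 = 0 := (mul_eq_zero.1 hQ).resolve_left (one_add_sq_pos c₂).ne'
  -- The condition c₁² = 1 + c₂² from Q = 0 turns 1 + μ_z² into a perfect square; in particular cos
  -- μ ≠ 0.
  have hsq : ∀ p ∈ U, 1 + deriv mu p.2.2 ^ 2 = (c₁ * Real.cos (mu p.2.2)) ^ 2 := fun p hp => by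
    rw [hs.mu_z_sq hU hmu _ (mem_projZ hp), mul_pow, Real.cos_sq']
    linear_combination -hc
  have hcos : ∀ p ∈ U, Real.cos (mu p.2.2) ≠ 0 := fun p hp h0 => by
    have h1 := hsq p hp
    have h2 := one_add_sq_pos (deriv mu p.2.2)
    rw [h1, h0] at h2
    norm_num at h2
  -- Pκ₃(1 + μ_z²) = μ_zz now reads Pκ₃ cos μ = −sin μ, which is D = 0.
  have hD : ∀ p ∈ U, sinCoeff mu P κ₃ p = 0 := fun p hp => by
    have h1 := (h p hp).2.2.2
    have hP := H.P_ne hp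
    rw [hsq p hp, hs.mu_zz hU _ (mem_projZ hp)] at h1
    have : P p * c₁ ^ 2 * Real.cos (mu p.2.2) * sinCoeff mu P κ₃ p = 0 := by
      simp only [sinCoeff]
      field_simp
      linear_combination h1
    simpa [hP, hs.c₁_ne, hcos p hp] using this
  obtain ⟨p₀, hp₀⟩ := hUc.nonempty
  have hC : ∀ p ∈ U, cosCoeff mu P κ₃ p = cosCoeff mu P κ₃ p₀ := fun p hp => by
    refine eq_of_partials_zero hU hUc ?_ ?_ (fun q hq => H.cosCoeff_z hs hU hq (h q hq).1) hp hp₀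
      <;> intro q hq <;> refine (H.hasDir_cosCoeff hs hU hq).to_eq ?_
    · rw [H.inv_x hq, H.κ₃_x hU hs.smooth_phi hq, (h q hq).2.1]; simp
    · rw [H.inv_y hq, H.κ₃_y hU hs.smooth_phi hq, (h q hq).2.2.1]; simp
  set C := cosCoeff mu P κ₃ p₀
  have hPC : ∀ p ∈ U, (P p)⁻¹ = C * Real.cos (mu p.2.2) := fun p hp => by
    rw [IsGuichardHypersurface.inv_eq_coeff (mu := mu) (κ₃ := κ₃), hD p hp, hC p hp]; ring
  have hpos : ∀ p ∈ U, 0 < C * Real.cos (mu p.2.2) := fun p hp => by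
    rw [← hPC p hp]; exact inv_pos.2 (H.P_pos p hp)
  refine ⟨C, left_ne_zero_of_mul (hpos p₀ hp₀).ne', fun p hp => ⟨hpos p hp, hPC p hp, ?_⟩, hc,
    ε, hε, fun p hp => ?_, fun T hT => ?_⟩
  · exact (IsGuichardHypersurface.κ₃_eq_coeff (P := P) (mu := mu)).trans
      (by rw [hD p hp, hC p hp]; ring)
  · rw [IsGuichardHypersurface.neg_smul_Avec hs hU hp, hE p hp]
  have h3 : ∀ p, T (f p) 3 = inner ℝ (f p) (ε • B) := fun p => by
    rw [← T.inner_map_map, hT, inner_basis_three]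
  obtain ⟨hB, d, hd⟩ := hA
  -- The fourth coordinate is the signed offset of the hyperplane. Its derivative is ⟨f_z, εB⟩, the
  -- normal part of f_z.
  refine ⟨fun p => dropLast (T (f p)), fun z => ε * d z,
    isSurfaceFamily_dropLast H hU T (fun p hp => by rw [hE p hp, hT]), fun p hp => ?_,
    fun p hp => ⟨?_, fun hc1 => ?_⟩⟩
  · have : T (f p) 3 = ε * d p.2.2 := by
      rw [h3, real_inner_smul_right, real_inner_comm, hd p hp]
    ext i
    fin_cases i
    · simp [dropLast]
    · simp [dropLast]
    · simp [dropLast]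
    · simpa using this
  · have d3 := (hasDir_of_smooth hU H.smooth_f ez hp).inner (HasDir.const (v := ez) (p := p) (ε • B))
    have e3 : inner ℝ (f p) (0 : E4) + inner ℝ (dirD ez f p) (ε • B) =
        P p / √(1 + deriv mu p.2.2 ^ 2) := by
      rw [← hE p hp, H.f_z hp, real_inner_smul_left, H.inner_Xgamma_tiltUnit hp, inner_zero_right,
        zero_add, div_eq_mul_inv]
    rw [e3] at d3
    refine (line_hasDerivAt (x := p.1) (y := p.2.1) (t := p.2.2) d3).congr_of_eventuallyEq ?_
    -- Nothing is assumed about the regularity of `d`. It is differentiable because it agrees, near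
    -- the given height, with ⟨B, f⟩ on a vertical segment inside `U`.
    have hcont : ContinuousAt (fun t : ℝ => ((p.1, p.2.1, t) : Coord)) p.2.2 := by fun_prop
    filter_upwards [hcont.eventually_mem (hU.mem_nhds hp)] with t ht
    rw [real_inner_smul_right, real_inner_comm, hd _ ht]
  · rw [hsq p hp, Real.sqrt_sq hc1.le, ← inv_inv (P p), hPC p hp]
    have := hs.c₁_ne
    have := hcos p hp
    have := left_ne_zero_of_mul (hpos p₀ hp₀).ne'
    field_simp

end

/-! ### Rotating hyperplanes -/

theorem hasDerivAt_integral {I : Set ℝ} (hI : IsOpen I) (hc : I.OrdConnected) {g : ℝ → ℝ}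
    (hg : ContinuousOn g I) {z₀ z : ℝ} (hz₀ : z₀ ∈ I) (hz : z ∈ I) :
    HasDerivAt (fun u => ∫ t in z₀..u, g t) (g z) z :=
  intervalIntegral.integral_hasDerivAt_right
    ((hg.mono (hc.uIcc_subset hz₀ hz)).intervalIntegrable)
    (hg.stronglyMeasurableAtFilter hI z hz) (hg.continuousAt (hI.mem_nhds hz))

section

variable {U : Set Coord} {lam : ℝ × ℝ → ℝ} {mu : ℝ → ℝ} {c₁ c₂ : ℝ}
  {P κ₃ : Coord → ℝ} {f N : Coord → E4} {p v : Coord}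

theorem absq_eq_zero {φ P : Coord → ℝ} (h : absq φ P p = 0) : aFun φ P p = 0 ∧ bFun φ P p = 0 := by
  have h1 := sq_nonneg (aFun φ P p)
  have h2 := sq_nonneg (bFun φ P p)
  rw [absq] at h
  exact ⟨pow_eq_zero_iff two_ne_zero |>.1 (by linarith),
    pow_eq_zero_iff two_ne_zero |>.1 (by linarith)⟩

/-! ### Vanishing of κ₁(P⁻¹)_x and κ₂(P⁻¹)_y -/

namespace IsGuichardHypersurface

theorem phi_deriv_eq_zero_of_absq_ne (H : IsGuichardHypersurface U (phi lam mu) P κ₃ f N)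
    (hs : IsSplitAngle U lam mu c₁ c₂) (hU : IsOpen U)
    (h : ∀ p ∈ U, kappa₁ (phi lam mu) P κ₃ p * dx (fun q => (P q)⁻¹) p = 0 ∧
      kappa₂ (phi lam mu) P κ₃ p * dy (fun q => (P q)⁻¹) p = 0)
    (hp : p ∈ U) (hne : absq (phi lam mu) P p ≠ 0) :
    dirD ex (phi lam mu) p = 0 ∧ dirD ey (phi lam mu) p = 0 := by
  set φ := phi lam mu with hφ
  have sφ : ContDiffOn ℝ ∞ φ U := hs.smooth_phi
  have k1 : ∀ q ∈ U, kappa₁ φ P κ₃ q * Real.cos (φ q) =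
      (P q)⁻¹ * Real.sin (φ q) + κ₃ q * Real.cos (φ q) := fun q hq => by
    have := H.cos_ne hq
    rw [kappa₁, Real.tan_eq_sin_div_cos]; field_simp
  have k2 : ∀ q ∈ U, kappa₂ φ P κ₃ q * Real.sin (φ q) =
      -((P q)⁻¹ * Real.cos (φ q)) + κ₃ q * Real.sin (φ q) := fun q hq => by
    have := H.sin_ne hq
    rw [kappa₂, Real.cot_eq_cos_div_sin]; field_simp
  have e1 : ∀ q ∈ U, aFun φ P q ≠ 0 → (P q)⁻¹ * Real.sin (φ q) + κ₃ q * Real.cos (φ q) = 0 :=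
    fun q hq ha => by
      have h1 : kappa₁ φ P κ₃ q * dirD ex (fun q => (P q)⁻¹) q = 0 := (h q hq).1
      rw [H.inv_x hq] at h1
      rw [← k1 q hq, (mul_eq_zero.1 h1).resolve_right (mul_ne_zero ha (H.cos_ne hq)), zero_mul]
  have e2 : ∀ q ∈ U, bFun φ P q ≠ 0 → -((P q)⁻¹ * Real.cos (φ q)) + κ₃ q * Real.sin (φ q) = 0 :=
    fun q hq hb => by
      have h1 : kappa₂ φ P κ₃ q * dirD ey (fun q => (P q)⁻¹) q = 0 := (h q hq).2
      rw [H.inv_y hq] at h1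
      rw [← k2 q hq, (mul_eq_zero.1 h1).resolve_right (mul_ne_zero hb (H.sin_ne hq)), zero_mul]
  have hw := inv_ne_zero (H.P_ne hp)
  have tr := Real.sin_sq_add_cos_sq (φ p)
  -- κ₁ and κ₂ differ, so they cannot both vanish; hence at most one of a, b is nonzero at a point.
  have no : ¬((P p)⁻¹ * Real.sin (φ p) + κ₃ p * Real.cos (φ p) = 0 ∧
      -((P p)⁻¹ * Real.cos (φ p)) + κ₃ p * Real.sin (φ p) = 0) := by
    rintro ⟨x1, x2⟩
    apply hw
    linear_combination Real.sin (φ p) * x1 - Real.cos (φ p) * x2 - (P p)⁻¹ * tr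
  have cont : ∀ g : Coord → ℝ, ContDiffOn ℝ ∞ g U → IsOpen {q ∈ U | g q ≠ 0} := fun g hg =>
    hg.continuousOn.isOpen_inter_preimage hU isOpen_compl_singleton
  have sa : ContDiffOn ℝ ∞ (aFun φ P) U :=
    (smooth_dirD hU H.smooth_inv ex).div sφ.cos fun q hq => H.cos_ne hq
  have sb : ContDiffOn ℝ ∞ (bFun φ P) U :=
    (smooth_dirD hU H.smooth_inv ey).div sφ.sin fun q hq => H.sin_ne hq
  have dw := fun v => H.hasDir_inv (v := v) hU hp
  have dκ := fun v => hasDir_of_smooth hU H.smooth_κ₃ v hp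
  have dφ := fun v => hasDir_of_smooth hU sφ v hp
  have wx := H.inv_x hp
  have wy := H.inv_y hp
  have κx := H.κ₃_x hU sφ hp
  have κy := H.κ₃_y hU sφ hp
  by_cases ha : aFun φ P p = 0
  · have hb : bFun φ P p ≠ 0 := fun hb => hne (by rw [absq, ha, hb]; ring)
    have E := e2 p hp hb
    have hne' : (P p)⁻¹ * Real.sin (φ p) + κ₃ p * Real.cos (φ p) ≠ 0 := fun h0 => no ⟨h0, E⟩
    -- Where b ≠ 0, κ₂ = 0 on a neighborhood and can be differentiated. By Codazzi the terms with a
    -- and b drop out, and what is left is a derivative of φ times a nonzero factor. The case a ≠ 0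
    -- is symmetric.
    have d : ∀ v, _ := fun v => ((((dw v).mul (dφ v).cos).neg).add ((dκ v).mul (dφ v).sin)).unique
      ((HasDir.const 0).congr (cont _ sb) (fun q hq => e2 q hq.1 hq.2) ⟨hp, hb⟩)
    have dX := d ex
    have dY := d ey
    rw [wx, κx, ha] at dX
    rw [wy, κy] at dY
    constructor
    · refine (mul_eq_zero.1 ?_).resolve_left hne'
      linear_combination dX
    · refine (mul_eq_zero.1 ?_).resolve_left hne'
      linear_combination dY
  · have E := e1 p hp ha
    have hne' : -((P p)⁻¹ * Real.cos (φ p)) + κ₃ p * Real.sin (φ p) ≠ 0 := fun h0 => no ⟨E, h0⟩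
    have hb : bFun φ P p = 0 := by
      by_contra hb
      exact hne' (e2 p hp hb)
    have d : ∀ v, _ := fun v => (((dw v).mul (dφ v).sin).add ((dκ v).mul (dφ v).cos)).unique
      ((HasDir.const 0).congr (cont _ sa) (fun q hq => e1 q hq.1 hq.2) ⟨hp, ha⟩)
    have dX := d ex
    have dY := d ey
    rw [wx, κx] at dX
    rw [wy, κy, hb] at dY
    constructor
    · refine (mul_eq_zero.1 ?_).resolve_left hne'
      linear_combination -dX
    · refine (mul_eq_zero.1 ?_).resolve_left hne'
      linear_combination -dY

/-- If `κ₁ (P⁻¹)_x = κ₂ (P⁻¹)_y = 0`, then `φ` depends on `z` only. -/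
theorem phi_x_phi_y_eq_zero (H : IsGuichardHypersurface U (phi lam mu) P κ₃ f N)
    (hs : IsSplitAngle U lam mu c₁ c₂) (hU : IsOpen U)
    (h : ∀ p ∈ U, kappa₁ (phi lam mu) P κ₃ p * dx (fun q => (P q)⁻¹) p = 0 ∧
      kappa₂ (phi lam mu) P κ₃ p * dy (fun q => (P q)⁻¹) p = 0)
    (hne : NotLocallyZero U (absq (phi lam mu) P)) (hp : p ∈ U) :
    dirD ex (phi lam mu) p = 0 ∧ dirD ey (phi lam mu) p = 0 := by
  have key : ∀ v, (∀ q ∈ U, absq (phi lam mu) P q ≠ 0 → dirD v (phi lam mu) q = 0) →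
      dirD v (phi lam mu) p = 0 := fun v hv => by
    by_contra h0
    -- The set where the derivative of φ is nonzero is open, so if nonempty it would contain a point
    -- with a² + b² ≠ 0, where the derivative vanishes.
    obtain ⟨q, hq, hq'⟩ := hne {q ∈ U | dirD v (phi lam mu) q ≠ 0} (fun q hq => hq.1)
      ((smooth_dirD hU hs.smooth_phi v).continuousOn.isOpen_inter_preimage hU
        isOpen_compl_singleton) ⟨p, hp, h0⟩
    exact hq.2 (hv q hq.1 hq')
  exact ⟨key ex fun q hq hq' => (H.phi_deriv_eq_zero_of_absq_ne hs hU h hq hq').1,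
    key ey fun q hq hq' => (H.phi_deriv_eq_zero_of_absq_ne hs hU h hq hq').2⟩

end IsGuichardHypersurface

/-- Turning a vector of `ℝ⁴` by `-θ` in the first coordinate plane, and forgetting its second
coordinate. -/
def rotateProj (θ : ℝ) : E4 →ₗ[ℝ] E4 where
  toFun u := !₂[Real.cos θ * u 0 + Real.sin θ * u 1, 0, u 2, u 3]
  map_add' v w := by ext i; fin_cases i <;> (simp; try ring)
  map_smul' c v := by ext i; fin_cases i <;> (simp; try ring)

namespace StructureB

variable {L : Submodule ℝ E4} {B : ℝ → E4} {Q : ℝ}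

theorem normal (hB : StructureB U f L B)
    (H : IsGuichardHypersurface U (phi lam mu) P κ₃ f N)
    (hs : IsSplitAngle U lam mu c₁ c₂) (hU : IsOpen U) (hp : p ∈ U) :
    dirD ez (fun q => (P q)⁻¹) p = κ₃ p * deriv mu p.2.2 ∧
      (tiltUnit mu (Xgamma P f) N p = B p.2.2 ∨ tiltUnit mu (Xgamma P f) N p = -B p.2.2) :=
  H.normal_of_hyperplanes hs hU (d := fun _ => 0) (fun z hz => (hB.2.1 z hz).2) hB.2.2 hp

theorem tau_eq (hB : StructureB U f L B)
    (H : IsGuichardHypersurface U (phi lam mu) P κ₃ f N)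
    (hs : IsSplitAngle U lam mu c₁ c₂) (hU : IsOpen U) :
    ∀ q ∈ U, P q * dirD ez (fun q => (P q)⁻¹) q = P q * κ₃ q * deriv mu q.2.2 :=
  fun q hq => by rw [(hB.normal H hs hU hq).1]; ring

theorem tiltUnit_mem (hB : StructureB U f L B)
    (H : IsGuichardHypersurface U (phi lam mu) P κ₃ f N)
    (hs : IsSplitAngle U lam mu c₁ c₂) (hU : IsOpen U) :
    ∀ q ∈ U, tiltUnit mu (Xgamma P f) N q ∈ L := fun q hq => by
  have := (hB.2.1 _ (mem_projZ hq)).1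
  rcases (hB.normal H hs hU hq).2 with e | e <;> rw [e]
  · exact this
  · exact L.neg_mem this

theorem inner_tiltUnit (hB : StructureB U f L B)
    (H : IsGuichardHypersurface U (phi lam mu) P κ₃ f N)
    (hs : IsSplitAngle U lam mu c₁ c₂) (hU : IsOpen U) :
    ∀ q ∈ U, inner ℝ (f q) (tiltUnit mu (Xgamma P f) N q) = (0 : ℝ) := fun q hq => by
  have := hB.2.2 q hq
  rw [real_inner_comm]
  rcases (hB.normal H hs hU hq).2 with e | e <;> rw [e]
  · exact this
  · rw [inner_neg_left, this, neg_zero]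

/-- This is the z-derivative of ⟨f, E⟩ = 0 for E = −A / √(1 + μ_z²), as ⟨f_z, E⟩ = P / √(1 + μ_z²).
It shows that the normal really rotates, and it later gives f¹. -/
theorem inner_tiltUnit_z (hB : StructureB U f L B)
    (H : IsGuichardHypersurface U (phi lam mu) P κ₃ f N)
    (hs : IsSplitAngle U lam mu c₁ c₂) (hU : IsOpen U) (hp : p ∈ U) :
    inner ℝ (f p) (dirD ez (tiltUnit mu (Xgamma P f) N) p) =
      -(P p * (√(1 + deriv mu p.2.2 ^ 2))⁻¹) := by
  have d := ((hasDir_of_smooth hU H.smooth_f ez hp).inner (hasDir_of_smooth hU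
    (H.smooth_tiltUnit hs hU) ez hp)).unique ((HasDir.const 0).congr hU
      (hB.inner_tiltUnit H hs hU) hp)
  rw [H.f_z hp, real_inner_smul_left, H.inner_Xgamma_tiltUnit hp] at d
  linarith

/-- ⟨f, E_z⟩ ≠ 0 implies E_z ≠ 0, and |E_z|² has the sign of Q. -/
theorem invariant_pos (hB : StructureB U f L B)
    (H : IsGuichardHypersurface U (phi lam mu) P κ₃ f N)
    (hs : IsSplitAngle U lam mu c₁ c₂) (hU : IsOpen U) (hUc : IsConnected U)
    (hQ : IsSplitAngle.HasInvariant U mu c₁ Q) : 0 < Q := by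
  obtain ⟨p, hp⟩ := hUc.nonempty
  have h1 := (H.frame_split hs hU).inner_tiltUnit_z hs hQ (hB.tau_eq H hs hU) hp
  have h2 := hB.inner_tiltUnit_z H hs hU hp
  have h3 : dirD ez (tiltUnit mu (Xgamma P f) N) p ≠ 0 := fun h0 => by
    rw [h0, inner_zero_right, eq_comm, neg_eq_zero] at h2
    exact mul_ne_zero (H.P_ne hp) (inv_ne_zero (Real.sqrt_pos.2 (one_add_sq_pos _)).ne') h2
  have h4 := real_inner_self_pos.2 h3
  rw [h1] at h4
  exact (div_pos_iff_of_pos_right (by positivity)).1 h4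

theorem speed (hB : StructureB U f L B)
    (H : IsGuichardHypersurface U (phi lam mu) P κ₃ f N)
    (hs : IsSplitAngle U lam mu c₁ c₂) (hU : IsOpen U)
    (hQ : IsSplitAngle.HasInvariant U mu c₁ Q) (hp : p ∈ U) :
    P p ^ 2 * absq (phi lam mu) P p * (1 + deriv mu p.2.2 ^ 2) +
      (P p * κ₃ p * (1 + deriv mu p.2.2 ^ 2) - deriv (deriv mu) p.2.2) ^ 2 = Q := by
  have h := (H.frame_split hs hU).speed_tiltUnit hs hQ (hB.tau_eq H hs hU) hp
  have h0 := (one_add_sq_pos (deriv mu p.2.2)).ne'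
  rw [absq]
  field_simp at h
  rw [← h]

/-- If a = b = 0 on an open set, `second_z_of_absq_zero` with τ = σμ_z gives μ_zz = σ(1 + μ_z²).
Then both terms of `speed` vanish, against Q > 0. -/
theorem notLocallyZero_absq (hB : StructureB U f L B)
    (H : IsGuichardHypersurface U (phi lam mu) P κ₃ f N)
    (hs : IsSplitAngle U lam mu c₁ c₂) (hU : IsOpen U) (hUc : IsConnected U)
    (hQ : IsSplitAngle.HasInvariant U mu c₁ Q) : NotLocallyZero U (absq (phi lam mu) P) := by
  rintro W hWU hW ⟨p, hp⟩
  by_contra! h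
  have h1 := ((H.frame_split hs hU).second_z_of_absq_zero hWU hW
    (fun q hq => by rw [(absq_eq_zero (h q hq)).1, mul_zero])
    (fun q hq => by rw [(absq_eq_zero (h q hq)).2, mul_zero]) hp).2
  rw [hs.phi_zz hU (hWU hp), hs.phi_z hU (hWU hp), hB.tau_eq H hs hU p (hWU hp)] at h1
  have h2 := hB.speed H hs hU hQ (hWU hp)
  rw [h p hp, show P p * κ₃ p * (1 + deriv mu p.2.2 ^ 2) - deriv (deriv mu) p.2.2 = 0 by
    linear_combination -h1] at h2
  have := hB.invariant_pos H hs hU hUc hQ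
  rw [← h2] at this
  norm_num at this

/-- The rotation of the hyperplanes, and the shape of `f` in adapted coordinates. -/
theorem rotation (hB : StructureB U f L B)
    (H : IsGuichardHypersurface U (phi lam mu) P κ₃ f N)
    (hs : IsSplitAngle U lam mu c₁ c₂) (hU : IsOpen U) (hUc : IsConnected U)
    (hQ : IsSplitAngle.HasInvariant U mu c₁ Q) {ρ : ℝ → ℝ}
    (hρ : ∀ z ∈ projZ U, HasDerivAt ρ (√Q / (1 + deriv mu z ^ 2)) z) :
    ∃ T : E4 ≃ₗᵢ[ℝ] E4, (∀ v ∈ L, T v 2 = 0 ∧ T v 3 = 0) ∧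
      (∀ p ∈ U, T (tiltUnit mu (Xgamma P f) N p) =
        !₂[-Real.sin (ρ p.2.2), Real.cos (ρ p.2.2), 0, 0]) ∧
      ∃ f1 f3 f4 : Coord → ℝ,
        (∀ p ∈ U, 0 < f1 p ∧ f1 p = P p * √((1 + deriv mu p.2.2 ^ 2) / Q)) ∧
        IsSurfaceFamily U (fun p => (!₂[f1 p, 0, f3 p, f4 p] : E4)) ∧
        ∀ p ∈ U, T (f p) = f1 p • !₂[Real.cos (ρ p.2.2), Real.sin (ρ p.2.2), 0, 0] +
          !₂[0, 0, f3 p, f4 p] := by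
  have F := H.frame_split hs hU
  have hk := hB.tau_eq H hs hU
  have hI := isOpen_projZ hU
  have hQ0 := hB.invariant_pos H hs hU hUc hQ
  have hsQ := Real.sqrt_pos.2 hQ0
  obtain ⟨V₁, hV₁, V₂, hV₂, h11, h22, h12, hE⟩ := exists_rotation (E := tiltUnit mu (Xgamma P f) N)
    (ν := fun z => √Q / (1 + deriv mu z ^ 2)) (ρ := ρ) hU hUc (H.smooth_tiltUnit hs hU) hB.1
    (hB.tiltUnit_mem H hs hU) (fun q hq => (F.tiltUnit_x hs hq (hk q hq)).eq)
    (fun q hq => (F.tiltUnit_y hs hq (hk q hq)).eq) (fun q hq => F.inner_tiltUnit_self hq)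
    (fun z _ => div_pos hsQ (one_add_sq_pos _))
    (fun z hz => (differentiableAt_const _).div ((differentiableAt_const _).add
      ((hasDerivAt_of_smooth hI (smooth_deriv hI hs.smooth_mu) hz).differentiableAt.pow 2))
        (one_add_sq_pos _).ne') hρ
    (fun q hq => by
      rw [F.inner_tiltUnit_z hs hQ hk hq, div_pow, Real.sq_sqrt hQ0.le])
  obtain ⟨T, hT0, hT1, ⟨t12, t13⟩, t22, t23⟩ := exists_isometry h11 h22 h12
  have h21 : inner ℝ V₂ V₁ = (0 : ℝ) := by rw [real_inner_comm, h12]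
  have hTL : ∀ v ∈ L, T v 2 = 0 ∧ T v 3 = 0 := fun v hv => by
    rw [plane_expand hB.1 hV₁ hV₂ h11 h22 h12 hv]
    simp [t12, t13, t22, t23]
  have hTE : ∀ p ∈ U, T (tiltUnit mu (Xgamma P f) N p) =
      !₂[-Real.sin (ρ p.2.2), Real.cos (ρ p.2.2), 0, 0] := fun p hp => by
    obtain ⟨x2, x3⟩ := hTL _ (hB.tiltUnit_mem H hs hU p hp)
    have x0 : T (tiltUnit mu (Xgamma P f) N p) 0 = -Real.sin (ρ p.2.2) := by
      rw [hT0, (hE p hp).1, inner_add_right, real_inner_smul_right, real_inner_smul_right, h21, h22]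
      ring
    have x1 : T (tiltUnit mu (Xgamma P f) N p) 1 = Real.cos (ρ p.2.2) := by
      rw [hT1, (hE p hp).1, inner_add_right, real_inner_smul_right, real_inner_smul_right, h11, h12]
      ring
    ext i
    fin_cases i
    · simpa using x0
    · simpa using x1
    · simpa using x2
    · simpa using x3
  -- The two L-coordinates of f solve a rotated system: ⟨f, E⟩ = 0 and ⟨f, E_z⟩ = −P / √(1 + μ_z²).
  -- Dividing the latter by the angular speed √Q / (1 + μ_z²) gives f¹.
  have hf1 : ∀ p ∈ U, T (f p) 0 = P p * √((1 + deriv mu p.2.2 ^ 2) / Q) * Real.cos (ρ p.2.2) ∧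
      T (f p) 1 = P p * √((1 + deriv mu p.2.2 ^ 2) / Q) * Real.sin (ρ p.2.2) := fun p hp => by
    have hr := one_add_sq_pos (deriv mu p.2.2)
    have hr' := Real.sqrt_pos.2 hr
    have hr2 := Real.sq_sqrt hr.le
    have i1 := hB.inner_tiltUnit H hs hU p hp
    have i2 := hB.inner_tiltUnit_z H hs hU hp
    rw [(hE p hp).1, inner_add_right, real_inner_smul_right, real_inner_smul_right] at i1
    rw [(hE p hp).2, real_inner_smul_right, inner_add_right, real_inner_smul_right,
      real_inner_smul_right] at i2
    rw [hT0, hT1, Real.sqrt_div' _ hQ0.le, real_inner_comm, real_inner_comm (f p) V₁]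
    have i3 : -Real.sin (ρ p.2.2) * inner ℝ (f p) V₁ + Real.cos (ρ p.2.2) * inner ℝ (f p) V₂ =
        -(P p * (√(1 + deriv mu p.2.2 ^ 2) / √Q)) := by
      have : √Q / (1 + deriv mu p.2.2 ^ 2) ≠ 0 := (div_pos hsQ hr).ne'
      apply mul_left_cancel₀ this
      rw [i2]
      field_simp
      linear_combination P p * hr2
    have tr := Real.sin_sq_add_cos_sq (ρ p.2.2)
    constructor
    · linear_combination -Real.cos (ρ p.2.2) * i3 - Real.sin (ρ p.2.2) * i1 +
        inner ℝ (f p) V₂ * tr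
    · linear_combination -Real.sin (ρ p.2.2) * i3 + Real.cos (ρ p.2.2) * i1 -
        inner ℝ (f p) V₁ * tr
  have hf1' : ∀ p ∈ U, P p * √((1 + deriv mu p.2.2 ^ 2) / Q) =
      Real.cos (ρ p.2.2) * T (f p) 0 + Real.sin (ρ p.2.2) * T (f p) 1 := fun p hp => by
    rw [(hf1 p hp).1, (hf1 p hp).2]
    linear_combination -(P p * √((1 + deriv mu p.2.2 ^ 2) / Q)) *
      Real.sin_sq_add_cos_sq (ρ p.2.2)
  have sTf : ContDiffOn ℝ ∞ (fun p => T (f p)) U :=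
    (T : E4 →L[ℝ] E4).contDiff.comp_contDiffOn H.smooth_f
  have sTfi := contDiffOn_euclidean.1 sTf
  have dTf : ∀ v, ∀ p ∈ U, HasDir v (fun p => T (f p)) (T (dirD v f p)) p := fun v p hp =>
    (hasDir_of_smooth hU H.smooth_f v hp).clm (T : E4 →L[ℝ] E4)
  refine ⟨T, hTL, hTE, fun p => P p * √((1 + deriv mu p.2.2 ^ 2) / Q), fun p => T (f p) 2,
    fun p => T (f p) 3, fun p hp => ⟨mul_pos (H.P_pos p hp)
      (Real.sqrt_pos.2 (div_pos (one_add_sq_pos _) hQ0)), rfl⟩, ⟨?_, fun p hp => ?_⟩,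
    fun p hp => ?_⟩
  · refine contDiffOn_euclidean.2 fun i => ?_
    fin_cases i
    · refine H.smooth_P.mul (ContDiffOn.sqrt ?_ fun q _ => (div_pos (one_add_sq_pos _) hQ0).ne')
      exact (contDiffOn_const.add ((smooth_profile
        (smooth_deriv hI hs.smooth_mu)).pow 2)).div_const _
    · exact contDiffOn_const
    · exact sTfi 2
    · exact sTfi 3
  · have key : ∀ v : Coord, v.2.2 = 0 → HasDir v
        (fun p => (!₂[P p * √((1 + deriv mu p.2.2 ^ 2) / Q), 0, T (f p) 2, T (f p) 3] : E4))
        (rotateProj (ρ p.2.2) (T (dirD v f p))) p := fun v hv => by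
      have dρ := hasDir_profile (v := v) (hρ _ (mem_projZ hp))
      have d := fun i => hasDir_coord (dTf v p hp) i
      refine hasDir_euclidean fun i => ?_
      fin_cases i
      · refine (((dρ.cos.mul (d 0)).add (dρ.sin.mul (d 1))).congr hU hf1' hp).to_eq ?_
        rw [hv]
        simp [rotateProj]
      · exact HasDir.const 0
      · exact d 2
      · exact d 3
    change LinearIndependent ℝ ![dirD ex _ p, dirD ey _ p]
    rw [(key ex rfl).eq, (key ey rfl).eq, H.f_x hp, H.f_y hp]
    refine linearIndependent_image ((rotateProj (ρ p.2.2)).comp (T : E4 →ₗ[ℝ] E4)) (H.isFrame hp)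
      (H.inner_unitX_tiltUnit hp) (H.inner_unitY_tiltUnit hp)
      (mul_ne_zero (H.P_ne hp) (H.cos_ne hp)) (mul_ne_zero (H.P_ne hp) (H.sin_ne hp)) ?_
    intro u hu hM
    rw [← T.inner_map_map, hTE p hp] at hu
    have h0 := congrArg (fun v => v 0) hM
    have h2 := congrArg (fun v => v 2) hM
    have h3 := congrArg (fun v => v 3) hM
    simp [rotateProj] at h0 h2 h3
    simp [PiLp.inner_apply, Fin.sum_univ_four] at hu
    have tr := Real.sin_sq_add_cos_sq (ρ p.2.2)
    -- The component of u along (cos ρ, sin ρ) is killed by `rotateProj`, the one along (−sin ρ, cos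
    -- ρ) by orthogonality to the normal.
    have y0 : T u 0 = 0 := by
      linear_combination Real.cos (ρ p.2.2) * h0 - Real.sin (ρ p.2.2) * hu - T u 0 * tr
    have y1 : T u 1 = 0 := by
      linear_combination Real.sin (ρ p.2.2) * h0 + Real.cos (ρ p.2.2) * hu - T u 1 * tr
    apply T.injective
    rw [map_zero]
    ext i
    fin_cases i <;> simp [y0, y1, h2, h3]
  · ext i
    fin_cases i
    · simpa using (hf1 p hp).1
    · simpa using (hf1 p hp).2
    · simp
    · simp

end StructureB

end

section

variable {U : Set Coord} {lam : ℝ × ℝ → ℝ} {mu : ℝ → ℝ} {c₁ c₂ : ℝ}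
  {P κ₃ : Coord → ℝ} {f N : Coord → E4} {p v : Coord}

namespace StructureB

variable {L : Submodule ℝ E4} {B : ℝ → E4}

theorem of_zero (hB : StructureB U f L B)
    (H : IsGuichardHypersurface U (phi lam mu) P κ₃ f N)
    (hs : IsSplitAngle U lam mu c₁ c₂) (hU : IsOpen U) (hUc : IsConnected U)
    (hmu : ∀ z ∈ projZ U, mu z = 0) :
    IndepZ U κ₃ ∧ IndepZ U P ∧ NotLocallyZero U κ₃ ∧
    (∀ p ∈ U, P p ^ 2 * (absq (phi lam mu) P p + κ₃ p ^ 2) = c₁ ^ 2 - 1) ∧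
    0 < c₁ ^ 2 - 1 ∧ NotLocallyZero U (absq (phi lam mu) P) ∧
    (∀ p ∈ U, Xgamma P f p = B p.2.2 ∨ Xgamma P f p = -B p.2.2) ∧
    (∀ z₀ : ℝ, ∃ T : E4 ≃ₗᵢ[ℝ] E4,
      (∀ v ∈ L, (T v) 2 = 0 ∧ (T v) 3 = 0) ∧
      (∀ p ∈ U, T (Xgamma P f p) =
        !₂[-Real.sin (√(c₁ ^ 2 - 1) * (p.2.2 - z₀)),
          Real.cos (√(c₁ ^ 2 - 1) * (p.2.2 - z₀)), 0, 0]) ∧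
      ∃ f1 f3 f4 : Coord → ℝ,
        (∀ p ∈ U, 0 < f1 p ∧ f1 p = P p / √(c₁ ^ 2 - 1)) ∧
        IndepZ U f1 ∧ IndepZ U f3 ∧ IndepZ U f4 ∧
        IsSurfaceFamily U (fun p => (!₂[f1 p, 0, f3 p, f4 p] : E4)) ∧
        ∀ p ∈ U, T (f p) =
          f1 p • !₂[Real.cos (√(c₁ ^ 2 - 1) * (p.2.2 - z₀)),
            Real.sin (√(c₁ ^ 2 - 1) * (p.2.2 - z₀)), 0, 0] + !₂[0, 0, f3 p, f4 p]) ∧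
    ¬ ∀ p ∈ U, kappa₁ (phi lam mu) P κ₃ p * dx (fun q => (P q)⁻¹) p = 0 ∧
      kappa₂ (phi lam mu) P κ₃ p * dy (fun q => (P q)⁻¹) p = 0 := by
  have hQ := IsSplitAngle.hasInvariant_of_zero (c₁ := c₁) hU hmu
  have hQ0 := hB.invariant_pos H hs hU hUc hQ
  have hz := fun p (hp : p ∈ U) => IsSplitAngle.mu_z_of_zero hU hmu _ (mem_projZ hp)
  have hzz := fun p (hp : p ∈ U) => IsSplitAngle.mu_z_of_zero hU
    (IsSplitAngle.mu_z_of_zero hU hmu) _ (mem_projZ hp)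
  have hX : ∀ p ∈ U, tiltUnit mu (Xgamma P f) N p = Xgamma P f p := fun p hp => by
    rw [tiltUnit, tilt, hz p hp]; simp
  have hspeed : ∀ p ∈ U, P p ^ 2 * (absq (phi lam mu) P p + κ₃ p ^ 2) = c₁ ^ 2 - 1 :=
    fun p hp => by
      have := hB.speed H hs hU hQ hp
      rw [hz p hp, hzz p hp] at this
      linear_combination this
  have hP : IndepZ U P := indepZ_of_dz fun q hq => by
    refine (hasDir_of_smooth hU H.smooth_P ez hq).to_eq ?_
    rw [H.dirD_P hU hq, (hB.normal H hs hU hq).1, hz q hq]; simp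
  have hne := hB.notLocallyZero_absq H hs hU hUc hQ
  refine ⟨indepZ_of_dz fun q hq => ?_, hP, ?_, hspeed, hQ0, hne, fun p hp => ?_, fun z₀ => ?_,
    fun h => ?_⟩
  · refine (hasDir_of_smooth hU H.smooth_κ₃ ez hq).to_eq ?_
    rw [H.κ₃_z_split hs hU hq, hz q hq]; simp
  · rintro W hWU hW ⟨p, hp⟩
    by_contra! h
    -- If κ₃ vanishes on an open set, then Codazzi gives a = b = 0 there, which contradicts the
    -- identity P²(a² + b² + κ₃²) = c₁² − 1 > 0.
    have h1 := H.κ₃_x hU hs.smooth_phi (hWU hp)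
    have h2 := H.κ₃_y hU hs.smooth_phi (hWU hp)
    have h0 : ∀ v, dirD v κ₃ p = 0 := fun v => ((HasDir.const 0).congr hW h hp).eq
    rw [h0, eq_comm, neg_eq_zero, mul_eq_zero] at h1
    rw [h0, eq_comm, mul_eq_zero] at h2
    have h3 := hspeed p (hWU hp)
    rw [absq, h1.resolve_right (H.sin_ne (hWU hp)), h2.resolve_right (H.cos_ne (hWU hp)), h p hp]
      at h3
    rw [← h3] at hQ0
    norm_num at hQ0
  · rw [← hX p hp]; exact (hB.normal H hs hU hp).2
  · obtain ⟨T, hTL, hTE, f1, f3, f4, h1, h2, h3⟩ := hB.rotation H hs hU hUc hQ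
      (ρ := fun z => √(c₁ ^ 2 - 1) * (z - z₀)) (fun z hz => by
        rw [IsSplitAngle.mu_z_of_zero hU hmu z hz]
        exact (((hasDerivAt_id z).sub_const z₀).const_mul (√(c₁ ^ 2 - 1))).congr_deriv (by simp))
    have hTX : ∀ p ∈ U, T (Xgamma P f p) = !₂[-Real.sin (√(c₁ ^ 2 - 1) * (p.2.2 - z₀)),
          Real.cos (√(c₁ ^ 2 - 1) * (p.2.2 - z₀)), 0, 0] := fun p hp => by
      rw [← hX p hp]; exact hTE p hp
    have h1' : ∀ p ∈ U, f1 p = P p / √(c₁ ^ 2 - 1) := fun p hp => by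
      rw [(h1 p hp).2, hz p hp, Real.sqrt_div' _ hQ0.le]; simp [div_eq_mul_inv]
    have dT : ∀ q ∈ U, HasDir ez (fun q => T (f q)) (P q • T (Xgamma P f q)) q := fun q hq => by
      rw [← map_smul, ← H.f_z hq]
      exact (hasDir_of_smooth hU H.smooth_f ez hq).clm (T : E4 →L[ℝ] E4)
    refine ⟨T, hTL, hTX, f1, f3, f4, fun p hp => ⟨(h1 p hp).1, h1' p hp⟩, ?_, ?_, ?_, h2, h3⟩
    · intro x y z z' hseg
      rw [h1' _ (hseg z Set.left_mem_uIcc), h1' _ (hseg z' Set.right_mem_uIcc), hP x y z z' hseg]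
    · refine indepZ_of_dz fun q hq => ((hasDir_coord (dT q hq) 2).congr hU (fun r hr => ?_)
        hq).to_eq ?_
      · rw [h3 r hr]; simp
      · rw [hTX q hq]; simp
    · refine indepZ_of_dz fun q hq => ((hasDir_coord (dT q hq) 3).congr hU (fun r hr => ?_)
        hq).to_eq ?_
      · rw [h3 r hr]; simp
      · rw [hTX q hq]; simp
  · obtain ⟨p, hp⟩ := hUc.nonempty
    have hxy := fun q (hq : q ∈ U) => H.phi_x_phi_y_eq_zero hs hU h hne hq
    -- φ = λ is constant, so the equation for λ forces sin 2φ = 0, which is excluded.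
    have hw := hs.phi_wave hU hp
    rw [((HasDir.const 0).congr hU (fun q hq => (hxy q hq).1) hp).eq,
      ((HasDir.const 0).congr hU (fun q hq => (hxy q hq).2) hp).eq, Real.sin_two_mul,
      show lam (p.1, p.2.1) = phi lam mu p by simp [phi, hmu _ (mem_projZ hp)]] at hw
    have hc := hs.c₁_ne
    have := H.angle p hp
    refine mul_ne_zero (pow_ne_zero 2 hc) this ?_
    linear_combination -hw

/-- This is `speed` divided by P² and written in C and D. The right side contains no z-dependent
quantity besides C and D, so a² + b² is independent of z. -/
theorem absq_eq (hB : StructureB U f L B)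
    (H : IsGuichardHypersurface U (phi lam mu) P κ₃ f N)
    (hs : IsSplitAngle U lam mu c₁ c₂) (hU : IsOpen U)
    (hmu : ∀ z ∈ projZ U, deriv mu z ≠ 0) (hp : p ∈ U) :
    cosCoeff mu P κ₃ p ^ 2 * (c₁ ^ 2 - c₂ ^ 2 - 1) - sinCoeff mu P κ₃ p ^ 2 * (c₂ ^ 2 + 1) =
      absq (phi lam mu) P p := by
  have h := hB.speed H hs hU (hs.hasInvariant hU hmu) hp
  have h0 := (one_add_sq_pos (deriv mu p.2.2)).ne'
  have hP := H.P_ne hp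
  rw [hs.mu_zz hU _ (mem_projZ hp)] at h
  rw [hs.mu_z_sq hU hmu _ (mem_projZ hp)] at h h0
  have tr := Real.sin_sq_add_cos_sq (mu p.2.2)
  have hw := IsGuichardHypersurface.inv_eq_coeff (p := p) (P := P) (κ₃ := κ₃) (mu := mu)
  have hκ := IsGuichardHypersurface.κ₃_eq_coeff (p := p) (P := P) (κ₃ := κ₃) (mu := mu)
  have hPw := mul_inv_cancel₀ hP
  set C := cosCoeff mu P κ₃ p
  set D := sinCoeff mu P κ₃ p
  set S := Real.sin (mu p.2.2)
  set K := Real.cos (mu p.2.2)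
  set w := (P p)⁻¹
  set n := c₁ ^ 2 - c₂ ^ 2 - 1 with hn
  have hX : κ₃ p * (1 + (c₂ ^ 2 - c₁ ^ 2 * S ^ 2)) + w * (c₁ ^ 2 * S * K) =
      C * S * n + D * (c₂ ^ 2 + 1) * K := by
    rw [hw, hκ, hn]
    linear_combination C * S * c₁ ^ 2 * tr
  have h2 : absq (phi lam mu) P p * (1 + (c₂ ^ 2 - c₁ ^ 2 * S ^ 2)) +
      (κ₃ p * (1 + (c₂ ^ 2 - c₁ ^ 2 * S ^ 2)) + w * (c₁ ^ 2 * S * K)) ^ 2 =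
      w ^ 2 * ((1 + c₂ ^ 2) * n) := by
    rw [← h]
    have e : ∀ x y : ℝ, w ^ 2 * (P p ^ 2 * x + (P p * y + c₁ ^ 2 * S * K) ^ 2) =
        x + (y + w * (c₁ ^ 2 * S * K)) ^ 2 := fun x y => by
      linear_combination (x * (P p * w + 1) + y ^ 2 * (P p * w + 1) +
        2 * y * w * (c₁ ^ 2 * S * K)) * hPw
    have := e (absq (phi lam mu) P p * (1 + (c₂ ^ 2 - c₁ ^ 2 * S ^ 2)))
      (κ₃ p * (1 + (c₂ ^ 2 - c₁ ^ 2 * S ^ 2)))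
    rw [← this]
    ring
  rw [hX, hw] at h2
  -- With n = c₁² − c₂² − 1 and m = c₂² + 1, one has 1 + μ_z² = m cos² μ − n sin² μ. The mixed terms
  -- in CD cancel, and this factor splits off.
  apply mul_right_cancel₀ h0
  linear_combination -h2 - (C ^ 2 * n - D ^ 2 * (c₂ ^ 2 + 1)) * (c₂ ^ 2 + 1) * tr +
    (C ^ 2 * n - D ^ 2 * (c₂ ^ 2 + 1)) * S ^ 2 * hn

theorem of_ne_zero (hB : StructureB U f L B)
    (H : IsGuichardHypersurface U (phi lam mu) P κ₃ f N)
    (hs : IsSplitAngle U lam mu c₁ c₂) (hU : IsOpen U) (hUc : IsConnected U)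
    (hmu : ∀ z ∈ projZ U, deriv mu z ≠ 0) :
    (∃ C D : Coord → ℝ, IndepZ U C ∧ IndepZ U D ∧
      ∀ p ∈ U, (P p)⁻¹ = C p * Real.cos (mu p.2.2) + D p * Real.sin (mu p.2.2) ∧
        κ₃ p = -(C p * Real.sin (mu p.2.2)) + D p * Real.cos (mu p.2.2) ∧
        C p ^ 2 * (c₁ ^ 2 - c₂ ^ 2 - 1) - D p ^ 2 * (c₂ ^ 2 + 1) =
          absq (phi lam mu) P p) ∧
    0 < c₁ ^ 2 - c₂ ^ 2 - 1 ∧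
    IndepZ U (absq (phi lam mu) P) ∧ NotLocallyZero U (absq (phi lam mu) P) ∧
    (∀ p ∈ U,
      -((√(1 + deriv mu p.2.2 ^ 2))⁻¹ • Avec (phi lam mu) P f N p) = B p.2.2 ∨
      -((√(1 + deriv mu p.2.2 ^ 2))⁻¹ • Avec (phi lam mu) P f N p) = -B p.2.2) ∧
    (∀ z₀ ∈ projZ U, ∃ (ρ : ℝ → ℝ) (T : E4 ≃ₗᵢ[ℝ] E4),
      ρ z₀ = 0 ∧
      (∀ z ∈ projZ U, HasDerivAt ρ
        (√((1 + c₂ ^ 2) * (c₁ ^ 2 - c₂ ^ 2 - 1)) / (1 + deriv mu z ^ 2)) z) ∧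
      (∀ v ∈ L, (T v) 2 = 0 ∧ (T v) 3 = 0) ∧
      (∀ p ∈ U,
        T (-((√(1 + deriv mu p.2.2 ^ 2))⁻¹ • Avec (phi lam mu) P f N p)) =
          !₂[-Real.sin (ρ p.2.2), Real.cos (ρ p.2.2), 0, 0]) ∧
      ∃ f1 f3 f4 : Coord → ℝ,
        (∀ p ∈ U, 0 < f1 p ∧
          f1 p = P p * √((1 + deriv mu p.2.2 ^ 2) /
            ((1 + c₂ ^ 2) * (c₁ ^ 2 - c₂ ^ 2 - 1)))) ∧
        IsSurfaceFamily U (fun p => (!₂[f1 p, 0, f3 p, f4 p] : E4)) ∧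
        ∀ p ∈ U, T (f p) =
          f1 p • !₂[Real.cos (ρ p.2.2), Real.sin (ρ p.2.2), 0, 0] +
            !₂[0, 0, f3 p, f4 p]) ∧
    ((¬ ∃ c : ℝ, ∀ q ∈ projXY U, lam q = c) →
      ¬ ∀ p ∈ U, kappa₁ (phi lam mu) P κ₃ p * dx (fun q => (P q)⁻¹) p = 0 ∧
        kappa₂ (phi lam mu) P κ₃ p * dy (fun q => (P q)⁻¹) p = 0) := by
  have hQ := hs.hasInvariant hU hmu
  have hQ0 := hB.invariant_pos H hs hU hUc hQ
  have hne := hB.notLocallyZero_absq H hs hU hUc hQ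
  have hI := isOpen_projZ hU
  have hC : IndepZ U (cosCoeff mu P κ₃) := indepZ_of_dz fun q hq =>
    H.cosCoeff_z hs hU hq (hB.normal H hs hU hq).1
  have hD : IndepZ U (sinCoeff mu P κ₃) := indepZ_of_dz fun q hq =>
    H.sinCoeff_z hs hU hq (hB.normal H hs hU hq).1
  have hA := fun p (hp : p ∈ U) =>
    IsGuichardHypersurface.neg_smul_Avec (P := P) (f := f) (N := N) hs hU hp
  refine ⟨⟨_, _, hC, hD, fun p hp => ⟨IsGuichardHypersurface.inv_eq_coeff,
    IsGuichardHypersurface.κ₃_eq_coeff, hB.absq_eq H hs hU hmu hp⟩⟩,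
    (mul_pos_iff_of_pos_left (one_add_sq_pos c₂)).1 hQ0, ?_, hne, fun p hp => ?_, fun z₀ hz₀ => ?_,
    fun hlam h => hlam ?_⟩
  · intro x y z z' hseg
    rw [← hB.absq_eq H hs hU hmu (hseg z Set.left_mem_uIcc),
      ← hB.absq_eq H hs hU hmu (hseg z' Set.right_mem_uIcc), hC x y z z' hseg, hD x y z z' hseg]
  · rw [hA p hp]; exact (hB.normal H hs hU hp).2
  · have hρ : ∀ z ∈ projZ U, HasDerivAt
        (fun z => ∫ t in z₀..z, √((1 + c₂ ^ 2) * (c₁ ^ 2 - c₂ ^ 2 - 1)) / (1 + deriv mu t ^ 2))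
        (√((1 + c₂ ^ 2) * (c₁ ^ 2 - c₂ ^ 2 - 1)) / (1 + deriv mu z ^ 2)) z := fun z hz =>
      hasDerivAt_integral (g := fun t => √((1 + c₂ ^ 2) * (c₁ ^ 2 - c₂ ^ 2 - 1)) /
        (1 + deriv mu t ^ 2)) hI (ordConnected_projZ hUc)
        (continuousOn_const.div (continuousOn_const.add
          ((smooth_deriv hI hs.smooth_mu).continuousOn.pow 2)) fun t _ => (one_add_sq_pos _).ne')
        hz₀ hz
    obtain ⟨T, hTL, hTE, h⟩ := hB.rotation H hs hU hUc hQ hρ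
    exact ⟨_, T, intervalIntegral.integral_same, hρ, hTL,
      fun p hp => by rw [hA p hp]; exact hTE p hp, h⟩
  · obtain ⟨p₀, hp₀⟩ := hUc.nonempty
    refine ⟨lam (p₀.1, p₀.2.1), ?_⟩
    rintro _ ⟨p, hp, rfl⟩
    have hxy := fun q (hq : q ∈ U) => H.phi_x_phi_y_eq_zero hs hU h hne hq
    have d : ∀ v, ∀ q ∈ U, HasDir v (fun q : Coord => lam (q.1, q.2.1))
        (dirD v (phi lam mu) q - v.2.2 * deriv mu q.2.2) q := fun v q hq =>
      ((hasDir_of_smooth hU hs.smooth_phi v hq).sub (hs.hasDir_mu hU hq)).congr hU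
        (fun r _ => by simp [phi]) hq
    refine eq_of_partials_zero (h := fun q : Coord => lam (q.1, q.2.1)) hU hUc ?_ ?_ ?_ hp hp₀ <;>
      intro q hq <;> refine (d _ q hq).to_eq ?_
    · rw [(hxy q hq).1]; simp
    · rw [(hxy q hq).2]; simp
    · rw [hs.phi_z hU hq]; simp

end StructureB

end

/-! ### Concentric spheres -/

section

variable {U : Set Coord} {lam : ℝ × ℝ → ℝ} {mu : ℝ → ℝ} {c₁ c₂ : ℝ}
  {P κ₃ : Coord → ℝ} {f N : Coord → E4} {p v : Coord}

theorem exists_sign_mul_sqrt {k q : ℝ} (hk : k ≠ 0) (hq : k ^ 2 = q) :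
    ∃ ε : ℝ, (ε = 1 ∨ ε = -1) ∧ k = ε * √q := by
  rw [← hq, Real.sqrt_sq_eq_abs]
  rcases lt_or_gt_of_ne hk with h | h
  · exact ⟨-1, Or.inr rfl, by rw [abs_of_neg h]; ring⟩
  · exact ⟨1, Or.inl rfl, by rw [abs_of_pos h]; ring⟩

/-- A sign is its own inverse. -/
theorem sign_mul_inv {k ε q : ℝ} (hε : ε = 1 ∨ ε = -1) (hk : k = ε * q) : k⁻¹ = ε * (1 / q) := by
  rw [hk]
  rcases hε with rfl | rfl <;> simp [inv_neg]

namespace StructureC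

theorem K_eq (hs : IsSplitAngle U lam mu c₁ c₂) (hU : IsOpen U) (hp : p ∈ U) :
    P p * Kfun (phi lam mu) P κ₃ p =
      P p * κ₃ p * deriv mu p.2.2 - P p * dirD ez (fun q => (P q)⁻¹) p := by
  have h1 : dz (phi lam mu) p = deriv mu p.2.2 := hs.phi_z hU hp
  have h2 : dz (fun q => (P q)⁻¹) p = dirD ez (fun q => (P q)⁻¹) p := rfl
  rw [Kfun, h1, h2]
  ring

/-- The form −A = K f, without division, is the one that is differentiated afterwards. -/
theorem center (hC : StructureC U f) (H : IsGuichardHypersurface U (phi lam mu) P κ₃ f N)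
    (hs : IsSplitAngle U lam mu c₁ c₂) (hU : IsOpen U) (hp : p ∈ U) :
    Kfun (phi lam mu) P κ₃ p ≠ 0 ∧
      tilt mu (Xgamma P f) N p = Kfun (phi lam mu) P κ₃ p • f p := by
  obtain ⟨r, hr⟩ := hC
  obtain ⟨h1, h2⟩ := (H.frame_split hs hU).center_of_sphere hs H.smooth_f (fun q hq => H.P_ne hq)
    (fun q hq => H.f_x hq) (fun q hq => H.f_y hq) (r := r)
    (fun q hq => mem_sphere_zero_iff_norm.1 (hr q hq)) hp
  rw [← K_eq hs hU hp] at h1 h2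
  have hK := right_ne_zero_of_mul h1
  refine ⟨hK, ?_⟩
  have hP := H.P_ne hp
  rw [h2, smul_smul, show Kfun (phi lam mu) P κ₃ p * (P p / (P p * Kfun (phi lam mu) P κ₃ p)) = 1 by
    field_simp, one_smul]

/-- Differentiate −A = K f. Along x and y the terms K df match, leaving K_x f = K_y f = 0 with f ≠
0. Along z, f is a multiple of X_γ − μ_z N, and the four frame components give a = b = 0, K_z / K =
τ and σ − μ_zz = −μ_z τ. -/
theorem derivatives (hC : StructureC U f) (H : IsGuichardHypersurface U (phi lam mu) P κ₃ f N)
    (hs : IsSplitAngle U lam mu c₁ c₂) (hU : IsOpen U) (hp : p ∈ U) :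
    dirD ex (Kfun (phi lam mu) P κ₃) p = 0 ∧ dirD ey (Kfun (phi lam mu) P κ₃) p = 0 ∧
    dirD ez (Kfun (phi lam mu) P κ₃) p =
      Kfun (phi lam mu) P κ₃ p * (P p * dirD ez (fun q => (P q)⁻¹) p) ∧
    aFun (phi lam mu) P p = 0 ∧ bFun (phi lam mu) P p = 0 ∧
    P p * κ₃ p - deriv (deriv mu) p.2.2 =
      -(deriv mu p.2.2 * (P p * dirD ez (fun q => (P q)⁻¹) p)) := by
  have F := H.frame_split hs hU
  have sK : ContDiffOn ℝ ∞ (Kfun (phi lam mu) P κ₃) U :=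
    (smooth_dirD hU H.smooth_inv ez).neg.add
      (H.smooth_κ₃.mul (smooth_dirD hU hs.smooth_phi ez))
  have hP := H.P_ne hp
  obtain ⟨hK, ht⟩ := hC.center H hs hU hp
  have hf0 : f p ≠ 0 := fun h0 => by
    rw [h0, smul_zero] at ht
    have h1 := F.inner_tiltUnit_self (mu := mu) hp
    rw [tiltUnit, ht] at h1
    simp at h1
  have d : ∀ v, HasDir v (tilt mu (Xgamma P f) N) (Kfun (phi lam mu) P κ₃ p • dirD v f p +
      dirD v (Kfun (phi lam mu) P κ₃) p • f p) p := fun v =>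
    ((hasDir_of_smooth hU sK v hp).smul (hasDir_of_smooth hU H.smooth_f v hp)).congr hU
      (fun q hq => (hC.center H hs hU hq).2) hp
  have hPK := K_eq (P := P) (κ₃ := κ₃) hs hU hp
  refine ⟨?_, ?_, ?_⟩
  · have h := (F.tilt_x hs hp).unique (d ex)
    rw [← hPK, H.f_x hp, smul_smul, show P p * Kfun (phi lam mu) P κ₃ p * Real.cos (phi lam mu p) =
      Kfun (phi lam mu) P κ₃ p * (P p * Real.cos (phi lam mu p)) by ring, left_eq_add,
      smul_eq_zero] at h
    exact h.resolve_right hf0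
  · have h := (F.tilt_y hs hp).unique (d ey)
    rw [← hPK, H.f_y hp, smul_smul, show P p * Kfun (phi lam mu) P κ₃ p * Real.sin (phi lam mu p) =
      Kfun (phi lam mu) P κ₃ p * (P p * Real.sin (phi lam mu p)) by ring, left_eq_add,
      smul_eq_zero] at h
    exact h.resolve_right hf0
  · have h := (F.tilt_z hs hp).unique (d ez)
    have hft : f p = (Kfun (phi lam mu) P κ₃ p)⁻¹ • tilt mu (Xgamma P f) N p := by
      rw [ht, inv_smul_smul₀ hK]
    rw [hft, H.f_z hp] at h
    have Fr := H.isFrame hp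
    have g1 := congrArg (fun u => inner ℝ u (unitX (phi lam mu) P f p)) h
    have g2 := congrArg (fun u => inner ℝ u (unitY (phi lam mu) P f p)) h
    have g3 := congrArg (fun u => inner ℝ u (Xgamma P f p)) h
    have g4 := congrArg (fun u => inner ℝ u (N p)) h
    simp only [tilt, inner_add_left, inner_sub_left, real_inner_smul_left, Fr.i₁₁, Fr.i₂₂, Fr.i₃₃,
      Fr.i₄₄, Fr.i₁₂, Fr.i₁₃, Fr.i₁₄, Fr.i₂₁, Fr.i₂₃, Fr.i₂₄, Fr.i₃₁, Fr.i₃₂, Fr.i₃₄, Fr.i₄₁,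
      Fr.i₄₂, Fr.i₄₃] at g1 g2 g3 g4
    have hKz : dirD ez (Kfun (phi lam mu) P κ₃) p * (Kfun (phi lam mu) P κ₃ p)⁻¹ =
        P p * dirD ez (fun q => (P q)⁻¹) p := by linear_combination -g3 - hPK
    refine ⟨?_, ?_, ?_, ?_⟩
    · rw [← hKz]; field_simp
    · exact (mul_eq_zero.1 (show P p * aFun (phi lam mu) P p = 0 by linear_combination g1)
        ).resolve_left hP
    · exact (mul_eq_zero.1 (show P p * bFun (phi lam mu) P p = 0 by linear_combination g2)
        ).resolve_left hP
    · linear_combination g4 - deriv mu p.2.2 * hKz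

/-- The logarithmic z-derivatives of P and K are −τ and τ, so k = PK is constant. Then σμ_z − τ = k
and σ + μ_z τ = μ_zz determine σ and τ. Inserting them into the Gauss relation gives k² = −Q. -/
theorem invariants (hC : StructureC U f) (H : IsGuichardHypersurface U (phi lam mu) P κ₃ f N)
    (hs : IsSplitAngle U lam mu c₁ c₂) (hU : IsOpen U) (hUc : IsConnected U) {Q : ℝ}
    (hQ : IsSplitAngle.HasInvariant U mu c₁ Q) :
    ∃ k : ℝ, k ≠ 0 ∧ k ^ 2 = -Q ∧ ∀ p ∈ U,
      Kfun (phi lam mu) P κ₃ p = k * (P p)⁻¹ ∧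
      aFun (phi lam mu) P p = 0 ∧ bFun (phi lam mu) P p = 0 ∧
      P p * κ₃ p * (1 + deriv mu p.2.2 ^ 2) = deriv (deriv mu) p.2.2 + k * deriv mu p.2.2 ∧
      P p * dirD ez (fun q => (P q)⁻¹) p * (1 + deriv mu p.2.2 ^ 2) =
        deriv mu p.2.2 * deriv (deriv mu) p.2.2 - k := by
  have F := H.frame_split hs hU
  have h := fun p (hp : p ∈ U) => hC.derivatives H hs hU hp
  have sK : ContDiffOn ℝ ∞ (Kfun (phi lam mu) P κ₃) U :=
    (smooth_dirD hU H.smooth_inv ez).neg.add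
      (H.smooth_κ₃.mul (smooth_dirD hU hs.smooth_phi ez))
  obtain ⟨p₀, hp₀⟩ := hUc.nonempty
  have hk : ∀ p ∈ U, P p * Kfun (phi lam mu) P κ₃ p = P p₀ * Kfun (phi lam mu) P κ₃ p₀ :=
    fun p hp => by
      refine eq_of_partials_zero (h := fun q => P q * Kfun (phi lam mu) P κ₃ q)
        hU hUc ?_ ?_ ?_ hp hp₀ <;> intro q hq <;>
        refine ((hasDir_of_smooth hU H.smooth_P _ hq).mul
          (hasDir_of_smooth hU sK _ hq)).to_eq ?_ <;> obtain ⟨h1, h2, h3, h4, h5, h6⟩ := h q hq <;>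
        rw [H.dirD_P hU hq]
      · rw [h1, H.inv_x hq, h4]; ring
      · rw [h2, H.inv_y hq, h5]; ring
      · rw [h3]; ring
  set k := P p₀ * Kfun (phi lam mu) P κ₃ p₀ with hkdef
  have hστ : ∀ p ∈ U,
      P p * κ₃ p * (1 + deriv mu p.2.2 ^ 2) = deriv (deriv mu) p.2.2 + k * deriv mu p.2.2 ∧
      P p * dirD ez (fun q => (P q)⁻¹) p * (1 + deriv mu p.2.2 ^ 2) =
        deriv mu p.2.2 * deriv (deriv mu) p.2.2 - k := fun p hp => by
    have h1 := (h p hp).2.2.2.2.2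
    have h2 := K_eq (P := P) (κ₃ := κ₃) hs hU hp
    rw [hk p hp] at h2
    constructor
    · linear_combination h1 - deriv mu p.2.2 * h2
    · linear_combination deriv mu p.2.2 * h1 + h2
  refine ⟨k, mul_ne_zero (H.P_ne hp₀) (hC.center H hs hU hp₀).1, ?_, fun p hp => ⟨?_,
    (h p hp).2.2.2.1, (h p hp).2.2.2.2.1, hστ p hp⟩⟩
  · have g1 := (F.second_z_of_absq_zero subset_rfl hU
      (fun q hq => by rw [(h q hq).2.2.2.1, mul_zero])
      (fun q hq => by rw [(h q hq).2.2.2.2.1, mul_zero]) hp₀).1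
    have g2 := F.gauss_split hs hp₀
    rw [hs.phi_z hU hp₀] at g1
    rw [(h p₀ hp₀).2.2.2.1, (h p₀ hp₀).2.2.2.2.1] at g2
    have g3 := hQ _ (mem_projZ hp₀)
    obtain ⟨x1, x2⟩ := hστ p₀ hp₀
    have h0 := (one_add_sq_pos (deriv mu p₀.2.2)).ne'
    set σ := P p₀ * κ₃ p₀
    set τ := P p₀ * dirD ez (fun q => (P q)⁻¹) p₀
    set m := deriv mu p₀.2.2
    set n := deriv (deriv mu) p₀.2.2
    have x3 : (σ ^ 2 + τ ^ 2) * (1 + m ^ 2) = n ^ 2 + k ^ 2 := by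
      apply mul_right_cancel₀ h0
      linear_combination (σ * (1 + m ^ 2) + n + k * m) * x1 + (τ * (1 + m ^ 2) + m * n - k) * x2
    rw [← g3, g2]
    linear_combination -x3 - 2 * (1 + m ^ 2) * g1
  · have hP := H.P_ne hp
    rw [← hk p hp]
    field_simp

/-- The hypothesis is (log P)_z = (k − μ_z μ_zz) / (1 + μ_z²): the second term integrates to −½
log(1 + μ_z²), the first to kI. -/
theorem P_eq_exp (H : IsGuichardHypersurface U (phi lam mu) P κ₃ f N)
    (hs : IsSplitAngle U lam mu c₁ c₂) (hU : IsOpen U) (hUc : IsConnected U) {k : ℝ}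
    (h : ∀ p ∈ U, aFun (phi lam mu) P p = 0 ∧ bFun (phi lam mu) P p = 0 ∧
      P p * dirD ez (fun q => (P q)⁻¹) p * (1 + deriv mu p.2.2 ^ 2) =
        deriv mu p.2.2 * deriv (deriv mu) p.2.2 - k) {I : ℝ → ℝ}
    (hI : ∀ z ∈ projZ U, HasDerivAt I (1 + deriv mu z ^ 2)⁻¹ z) :
    ∃ C : ℝ, 0 < C ∧ ∀ p ∈ U, P p = C / √(1 + deriv mu p.2.2 ^ 2) * Real.exp (k * I p.2.2) := by
  obtain ⟨p₀, hp₀⟩ := hUc.nonempty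
  -- The claimed formula for P divided by C P; its partial derivatives vanish, and C is the inverse
  -- of its constant value.
  set g : Coord → ℝ := fun q =>
    (P q)⁻¹ * ((√(1 + deriv mu q.2.2 ^ 2))⁻¹ * Real.exp (k * I q.2.2)) with hg
  have hpos : ∀ q ∈ U, 0 < g q := fun q hq => by
    have := H.P_pos q hq
    have := Real.sqrt_pos.2 (one_add_sq_pos (deriv mu q.2.2))
    positivity
  have dE : ∀ v, ∀ q ∈ U, HasDir v (fun q => Real.exp (k * I q.2.2))
      (v.2.2 * (Real.exp (k * I q.2.2) * (k * (1 + deriv mu q.2.2 ^ 2)⁻¹))) q := fun v q hq =>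
    hasDir_profile (((hI _ (mem_projZ hq)).const_mul k).exp)
  have dg := fun v q (hq : q ∈ U) => (H.hasDir_inv (v := v) hU hq).mul
    ((IsGuichardFrame.hasDir_inv_sqrt (v := v) hs hU hq).mul (dE v q hq))
  have hconst : ∀ q ∈ U, g q = g p₀ := fun q hq => by
    refine eq_of_partials_zero hU hUc ?_ ?_ ?_ hq hp₀ <;> intro r hr <;>
      refine (dg _ r hr).to_eq ?_ <;> obtain ⟨h1, h2, h3⟩ := h r hr
    · rw [H.inv_x hr, h1]; simp
    · rw [H.inv_y hr, h2]; simp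
    · have h0 := (one_add_sq_pos (deriv mu r.2.2)).ne'
      have hP := H.P_ne hr
      have h4 : dirD ez (fun q => (P q)⁻¹) r = (deriv mu r.2.2 * deriv (deriv mu) r.2.2 - k) *
          (P r)⁻¹ / (1 + deriv mu r.2.2 ^ 2) := by
        rw [eq_div_iff h0, ← h3]; field_simp
      rw [h4]
      generalize (√(1 + deriv mu r.2.2 ^ 2))⁻¹ = s
      field_simp
      ring
  refine ⟨(g p₀)⁻¹, inv_pos.2 (hpos p₀ hp₀), fun p hp => ?_⟩
  rw [← hconst p hp, hg]
  have := H.P_ne hp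
  have := (Real.sqrt_pos.2 (one_add_sq_pos (deriv mu p.2.2))).ne'
  have := (Real.exp_pos (k * I p.2.2)).ne'
  simp only
  field_simp

theorem of_zero (hC : StructureC U f) (H : IsGuichardHypersurface U (phi lam mu) P κ₃ f N)
    (hs : IsSplitAngle U lam mu c₁ c₂) (hU : IsOpen U) (hUc : IsConnected U)
    (hmu : ∀ z ∈ projZ U, mu z = 0) :
    (∀ p ∈ U, κ₃ p = 0) ∧ IndepZ U (Xgamma P f) ∧ 0 < 1 - c₁ ^ 2 ∧
    ∃ ε : ℝ, (ε = 1 ∨ ε = -1) ∧ ∃ C : ℝ, 0 < C ∧ ∀ p ∈ U,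
      P p = C * Real.exp (ε * √(1 - c₁ ^ 2) * p.2.2) ∧
      Kfun (phi lam mu) P κ₃ p ≠ 0 ∧
      Kfun (phi lam mu) P κ₃ p = ε * √(1 - c₁ ^ 2) * (P p)⁻¹ ∧
      f p = (Kfun (phi lam mu) P κ₃ p)⁻¹ • Xgamma P f p ∧
      f p = (ε * (1 / √(1 - c₁ ^ 2)) * P p) • Xgamma P f p := by
  obtain ⟨k, hk0, hk, h⟩ := hC.invariants H hs hU hUc (IsSplitAngle.hasInvariant_of_zero hU hmu)
  rw [neg_sub] at hk
  have hz := fun z hz => IsSplitAngle.mu_z_of_zero hU hmu z hz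
  have hzz := fun z hz' => IsSplitAngle.mu_z_of_zero hU hz z hz'
  have hκ : ∀ p ∈ U, κ₃ p = 0 := fun p hp => by
    have := (h p hp).2.2.2.1
    rw [hz _ (mem_projZ hp), hzz _ (mem_projZ hp)] at this
    simpa [H.P_ne hp] using this
  obtain ⟨ε, hε, hkε⟩ := exists_sign_mul_sqrt hk0 hk
  have F := H.frame_split hs hU
  refine ⟨hκ, indepZ_of_dz fun q hq => ?_, by rw [← hk]; positivity, ε, hε, ?_⟩
  · refine (F.hasDir_e₃ hq).to_eq ?_
    rw [F.e₃_z q hq, (h q hq).2.1, (h q hq).2.2.1, hκ q hq]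
    simp
  obtain ⟨C, hC0, hPC⟩ := P_eq_exp H hs hU hUc (k := k) (I := fun z => z)
    (fun p hp => ⟨(h p hp).2.1, (h p hp).2.2.1, (h p hp).2.2.2.2⟩)
    (fun z hz' => by rw [hz z hz']; simpa using hasDerivAt_id' z)
  refine ⟨C, hC0, fun p hp => ?_⟩
  obtain ⟨hK, ht⟩ := hC.center H hs hU hp
  have hX : tilt mu (Xgamma P f) N p = Xgamma P f p := by
    rw [tilt, hz _ (mem_projZ hp)]; simp
  have hf : f p = (Kfun (phi lam mu) P κ₃ p)⁻¹ • Xgamma P f p := by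
    rw [← hX, ht, inv_smul_smul₀ hK]
  rw [← hkε]
  refine ⟨?_, hK, (h p hp).1, hf, ?_⟩
  · have := hPC p hp
    rw [hz _ (mem_projZ hp)] at this
    simpa using this
  · conv_lhs => rw [hf, (h p hp).1, mul_inv, inv_inv, sign_mul_inv hε hkε]

theorem of_ne_zero (hC : StructureC U f) (H : IsGuichardHypersurface U (phi lam mu) P κ₃ f N)
    (hs : IsSplitAngle U lam mu c₁ c₂) (hU : IsOpen U) (hUc : IsConnected U)
    (hmu : ∀ z ∈ projZ U, deriv mu z ≠ 0) :
    (∀ p ∈ U, dz κ₃ p ≠ 0) ∧ 0 < 1 + c₂ ^ 2 - c₁ ^ 2 ∧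
    ∃ ε c₄ : ℝ, (ε = 1 ∨ ε = -1) ∧ c₄ = √((1 + c₂ ^ 2) * (1 + c₂ ^ 2 - c₁ ^ 2)) ∧
      (∀ z₀ ∈ projZ U, ∃ C : ℝ, 0 < C ∧ ∀ p ∈ U,
        P p = C / √(1 + deriv mu p.2.2 ^ 2) *
          Real.exp (ε * c₄ * ∫ t in z₀..p.2.2, (1 + deriv mu t ^ 2)⁻¹)) ∧
      ∀ p ∈ U,
        κ₃ p = (ε * c₄ * deriv mu p.2.2 + deriv (deriv mu) p.2.2) /
          (1 + deriv mu p.2.2 ^ 2) * (P p)⁻¹ ∧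
        Kfun (phi lam mu) P κ₃ p ≠ 0 ∧
        Kfun (phi lam mu) P κ₃ p = ε * c₄ * (P p)⁻¹ ∧
        f p = -((Kfun (phi lam mu) P κ₃ p)⁻¹ • Avec (phi lam mu) P f N p) ∧
        f p = -((ε * (1 / c₄) * P p) • Avec (phi lam mu) P f N p) := by
  obtain ⟨k, hk0, hk, h⟩ := hC.invariants H hs hU hUc (hs.hasInvariant hU hmu)
  have hk' : k ^ 2 = (1 + c₂ ^ 2) * (1 + c₂ ^ 2 - c₁ ^ 2) := by rw [hk]; ring
  obtain ⟨ε, hε, hkε⟩ := exists_sign_mul_sqrt hk0 hk'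
  have hI := isOpen_projZ hU
  refine ⟨fun p hp => ?_, ?_, ε, _, hε, rfl, ?_⟩
  · rw [show dz κ₃ p = dirD ez κ₃ p from rfl, H.κ₃_z_split hs hU hp]
    exact neg_ne_zero.2 (mul_ne_zero (hmu _ (mem_projZ hp)) (inv_ne_zero (H.P_ne hp)))
  · rw [← mul_pos_iff_of_pos_left (one_add_sq_pos c₂), ← hk']
    positivity
  rw [← hkε]
  refine ⟨fun z₀ hz₀ => ?_, fun p hp => ?_⟩
  · exact P_eq_exp H hs hU hUc
      (fun p hp => ⟨(h p hp).2.1, (h p hp).2.2.1, (h p hp).2.2.2.2⟩)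
      (I := fun z => ∫ t in z₀..z, (1 + deriv mu t ^ 2)⁻¹)
      (fun z hz => hasDerivAt_integral (g := fun t => (1 + deriv mu t ^ 2)⁻¹) hI
        (ordConnected_projZ hUc) ((continuousOn_const.add
          ((smooth_deriv hI hs.smooth_mu).continuousOn.pow 2)).inv₀ fun t _ =>
            (one_add_sq_pos _).ne') hz₀ hz)
  obtain ⟨hK, ht⟩ := hC.center H hs hU hp
  have hP := H.P_ne hp
  have h0 := (one_add_sq_pos (deriv mu p.2.2)).ne'
  have hA : Avec (phi lam mu) P f N p = -tilt mu (Xgamma P f) N p := by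
    have : dz (phi lam mu) p = deriv mu p.2.2 := hs.phi_z hU hp
    simp only [Avec, tilt, this]
    module
  have hf : f p = -((Kfun (phi lam mu) P κ₃ p)⁻¹ • Avec (phi lam mu) P f N p) := by
    rw [hA, ht, smul_neg, neg_neg, inv_smul_smul₀ hK]
  refine ⟨?_, hK, (h p hp).1, hf, ?_⟩
  · have h1 := (h p hp).2.2.2.1
    field_simp
    linear_combination h1
  · conv_lhs => rw [hf, (h p hp).1, mul_inv, inv_inv, sign_mul_inv hε hkε]

end StructureC

end

end

end GuichardNet

theorem proposition4p2
    (U : Set Coord) (hUo : IsOpen U) (hUc : IsConnected U)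
    (lam : ℝ × ℝ → ℝ) (mu : ℝ → ℝ) (c₁ c₂ : ℝ)
    (hsplit : IsSplitAngle U lam mu c₁ c₂)
    (P κ₃ : Coord → ℝ) (f N : Coord → E4)
    (hf : IsGuichardHypersurface U (phi lam mu) P κ₃ f N) :
    -- structure (a)
    (∀ B : E4, StructureA U f B →
      ((∀ z ∈ projZ U, mu z = 0) →
        (∀ p ∈ U, κ₃ p = 0) ∧ c₁ ^ 2 = 1 ∧
        ∃ P₀ : ℝ, 0 < P₀ ∧ (∀ p ∈ U, P p = P₀) ∧
        ∃ ε : ℝ, (ε = 1 ∨ ε = -1) ∧ (∀ p ∈ U, Xgamma P f p = ε • B) ∧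
        ∀ T : E4 ≃ₗᵢ[ℝ] E4, T (ε • B) = !₂[0, 0, 0, 1] →
          ∃ (ft : Coord → EuclideanSpace ℝ (Fin 3)) (s : ℝ),
            IsSurfaceFamily U ft ∧ IndepZ U ft ∧
            ∀ p ∈ U, T (f p) = !₂[ft p 0, ft p 1, ft p 2, P₀ * p.2.2 + s]) ∧
      ((∀ z ∈ projZ U, deriv mu z ≠ 0) →
        ∃ C : ℝ, C ≠ 0 ∧
        (∀ p ∈ U, 0 < C * Real.cos (mu p.2.2) ∧ (P p)⁻¹ = C * Real.cos (mu p.2.2) ∧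
          κ₃ p = -(C * Real.sin (mu p.2.2))) ∧
        c₁ ^ 2 - c₂ ^ 2 - 1 = 0 ∧
        ∃ ε : ℝ, (ε = 1 ∨ ε = -1) ∧
        (∀ p ∈ U, -((√(1 + deriv mu p.2.2 ^ 2))⁻¹ • Avec (phi lam mu) P f N p) = ε • B) ∧
        ∀ T : E4 ≃ₗᵢ[ℝ] E4, T (ε • B) = !₂[0, 0, 0, 1] →
          ∃ (ft : Coord → EuclideanSpace ℝ (Fin 3)) (f4 : ℝ → ℝ),
            IsSurfaceFamily U ft ∧
            (∀ p ∈ U, T (f p) = !₂[ft p 0, ft p 1, ft p 2, f4 p.2.2]) ∧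
            ∀ p ∈ U, HasDerivAt f4 (P p / √(1 + deriv mu p.2.2 ^ 2)) p.2.2 ∧
              (0 < c₁ * Real.cos (mu p.2.2) →
                P p / √(1 + deriv mu p.2.2 ^ 2) = (C * c₁ * Real.cos (mu p.2.2) ^ 2)⁻¹))) ∧
    -- structure (b)
    (∀ (L : Submodule ℝ E4) (B : ℝ → E4), StructureB U f L B →
      ((∀ z ∈ projZ U, mu z = 0) →
        IndepZ U κ₃ ∧ IndepZ U P ∧ NotLocallyZero U κ₃ ∧
        (∀ p ∈ U, P p ^ 2 * (absq (phi lam mu) P p + κ₃ p ^ 2) = c₁ ^ 2 - 1) ∧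
        0 < c₁ ^ 2 - 1 ∧ NotLocallyZero U (absq (phi lam mu) P) ∧
        (∀ p ∈ U, Xgamma P f p = B p.2.2 ∨ Xgamma P f p = -B p.2.2) ∧
        (∀ z₀ : ℝ, ∃ T : E4 ≃ₗᵢ[ℝ] E4,
          (∀ v ∈ L, (T v) 2 = 0 ∧ (T v) 3 = 0) ∧
          (∀ p ∈ U, T (Xgamma P f p) =
            !₂[-Real.sin (√(c₁ ^ 2 - 1) * (p.2.2 - z₀)),
              Real.cos (√(c₁ ^ 2 - 1) * (p.2.2 - z₀)), 0, 0]) ∧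
          ∃ f1 f3 f4 : Coord → ℝ,
            (∀ p ∈ U, 0 < f1 p ∧ f1 p = P p / √(c₁ ^ 2 - 1)) ∧
            IndepZ U f1 ∧ IndepZ U f3 ∧ IndepZ U f4 ∧
            IsSurfaceFamily U (fun p => (!₂[f1 p, 0, f3 p, f4 p] : E4)) ∧
            ∀ p ∈ U, T (f p) =
              f1 p • !₂[Real.cos (√(c₁ ^ 2 - 1) * (p.2.2 - z₀)),
                Real.sin (√(c₁ ^ 2 - 1) * (p.2.2 - z₀)), 0, 0] + !₂[0, 0, f3 p, f4 p]) ∧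
        ¬ ∀ p ∈ U, kappa₁ (phi lam mu) P κ₃ p * dx (fun q => (P q)⁻¹) p = 0 ∧
          kappa₂ (phi lam mu) P κ₃ p * dy (fun q => (P q)⁻¹) p = 0) ∧
      ((∀ z ∈ projZ U, deriv mu z ≠ 0) →
        (∃ C D : Coord → ℝ, IndepZ U C ∧ IndepZ U D ∧
          ∀ p ∈ U, (P p)⁻¹ = C p * Real.cos (mu p.2.2) + D p * Real.sin (mu p.2.2) ∧
            κ₃ p = -(C p * Real.sin (mu p.2.2)) + D p * Real.cos (mu p.2.2) ∧
            C p ^ 2 * (c₁ ^ 2 - c₂ ^ 2 - 1) - D p ^ 2 * (c₂ ^ 2 + 1) =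
              absq (phi lam mu) P p) ∧
        0 < c₁ ^ 2 - c₂ ^ 2 - 1 ∧
        IndepZ U (absq (phi lam mu) P) ∧ NotLocallyZero U (absq (phi lam mu) P) ∧
        (∀ p ∈ U,
          -((√(1 + deriv mu p.2.2 ^ 2))⁻¹ • Avec (phi lam mu) P f N p) = B p.2.2 ∨
          -((√(1 + deriv mu p.2.2 ^ 2))⁻¹ • Avec (phi lam mu) P f N p) = -B p.2.2) ∧
        (∀ z₀ ∈ projZ U, ∃ (ρ : ℝ → ℝ) (T : E4 ≃ₗᵢ[ℝ] E4),
          ρ z₀ = 0 ∧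
          (∀ z ∈ projZ U, HasDerivAt ρ
            (√((1 + c₂ ^ 2) * (c₁ ^ 2 - c₂ ^ 2 - 1)) / (1 + deriv mu z ^ 2)) z) ∧
          (∀ v ∈ L, (T v) 2 = 0 ∧ (T v) 3 = 0) ∧
          (∀ p ∈ U,
            T (-((√(1 + deriv mu p.2.2 ^ 2))⁻¹ • Avec (phi lam mu) P f N p)) =
              !₂[-Real.sin (ρ p.2.2), Real.cos (ρ p.2.2), 0, 0]) ∧
          ∃ f1 f3 f4 : Coord → ℝ,
            (∀ p ∈ U, 0 < f1 p ∧
              f1 p = P p * √((1 + deriv mu p.2.2 ^ 2) /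
                ((1 + c₂ ^ 2) * (c₁ ^ 2 - c₂ ^ 2 - 1)))) ∧
            IsSurfaceFamily U (fun p => (!₂[f1 p, 0, f3 p, f4 p] : E4)) ∧
            ∀ p ∈ U, T (f p) =
              f1 p • !₂[Real.cos (ρ p.2.2), Real.sin (ρ p.2.2), 0, 0] +
                !₂[0, 0, f3 p, f4 p]) ∧
        ((¬ ∃ c : ℝ, ∀ q ∈ projXY U, lam q = c) →
          ¬ ∀ p ∈ U, kappa₁ (phi lam mu) P κ₃ p * dx (fun q => (P q)⁻¹) p = 0 ∧
            kappa₂ (phi lam mu) P κ₃ p * dy (fun q => (P q)⁻¹) p = 0))) ∧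
    -- structure (c)
    (StructureC U f →
      ((∀ z ∈ projZ U, mu z = 0) →
        (∀ p ∈ U, κ₃ p = 0) ∧ IndepZ U (Xgamma P f) ∧ 0 < 1 - c₁ ^ 2 ∧
        ∃ ε : ℝ, (ε = 1 ∨ ε = -1) ∧ ∃ C : ℝ, 0 < C ∧ ∀ p ∈ U,
          P p = C * Real.exp (ε * √(1 - c₁ ^ 2) * p.2.2) ∧
          Kfun (phi lam mu) P κ₃ p ≠ 0 ∧
          Kfun (phi lam mu) P κ₃ p = ε * √(1 - c₁ ^ 2) * (P p)⁻¹ ∧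
          f p = (Kfun (phi lam mu) P κ₃ p)⁻¹ • Xgamma P f p ∧
          f p = (ε * (1 / √(1 - c₁ ^ 2)) * P p) • Xgamma P f p) ∧
      ((∀ z ∈ projZ U, deriv mu z ≠ 0) →
        (∀ p ∈ U, dz κ₃ p ≠ 0) ∧ 0 < 1 + c₂ ^ 2 - c₁ ^ 2 ∧
        ∃ ε c₄ : ℝ, (ε = 1 ∨ ε = -1) ∧ c₄ = √((1 + c₂ ^ 2) * (1 + c₂ ^ 2 - c₁ ^ 2)) ∧
          (∀ z₀ ∈ projZ U, ∃ C : ℝ, 0 < C ∧ ∀ p ∈ U,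
            P p = C / √(1 + deriv mu p.2.2 ^ 2) *
              Real.exp (ε * c₄ * ∫ t in z₀..p.2.2, (1 + deriv mu t ^ 2)⁻¹)) ∧
          ∀ p ∈ U,
            κ₃ p = (ε * c₄ * deriv mu p.2.2 + deriv (deriv mu) p.2.2) /
              (1 + deriv mu p.2.2 ^ 2) * (P p)⁻¹ ∧
            Kfun (phi lam mu) P κ₃ p ≠ 0 ∧
            Kfun (phi lam mu) P κ₃ p = ε * c₄ * (P p)⁻¹ ∧
            f p = -((Kfun (phi lam mu) P κ₃ p)⁻¹ • Avec (phi lam mu) P f N p) ∧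
            f p = -((ε * (1 / c₄) * P p) • Avec (phi lam mu) P f N p))) := by
  exact ⟨fun B hB => ⟨hB.of_zero hf hsplit hUo hUc, hB.of_ne_zero hf hsplit hUo hUc⟩,
    fun L B hB => ⟨hB.of_zero hf hsplit hUo hUc, hB.of_ne_zero hf hsplit hUo hUc⟩,
    fun hC => ⟨hC.of_zero hf hsplit hUo hUc, hC.of_ne_zero hf hsplit hUo hUc⟩⟩
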